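/- Let $\mathcal H_P=\mathbb C^3$ with basis $|0\rangle,|1\rangle,|2\rangle$. A qutrit probe evolves by $\dot\rho=-i[\omega H,\rho]+L\rho L^\dagger-\tfrac12\{L^\dagger L,\rho\}$, where $$H=\begin{pmatrix}1&0&0\\0&-1&-1\\0&-1&-1\end{pmatrix},\qquad L=\begin{pmatrix}0&1&1\\0&0&1\\0&0&0\end{pmatrix}.$$ Let $\mathcal S$ be the real span of $\mathbb 1$, $L+L^\dagger$, $i(L-L^\dagger)$, $L^\dagger L$, let $\|\cdot\|$ be the operator norm, and $\|H-\mathcal S\|=\inf_{X\in\mathcal S}\|H-X\|$. Let $A^{(\ell)}$ denote $A$ acting on the $\ell$-th of several probes; ancillas are noiseless and carry no signal. 1. $H\notin\mathcal S$. With $S=\tfrac12\mathbb 1-L^\dagger L\in\mathcal S$ one has $H-S=\mathrm{diag}(\tfrac12,-\tfrac12,\tfrac12)$, and $\|H-\mathcal S\|=\min_{X\in\mathcal S}\|H-X\|=\|H-S\|=\tfrac12$. 2. The density matrices $\rho_0=\tfrac12(|0\rangle\langle0|+|2\rangle\langle2|)$ and $\rho_1=|1\rangle\langle1|$ satisfy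 $\mathrm{Tr}(\rho_0\rho_1)=0$. They are the unique pair of density matrices with $\mathrm{Tr}((\rho_0-\rho_1)H)=2\|H-\mathcal S\|$ and $\mathrm{Tr}((\rho_0-\rho_1)X)=0$ for all $X\in\mathcal S$. 3. In $\mathcal H_P^{\otimes4}\otimes\mathbb C^3$ let $$|0_L\rangle=\tfrac1{\sqrt6}\big((|0022\rangle+|2200\rangle)|0\rangle_A+(|0202\rangle+|2020\rangle)|1\rangle_A+(|0220\rangle+|2002\rangle)|2\rangle_A\big),\qquad |1_L\rangle=|1111\rangle|0\rangle_A .$$ These vectors are orthonormal. With $Q_0=\tfrac1{\sqrt{12}}(|0\rangle\langle0|-|2\rangle\langle2|)$ and $Q_1=0$ they satisfy the multi-probe condition: each $Q_k$ is Hermitian with $\mathrm{Tr}\,Q_k=\mathrm{Tr}(Q_kL)=0$, and for all $k,k'\in\{0,1\}$ and $\ell\ne\ell'$, tracing out everything except probes $\ell,\ell'$ gives $$\mathrm{Tr}_{\backslash\{\ell,\ell'\}}(|k_L\rangle\langle k'_L|)=\delta_{kk'}(\rho_k\otimes\rho_k-Q_k\otimes Q_k).$$ 4. Let $P=|0_L\rangle\langle0_L|+|1_L\rangle\langle1_L|$,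 $Z_L=|0_L\rangle\langle0_L|-|1_L\rangle\langle1_L|$, $m=4$. There is a quantum channel $\mathcal R$ with $P\mathcal R(\cdot)P=\mathcal R(\cdot)$, independent of $\omega$, $t$ and $n$, such that the operation $\mathcal C(X)=PXP+\mathcal R((\mathbb 1-P)X(\mathbb 1-P))$ has the following properties. (a) For every $\omega\in\mathbb R$ and every $\rho=P\rho P$, $K$ rounds of free evolution for time $t/K$ followed by $\mathcal C$, applied to $\rho$, converge as $K\to\infty$, for every $t\ge0$, to $\rho_L(t)$, where $\rho_L(0)=\rho$ and $\dot\rho_L=-i[\tfrac{\omega m}{2}Z_L,\rho_L]$. (b) Let $n\ge1$ and $N=4n$. Start $n$ such blocks in $\tfrac1{\sqrt2}(|0_L\rangle^{\otimes n}+|1_L\rangle^{\otimes n})$ and apply $K$ rounds of free evolution of all probes for time $t/K$ followed by $\mathcal C^{\otimes n}$. For every $t\ge0$ and $\omega$, the resulting states converge as $K\to\infty$ to a state $\rho_\omega(t)$ whose quantum Fisher information about $\omega$ is exactly $N^2t^2=4\|H-\mathcal S\|^2N^2t^2$. The quantum Fisher information of the $K$-round state also exists for each $K$ and converges to $N^2t^2$.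 Here the quantum Fisher information is $F(\rho_\omega)=\mathrm{Tr}(\rho_\omega\Lambda^2)$ with $\Lambda$ Hermitian and $\partial_\omega\rho_\omega=\tfrac12(\Lambda\rho_\omega+\rho_\omega\Lambda)$. 5. Let $W_0$ be the set of the six permutations of $0022$. Consider the codes $|0_L\rangle=\tfrac1{\sqrt6}\sum_{w\in W_0}|w\rangle|c(w)\rangle_A$, $|1_L\rangle=|1111\rangle|c(1111)\rangle_A$, where $c$ assigns to each string an element of a fixed orthonormal basis of a $D$-dimensional ancilla. The least $D$ for which some such code satisfies the multi-probe condition, with $\rho_0,\rho_1$ as above and some admissible $Q_0,Q_1$, is $3$. Moreover, form the graph on $W_0\cup\{1111\}$ in which distinct $w,w'$ are joined iff $B$ acting on some two distinct probes $\ell,\ell'$ has a nonzero matrix element between them, for some $B\in\mathrm{span}\{X\otimes\mathbb 1,\mathbb 1\otimes X,L^\dagger\otimes L:X\in\mathcal S\}$. Two strings are joined iff one arises from the other by swapping two sites with different entries, and the chromatic number of the graph is $3$. -/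

import Mathlib

open Filter Topology
open scoped Matrix Kronecker Matrix.Norms.L2Operator ComplexOrder

noncomputable section

namespace QutritSensing

/-- Operators (and density operators) on the Hilbert space with orthonormal basis `I`. The norm is
the operator norm of `ℂ^I`. -/
abbrev Op (I : Type) := Matrix I I ℂ

/-- Superoperators. -/
abbrev SuperOp (I : Type) := Op I →ₗ[ℂ] Op I

/-- The operator `|ψ⟩⟨φ|`. -/
def ketbra {I : Type} (ψ φ : I → ℂ) : Op I := Matrix.vecMulVec ψ (star φ)

/-! ### The Lindblad span and the distance of the Hamiltonian to it -/

/-- The Lindblad span of a single Lindblad operator: the real linear space of Hermitian operators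
spanned by `1`, `L + L†`, `i (L - L†)` and `L† L`. -/
def lindbladSpan {I : Type} [Fintype I] [DecidableEq I] (L : Op I) : Submodule ℝ (Op I) :=
  Submodule.span ℝ {1, L + Lᴴ, Complex.I • (L - Lᴴ), Lᴴ * L}

/-- `‖H - 𝒮‖ = inf_{S ∈ 𝒮} ‖H - S‖` in operator norm. -/
def lindbladDist {I : Type} [Fintype I] [DecidableEq I] (H L : Op I) : ℝ :=
  sInf ((fun S : Op I => ‖H - S‖) '' (lindbladSpan L : Set (Op I)))

/-- Density operators. -/
def IsDensity {I : Type} [Fintype I] (ρ : Op I) : Prop := ρ.PosSemidef ∧ ρ.trace = 1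

/-! ### Master equations -/

/-- The generator `ρ ↦ -i[ωH, ρ] + ∑ᵢ (Lᵢ ρ Lᵢ† - ½ {Lᵢ† Lᵢ, ρ})`. -/
def lindbladian {I κ : Type} [Fintype I] [Fintype κ] (H : Op I) (J : κ → Op I) (ω : ℝ) :
    SuperOp I where
  toFun ρ := (-Complex.I * ω) • (H * ρ - ρ * H) +
    ∑ i, (J i * ρ * (J i)ᴴ - (1 / 2 : ℂ) • ((J i)ᴴ * J i * ρ + ρ * ((J i)ᴴ * J i)))
  map_add' ρ σ := by
    simp only [mul_add, add_mul, add_sub_add_comm]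
    simp only [smul_add, smul_sub, Finset.sum_add_distrib, Finset.sum_sub_distrib]
    abel
  map_smul' c ρ := by
    simp only [Matrix.mul_smul, Matrix.smul_mul, RingHom.id_apply, smul_add, smul_sub,
      Finset.smul_sum, smul_comm c]

/-- The evolution for time `s` under `dρ/ds = 𝓛 ρ`, i.e. `exp (s 𝓛)`; the exponential is taken of
the matrix of `𝓛` in the basis of matrix units. -/
def evolution {I : Type} [Fintype I] [DecidableEq I] (𝓛 : SuperOp I) (s : ℝ) : SuperOp I :=
  Matrix.toLin (Matrix.stdBasis ℂ I I) (Matrix.stdBasis ℂ I I) (NormedSpace.exp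
    ((s : ℂ) • LinearMap.toMatrix (Matrix.stdBasis ℂ I I) (Matrix.stdBasis ℂ I I) 𝓛))

/-- The evolution starts at the identity. -/
theorem evolution_zero {I : Type} [Fintype I] [DecidableEq I] (𝓛 : SuperOp I) (ρ : Op I) :
    evolution 𝓛 0 ρ = ρ := by
  simp [evolution]

/-- The evolution solves the master equation. -/
theorem evolution_hasDerivAt {I : Type} [Fintype I] [DecidableEq I] (𝓛 : SuperOp I) (ρ : Op I)
    (s : ℝ) (a b : I) :
    HasDerivAt (fun u : ℝ => evolution 𝓛 u ρ a b) (𝓛 (evolution 𝓛 s ρ) a b) s := by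
  have h := hasDerivAt_exp_smul_const' (𝕂 := ℂ)
    (LinearMap.toMatrix (Matrix.stdBasis ℂ I I) (Matrix.stdBasis ℂ I I) 𝓛) (s : ℂ)
  have h2 := ((LinearMap.toContinuousLinearMap
    ((Matrix.entryLinearMap ℂ ℂ a b : Op I →ₗ[ℂ] ℂ) ∘ₗ LinearMap.applyₗ ρ ∘ₗ
      (Matrix.toLin (Matrix.stdBasis ℂ I I) (Matrix.stdBasis ℂ I I)).toLinearMap)).hasFDerivAt.comp_hasDerivAt
        (s : ℂ) h).comp_ofReal
  refine h2.congr_deriv ?_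
  simp [evolution, Matrix.toLin_mul (Matrix.stdBasis ℂ I I) (Matrix.stdBasis ℂ I I)
    (Matrix.stdBasis ℂ I I)]

/-! ### Channels and error correction -/

/-- Quantum channels (completely positive and trace preserving), in Kraus form. -/
def IsChannel {I : Type} [Fintype I] [DecidableEq I] (Φ : SuperOp I) : Prop :=
  ∃ (r : ℕ) (K : Fin r → Op I),
    (∀ X, Φ X = ∑ i, K i * X * (K i)ᴴ) ∧ ∑ i, (K i)ᴴ * K i = 1

/-- `X ↦ A X A`. -/
def sandwich {I : Type} [Fintype I] (A : Op I) : SuperOp I :=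
  LinearMap.mulLeft ℂ A ∘ₗ LinearMap.mulRight ℂ A

/-- The error-correcting operation `𝒫 + ℛ ∘ 𝒫_⊥` of a code projection `P` and a recovery `ℛ`. -/
def qecOp {I : Type} [Fintype I] [DecidableEq I] (P : Op I) (R : SuperOp I) : SuperOp I :=
  sandwich P + R ∘ₗ sandwich (1 - P)

/-- `K` equally spaced rounds in total time `t`: free evolution for time `t / K` followed by the
operation `C`. -/
def rounds {I : Type} [Fintype I] [DecidableEq I] (C 𝓛 : SuperOp I) (t : ℝ) (K : ℕ) : SuperOp I :=
  (C ∘ₗ evolution 𝓛 (t / K)) ^ K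

/-- `Φ^{⊗ n}`, acting on `n` copies of the space with basis `I`. -/
def tensorPower {I : Type} [Fintype I] [DecidableEq I] (n : ℕ) (Φ : SuperOp I) :
    SuperOp (Fin n → I) where
  toFun X := Matrix.of fun w w' =>
    ∑ a : Fin n → I, ∑ b : Fin n → I,
      (∏ j, Φ (Matrix.single (a j) (b j) 1) (w j) (w' j)) * X a b
  map_add' X Y := by
    ext w w'
    simp [mul_add, Finset.sum_add_distrib]
  map_smul' c X := by
    ext w w'
    simp [Finset.mul_sum, mul_left_comm]

/-! ### Quantum Fisher information -/

/-- `F` is the quantum Fisher information `Tr(ρ_ω Λ²)` of the family `ρ` at `ω`, where `Λ` is a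
symmetric logarithmic derivative: a Hermitian operator with `∂_ω ρ_ω = ½ (Λ ρ_ω + ρ_ω Λ)`. -/
def IsQFI {I : Type} [Fintype I] [DecidableEq I] (ρ : ℝ → Op I) (ω F : ℝ) : Prop :=
  ∃ Λ : Op I, Λ.IsHermitian ∧
    (∀ a b, HasDerivAt (fun x => ρ x a b) (((1 / 2 : ℂ) • (Λ * ρ ω + ρ ω * Λ)) a b) ω) ∧
    (ρ ω * Λ ^ 2).trace = (F : ℂ)

/-! ### Probes and ancillas

The basis of `m` `d`-level probes together with an ancilla with basis `α` is `(Fin m → Fin d) × α`. -/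

/-- `A^{(ℓ)}`: the operator `A` acting on the `ℓ`-th probe. -/
def onProbe {m d : ℕ} {α : Type} [DecidableEq α] (ℓ : Fin m) (A : Op (Fin d)) :
    Op ((Fin m → Fin d) × α) :=
  Matrix.of fun p q =>
    if (∀ k, k ≠ ℓ → p.1 k = q.1 k) ∧ p.2 = q.2 then A (p.1 ℓ) (q.1 ℓ) else 0

/-- The operator `B` on two probes acting on the `ℓ`-th and `ℓ'`-th ones of `m` probes. -/
def onTwoProbes {m d : ℕ} (ℓ ℓ' : Fin m) (B : Op (Fin d × Fin d)) : Op (Fin m → Fin d) :=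
  Matrix.of fun w w' =>
    if ∀ k, k ≠ ℓ → k ≠ ℓ' → w k = w' k then B (w ℓ, w ℓ') (w' ℓ, w' ℓ') else 0

/-- The partial trace over everything except the `ℓ`-th and `ℓ'`-th probes. -/
def twoProbeMarginal {m d : ℕ} {α : Type} [Fintype α] (ℓ ℓ' : Fin m)
    (X : Op ((Fin m → Fin d) × α)) : Op (Fin d × Fin d) :=
  Matrix.of fun p q =>
    ∑ w : Fin m → Fin d, ∑ w' : Fin m → Fin d, ∑ x : α,
      if w ℓ = p.1 ∧ w ℓ' = p.2 ∧ w' ℓ = q.1 ∧ w' ℓ' = q.2 ∧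
          (∀ k, k ≠ ℓ → k ≠ ℓ' → w k = w' k)
      then X (w, x) (w', x) else 0

/-- `B` acting on the `j`-th of `n` blocks. -/
def onBlock {I : Type} [DecidableEq I] {n : ℕ} (j : Fin n) (B : Op I) : Op (Fin n → I) :=
  Matrix.of fun w w' => if ∀ k, k ≠ j → w k = w' k then B (w j) (w' j) else 0

/-- The multi-probe condition for code words `ψ 0, ψ 1`, with operators `ρ k` and `Q k`. -/
def MultiProbeCondition {m d : ℕ} {α : Type} [Fintype α] (L : Op (Fin d))
    (ρ Q : Fin 2 → Op (Fin d)) (ψ : Fin 2 → (Fin m → Fin d) × α → ℂ) : Prop :=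
  (∀ k, (Q k).IsHermitian ∧ (Q k).trace = 0 ∧ (Q k * L).trace = 0) ∧
  ∀ (k k' : Fin 2) (ℓ ℓ' : Fin m), ℓ ≠ ℓ' →
    twoProbeMarginal ℓ ℓ' (ketbra (ψ k) (ψ k')) =
      if k = k' then ρ k ⊗ₖ ρ k - Q k ⊗ₖ Q k else 0

/-- The generator for one block of `m` probes with a noiseless ancilla. -/
def blockGenerator (m : ℕ) {d : ℕ} (α : Type) [Fintype α] [DecidableEq α] (H L : Op (Fin d))
    (ω : ℝ) : SuperOp ((Fin m → Fin d) × α) :=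
  lindbladian (∑ ℓ : Fin m, onProbe ℓ H) (fun ℓ : Fin m => onProbe ℓ L) ω

/-- The generator for `n` blocks, each consisting of `m` probes and a noiseless ancilla: all `m n`
probes evolve independently under the same single-probe master equation. -/
def arrayGenerator (n m : ℕ) {d : ℕ} (α : Type) [Fintype α] [DecidableEq α] (H L : Op (Fin d))
    (ω : ℝ) : SuperOp (Fin n → (Fin m → Fin d) × α) :=
  lindbladian (∑ j : Fin n, ∑ ℓ : Fin m, onBlock j (onProbe ℓ H))
    (fun p : Fin n × Fin m => onBlock p.1 (onProbe p.2 L)) ω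

/-- The projection onto the code space spanned by (orthonormal) code words. -/
def codeProj {I : Type} (ψ : Fin 2 → I → ℂ) : Op I := ketbra (ψ 0) (ψ 0) + ketbra (ψ 1) (ψ 1)

/-- The logical Pauli-Z operator. -/
def logicalZ {I : Type} (ψ : Fin 2 → I → ℂ) : Op I := ketbra (ψ 0) (ψ 0) - ketbra (ψ 1) (ψ 1)

/-- The logical GHZ state `(|0_L⟩^{⊗ n} + |1_L⟩^{⊗ n}) / √2`. -/
def ghz {I : Type} (ψ : Fin 2 → I → ℂ) (n : ℕ) : (Fin n → I) → ℂ :=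
  fun w => (1 / (Real.sqrt 2 : ℂ)) * (∏ j, ψ 0 (w j) + ∏ j, ψ 1 (w j))

/-! ### The qutrit model -/

def qutritH : Op (Fin 3) := !![1, 0, 0; 0, -1, -1; 0, -1, -1]

def qutritL : Op (Fin 3) := !![0, 1, 1; 0, 0, 1; 0, 0, 0]

def qutritS : Op (Fin 3) := (1 / 2 : ℂ) • 1 - qutritLᴴ * qutritL

/-- `ρ_0 = (|0⟩⟨0| + |2⟩⟨2|) / 2` and `ρ_1 = |1⟩⟨1|`. -/
def qutritRho : Fin 2 → Op (Fin 3) :=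
  ![Matrix.diagonal ![1 / 2, 0, 1 / 2], Matrix.diagonal ![0, 1, 0]]

/-- `Q_0 = (|0⟩⟨0| - |2⟩⟨2|) / √12` and `Q_1 = 0`. -/
def qutritQ : Fin 2 → Op (Fin 3) :=
  ![(1 / (Real.sqrt 12 : ℂ)) • Matrix.diagonal ![1, 0, -1], 0]

/-- The basis state `|w⟩_P |a⟩_A`. -/
def ket (w : Fin 4 → Fin 3) (a : Fin 3) : (Fin 4 → Fin 3) × Fin 3 → ℂ := Pi.single (w, a) 1

/-- The code words of the (4,1)-qutrit code. -/
def code41 : Fin 2 → (Fin 4 → Fin 3) × Fin 3 → ℂ :=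
  ![(1 / (Real.sqrt 6 : ℂ)) •
      ((ket ![0, 0, 2, 2] 0 + ket ![2, 2, 0, 0] 0) +
       (ket ![0, 2, 0, 2] 1 + ket ![2, 0, 2, 0] 1) +
       (ket ![0, 2, 2, 0] 2 + ket ![2, 0, 0, 2] 2)),
    ket ![1, 1, 1, 1] 0]

/-- The six strings with two `0`s and two `2`s. -/
def W₀ : Finset (Fin 4 → Fin 3) :=
  {w | (Finset.univ.filter fun ℓ => w ℓ = 0).card = 2 ∧
       (Finset.univ.filter fun ℓ => w ℓ = 2).card = 2}

/-- The construction with a general ancilla of dimension `D`: each string `w` is tagged by an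
ancilla basis state `|c w⟩`, so that `|0_L⟩ = 6^{-1/2} ∑_{w ∈ W₀} |w⟩|c w⟩` and
`|1_L⟩ = |1111⟩|c 1111⟩`. -/
def taggedCode {D : ℕ} (c : (Fin 4 → Fin 3) → Fin D) :
    Fin 2 → (Fin 4 → Fin 3) × Fin D → ℂ :=
  ![(1 / (Real.sqrt 6 : ℂ)) • ∑ w ∈ W₀, Pi.single (w, c w) 1,
    Pi.single (![1, 1, 1, 1], c ![1, 1, 1, 1]) 1]

/-- The two-probe space `𝒮₂ = span {S ⊗ 1, 1 ⊗ S, L† ⊗ L : S ∈ 𝒮}`. -/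
def twoProbeSpan {d : ℕ} (L : Op (Fin d)) : Submodule ℂ (Op (Fin d × Fin d)) :=
  Submodule.span ℂ
    ({X | ∃ S ∈ lindbladSpan L, X = S ⊗ₖ (1 : Op (Fin d)) ∨ X = (1 : Op (Fin d)) ⊗ₖ S} ∪ {Lᴴ ⊗ₖ L})

/-- The strings used by the code: `W₀` and `1111`. -/
abbrev CodeString := {w : Fin 4 → Fin 3 // w ∈ W₀ ∨ w = ![1, 1, 1, 1]}

/-- Two different strings are adjacent iff some `S₂ ∈ 𝒮₂`, placed on two different probes, has a
nonzero matrix element between them. -/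
def conflictGraph : SimpleGraph CodeString :=
  SimpleGraph.fromRel fun w w' =>
    ∃ B ∈ twoProbeSpan qutritL, ∃ ℓ ℓ' : Fin 4, ℓ ≠ ℓ' ∧ onTwoProbes ℓ ℓ' B w.1 w'.1 ≠ 0

end QutritSensing

end

open QutritSensing

/-!
The operator `ρ₀ - ρ₁` has trace norm `2` and annihilates the Lindblad span, while it pairs with the
Hamiltonian to `1`. This certifies that the distance is at least `1 / 2`, and equality in the trace
norm bound determines the supports of an optimal pair, hence the pair.

Since `ρ₀` and `ρ₁` agree on the Lindblad span and `Tr(Q_k L) = 0`, the multi-probe condition makes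
the jumps on different probes satisfy the Knill–Laflamme condition, and the recovery undoes them. To
first order in time a round of evolution and error correction therefore acts on the code space as
the logical Hamiltonian alone, and a Chernoff-type product formula gives convergence of `K` rounds
to the noiseless logical evolution at rate `1 / K`, locally uniformly in complex `ω`.

The quantum Fisher information is not continuous where the rank of the state drops, so its
convergence needs more than the convergence of states and of their derivatives. These give the lower
bound, through the variational formula `F(ρ) = sup_X (2 Tr(ρ' X) - Tr(ρ X²))`. For the upper bound,
pass to the frame rotating with the logical Hamiltonian, where the limit family is constant. There
the `K`-round states form a holomorphic family with oscillation `O(1 / K)` on a complex disc, and a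
nonnegative function holomorphic on the disc satisfies `|f'|² ≤ C f · osc f`. Hence the frame
contributes only `O(1 / K)` to the Fisher information.

If two strings of `W₀` differing by one swap shared an ancilla state, they would produce a
positive coherence in a two-probe marginal, where the multi-probe condition forces the value
`-|⟨0|Q₀|2⟩|²`. Three strings of `W₀` are pairwise related by swaps, so three ancilla states are
needed.
-/

namespace QutritSensing

/-! ### Product formulas in Banach algebras -/

section BanachAlgebra

variable {𝔸 : Type*} [NormedRing 𝔸]

theorem one_sub_add_mul_mul_pow_mul {R : Type*} [Ring R] {C T π : R} (hππ : π * π = π)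
    (hπC : π * C = C) (K : ℕ) :
    (1 - π + C * T * π) ^ K * π = (C * T) ^ K * π := by
  have hπ : ∀ K : ℕ, π * ((C * T) ^ K * π) = (C * T) ^ K * π
    | 0 => by simpa using hππ
    | K + 1 => by simp only [pow_succ', ← mul_assoc, hπC]
  induction K with
  | zero => simp
  | succ K ih =>
    rw [pow_succ', mul_assoc, ih, add_mul, sub_mul, mul_assoc (C * T), hπ, one_mul, sub_self,
      zero_add, pow_succ', mul_assoc, mul_assoc, mul_assoc]

theorem norm_natCast_inv_smul [NormedAlgebra ℝ 𝔸] (K : ℕ) (x : 𝔸) :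
    ‖(K : ℝ)⁻¹ • x‖ = ‖x‖ / K := by
  rw [norm_smul, norm_inv, Real.norm_natCast, inv_mul_eq_div]

variable [NormOneClass 𝔸]

theorem norm_pow_sub_pow_le {a b : 𝔸} {M : ℝ} (hM : 1 ≤ M) (ha : ‖a‖ ≤ M) (hb : ‖b‖ ≤ M)
    (K : ℕ) : ‖a ^ K - b ^ K‖ ≤ K * M ^ K * ‖a - b‖ := by
  induction K with
  | zero => simp
  | succ K ih =>
    have telescope : a ^ (K + 1) - b ^ (K + 1) = (a ^ K - b ^ K) * a + b ^ K * (a - b) := by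
      rw [pow_succ, pow_succ]
      noncomm_ring
    have hbK : ‖b ^ K‖ ≤ M ^ K := (norm_pow_le _ _).trans (by gcongr)
    calc ‖a ^ (K + 1) - b ^ (K + 1)‖
        ≤ ‖a ^ K - b ^ K‖ * ‖a‖ + ‖b ^ K‖ * ‖a - b‖ := by
          rw [telescope]
          exact (norm_add_le _ _).trans (add_le_add (norm_mul_le _ _) (norm_mul_le _ _))
      _ ≤ (K * M ^ K * ‖a - b‖) * M + M ^ K * M * ‖a - b‖ := by
          gcongr
          exact hbK.trans (le_mul_of_one_le_right (by positivity) hM)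
      _ = _ := by push_cast; ring

variable [NormedAlgebra ℝ 𝔸] [CompleteSpace 𝔸]

theorem norm_exp_sub_sum_range_le (x : 𝔸) (n : ℕ) :
    ‖NormedSpace.exp x - ∑ i ∈ Finset.range n, (i.factorial : ℝ)⁻¹ • x ^ i‖ ≤
      ‖x‖ ^ n * Real.exp ‖x‖ := by
  have hx := NormedSpace.exp_series_hasSum_exp' (𝕂 := ℝ) x
  have hnorm := NormedSpace.exp_series_hasSum_exp' (𝕂 := ℝ) ‖x‖
  rw [← Real.exp_eq_exp_ℝ] at hnorm
  have hterm : ∀ i, ‖((i + n).factorial : ℝ)⁻¹ • x ^ (i + n)‖ ≤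
      ‖x‖ ^ n * ((i.factorial : ℝ)⁻¹ • ‖x‖ ^ i) := fun i => by
    rw [norm_smul, norm_inv, Real.norm_natCast, smul_eq_mul]
    have hfac : ((i + n).factorial : ℝ)⁻¹ ≤ (i.factorial : ℝ)⁻¹ := by
      gcongr
      exact Nat.le_add_right i n
    calc _ ≤ (i.factorial : ℝ)⁻¹ * ‖x‖ ^ (i + n) :=
          mul_le_mul hfac (norm_pow_le _ _) (norm_nonneg _) (by positivity)
      _ = _ := by ring
  rw [← hx.tsum_eq, ← hx.summable.sum_add_tsum_nat_add n, add_sub_cancel_left]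
  exact tsum_of_norm_bounded (hnorm.mul_left _) hterm

theorem norm_exp_le (x : 𝔸) : ‖NormedSpace.exp x‖ ≤ Real.exp ‖x‖ := by
  simpa using norm_exp_sub_sum_range_le x 0

theorem norm_exp_sub_one_sub_le (x : 𝔸) :
    ‖NormedSpace.exp x - 1 - x‖ ≤ ‖x‖ ^ 2 * Real.exp ‖x‖ := by
  simpa [Finset.sum_range_succ, sub_sub] using norm_exp_sub_sum_range_le x 2

theorem norm_exp_natCast_inv_smul_sub_le {x : 𝔸} {c : ℝ} {K : ℕ} (hK : 1 ≤ K) (hx : ‖x‖ ≤ c) :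
    ‖NormedSpace.exp ((K : ℝ)⁻¹ • x) - 1 - (K : ℝ)⁻¹ • x‖ ≤
      c ^ 2 * Real.exp c / (K : ℝ) ^ 2 := by
  have hc : 0 ≤ c := (norm_nonneg x).trans hx
  have hxK : ‖x‖ / K ≤ c / K := by gcongr
  refine (norm_exp_sub_one_sub_le _).trans ?_
  rw [norm_natCast_inv_smul]
  calc (‖x‖ / K) ^ 2 * Real.exp (‖x‖ / K) ≤ (c / K) ^ 2 * Real.exp c := by
        gcongr
        exact hxK.trans (div_le_self hc (by exact_mod_cast hK))
    _ = _ := by ring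

theorem norm_pow_sub_exp_le {σ x : 𝔸} {c D : ℝ} {K : ℕ} (hK : 1 ≤ K) (hx : ‖x‖ ≤ c)
    (hσ : ‖σ - 1 - (K : ℝ)⁻¹ • x‖ ≤ D / (K : ℝ) ^ 2) :
    ‖σ ^ K - NormedSpace.exp x‖ ≤ (D + c ^ 2 * Real.exp c) * Real.exp (c + D) / K := by
  let _ : NormedAlgebra ℚ 𝔸 := NormedAlgebra.restrictScalars ℚ ℝ 𝔸
  have hK1 : (1 : ℝ) ≤ K := by exact_mod_cast hK
  have hK0 : (K : ℝ) ≠ 0 := by positivity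
  have hc : 0 ≤ c := (norm_nonneg x).trans hx
  have hD : 0 ≤ D := by
    simpa [div_mul_cancel₀ D (pow_ne_zero 2 hK0)] using
      mul_nonneg ((norm_nonneg _).trans hσ) (sq_nonneg (K : ℝ))
  set y := (K : ℝ)⁻¹ • x with hy
  have hyK : ‖y‖ ≤ c / K := by rw [hy, norm_natCast_inv_smul]; gcongr
  have hσM : ‖σ‖ ≤ Real.exp ((c + D) / K) :=
    calc ‖σ‖ = ‖1 + y + (σ - 1 - y)‖ := by congr 1; abel
      _ ≤ 1 + c / K + D / (K : ℝ) ^ 2 :=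
        norm_add₃_le.trans (by rw [norm_one]; gcongr)
      _ ≤ 1 + c / K + D / K := by
        gcongr
        exact le_self_pow₀ hK1 two_ne_zero
      _ = (c + D) / K + 1 := by ring
      _ ≤ _ := Real.add_one_le_exp _
  have hexpM : ‖NormedSpace.exp y‖ ≤ Real.exp ((c + D) / K) :=
    (norm_exp_le y).trans (Real.exp_le_exp.2 (hyK.trans (by gcongr; linarith)))
  have hdiff : ‖σ - NormedSpace.exp y‖ ≤ (D + c ^ 2 * Real.exp c) / (K : ℝ) ^ 2 :=
    calc ‖σ - NormedSpace.exp y‖ = ‖(σ - 1 - y) - (NormedSpace.exp y - 1 - y)‖ := by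
          congr 1; abel
      _ ≤ D / (K : ℝ) ^ 2 + c ^ 2 * Real.exp c / (K : ℝ) ^ 2 :=
        (norm_sub_le _ _).trans (add_le_add hσ (norm_exp_natCast_inv_smul_sub_le hK hx))
      _ = _ := by rw [add_div]
  have hexp : NormedSpace.exp x = NormedSpace.exp y ^ K := by
    rw [← NormedSpace.exp_nsmul, ← Nat.cast_smul_eq_nsmul ℝ, hy, smul_inv_smul₀ hK0]
  calc ‖σ ^ K - NormedSpace.exp x‖
      ≤ K * Real.exp ((c + D) / K) ^ K * ‖σ - NormedSpace.exp y‖ := by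
        rw [hexp]
        exact norm_pow_sub_pow_le (Real.one_le_exp (by positivity)) hσM hexpM K
    _ = K * Real.exp (c + D) * ‖σ - NormedSpace.exp y‖ := by
        rw [← Real.exp_nat_mul, mul_div_cancel₀ _ hK0]
    _ ≤ K * Real.exp (c + D) * ((D + c ^ 2 * Real.exp c) / (K : ℝ) ^ 2) := by gcongr
    _ = _ := by field_simp

theorem tendsto_one_add_smul_add_smul_pow (x y : 𝔸) :
    Tendsto (fun K : ℕ => (1 + (K : ℝ)⁻¹ • x + ((K : ℝ)⁻¹ ^ 2) • y) ^ K) atTop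
      (𝓝 (NormedSpace.exp x)) := by
  set E := (‖y‖ + ‖x‖ ^ 2 * Real.exp ‖x‖) * Real.exp (‖x‖ + ‖y‖)
  rw [tendsto_iff_norm_sub_tendsto_zero]
  refine squeeze_zero' (Eventually.of_forall fun _ => norm_nonneg _) ?_
    (tendsto_const_div_atTop_nhds_zero_nat E)
  filter_upwards [eventually_ge_atTop 1] with K hK
  refine norm_pow_sub_exp_le hK le_rfl ?_
  rw [add_assoc, add_sub_cancel_left, add_sub_cancel_left, norm_smul, norm_pow, norm_inv,
    Real.norm_natCast, inv_pow, inv_mul_eq_div]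

/-- Adding `1 - π` to `C exp(L/K) π` does not change its powers on the range of `π` and makes it a
perturbation of the identity, to which the product formula applies. -/
theorem exists_norm_zeno_pow_sub_exp_le {C π : 𝔸} (hπC : π * C = C) (hCπ : C * π = π) (l : ℝ) :
    ∃ E : ℝ, ∀ K : ℕ, 1 ≤ K → ∀ L : 𝔸, ‖L‖ ≤ l →
      ‖(C * NormedSpace.exp ((K : ℝ)⁻¹ • L)) ^ K * π - NormedSpace.exp (C * L * π) * π‖ ≤
        E / K := by
  set c := ‖C‖ * l * ‖π‖
  set D := ‖C‖ * (l ^ 2 * Real.exp l) * ‖π‖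
  refine ⟨(D + c ^ 2 * Real.exp c) * Real.exp (c + D) * ‖π‖, fun K hK L hL => ?_⟩
  have hππ : π * π = π := by nth_rw 2 [← hCπ]; rw [← mul_assoc, hπC, hCπ]
  set T := NormedSpace.exp ((K : ℝ)⁻¹ • L)
  have hCLπ : ‖C * L * π‖ ≤ c := norm_mul₃_le.trans (by simp only [c]; gcongr)
  have hstep : ‖(1 - π + C * T * π) - 1 - (K : ℝ)⁻¹ • (C * L * π)‖ ≤ D / (K : ℝ) ^ 2 :=
    calc _ = ‖C * (T - 1 - (K : ℝ)⁻¹ • L) * π‖ := by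
          simp only [mul_sub, sub_mul, mul_one, hCπ, mul_smul_comm, smul_mul_assoc]
          congr 1
          abel
      _ ≤ ‖C‖ * (l ^ 2 * Real.exp l / (K : ℝ) ^ 2) * ‖π‖ :=
        norm_mul₃_le.trans (by gcongr; exact norm_exp_natCast_inv_smul_sub_le hK hL)
      _ = _ := by ring
  calc _ = ‖((1 - π + C * T * π) ^ K - NormedSpace.exp (C * L * π)) * π‖ := by
        rw [sub_mul, one_sub_add_mul_mul_pow_mul hππ hπC]
    _ ≤ (D + c ^ 2 * Real.exp c) * Real.exp (c + D) / K * ‖π‖ :=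
      (norm_mul_le _ _).trans (by gcongr; exact norm_pow_sub_exp_le hK hCLπ hstep)
    _ = _ := by ring

end BanachAlgebra

/-! ### Nonnegative holomorphic functions -/

section Holomorphic

theorem sq_le_of_forall_nonneg_quadratic {a b M : ℝ} (hbM : |b| ≤ 2 * M)
    (h : ∀ x : ℝ, |x| ≤ 1 → 0 ≤ a + b * x + M * x ^ 2) : b ^ 2 ≤ 4 * M * a := by
  rcases (by linarith [abs_nonneg b] : 0 ≤ M).eq_or_lt with rfl | hM
  · simp [show b = 0 by simpa using hbM]
  · have hvertex := h (-b / (2 * M)) (by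
      rwa [abs_div, abs_neg, abs_of_pos (by positivity : 0 < 2 * M), div_le_one (by positivity)])
    have hvalue : a + b * (-b / (2 * M)) + M * (-b / (2 * M)) ^ 2 = a - b ^ 2 / (4 * M) := by
      field_simp
      ring
    rw [hvalue, sub_nonneg, div_le_iff₀ (by positivity)] at hvertex
    linarith

theorem im_deriv_eq_zero_of_forall_ofReal {f : ℂ → ℂ} {x : ℝ} (hf : DifferentiableAt ℂ f x)
    (hreal : ∀ y : ℝ, (f y).im = 0) : (deriv f x).im = 0 := by
  have him : HasDerivAt (fun y : ℝ => (f y).im) (deriv f x).im x :=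
    Complex.imCLM.hasFDerivAt.comp_hasDerivAt x hf.hasDerivAt.comp_ofReal
  simp only [hreal] at him
  exact him.unique (hasDerivAt_const x 0)

variable {f : ℂ → ℂ} (hf : Differentiable ℂ f) {c : ℂ} {ε : ℝ}
  (hε : ∀ z : ℂ, ‖z‖ ≤ 1 → ‖f z - c‖ ≤ ε)

include hf hε

theorem norm_deriv_zero_le_of_forall_norm_sub_le : ‖deriv f 0‖ ≤ ε := by
  simpa using Complex.norm_deriv_le_of_forall_mem_sphere_norm_le (f := fun z => f z - c) (c := 0)
    one_pos (hf.sub_const c).diffContOnCl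
    fun z hz => hε z (by simpa using (mem_sphere_zero_iff_norm.1 hz).le)

/-- The maximum principle bounds the second difference quotient by its values on the unit circle. -/
theorem exists_eq_add_deriv_mul_add_mul_sq :
    ∃ q : ℂ → ℂ, (∀ z, f z = f 0 + deriv f 0 * z + q z * z ^ 2) ∧
      ∀ z : ℂ, ‖z‖ ≤ 1 → ‖q z‖ ≤ 3 * ε := by
  have hdslope : ∀ g : ℂ → ℂ, Differentiable ℂ g → Differentiable ℂ (dslope g 0) := fun g hg => by
    rw [← differentiableOn_univ, Complex.differentiableOn_dslope univ_mem]
    exact hg.differentiableOn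
  set q := dslope (dslope f 0) 0
  have hq : Differentiable ℂ q := hdslope _ (hdslope f hf)
  have htaylor : ∀ z, f z = f 0 + deriv f 0 * z + q z * z ^ 2 := fun z => by
    have first := sub_smul_dslope f 0 z
    have second := sub_smul_dslope (dslope f 0) 0 z
    simp only [dslope_same, sub_zero, smul_eq_mul] at first second
    linear_combination -first - z * second
  refine ⟨q, htaylor, fun z hz => ?_⟩
  refine Complex.norm_le_of_forall_mem_frontier_norm_le (U := Metric.ball 0 1)
    Metric.isBounded_ball hq.diffContOnCl (fun w hw => ?_)
    (by rw [closure_ball _ one_ne_zero]; simpa using hz)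
  rw [frontier_ball _ one_ne_zero, mem_sphere_zero_iff_norm] at hw
  calc ‖q w‖ = ‖q w * w ^ 2‖ := by simp [hw]
    _ = ‖(f w - c) - (f 0 - c) - deriv f 0 * w‖ := by rw [htaylor w]; congr 1; ring
    _ ≤ ε + ε + ε * 1 := by
      refine (norm_sub_le _ _).trans (add_le_add ((norm_sub_le _ _).trans ?_) ?_)
      · exact add_le_add (hε w hw.le) (hε 0 (by simp))
      · rw [norm_mul, hw]
        gcongr
        exact norm_deriv_zero_le_of_forall_norm_sub_le hf hε
    _ = 3 * ε := by ring

theorem norm_deriv_sq_le_of_nonneg (hpos : ∀ x : ℝ, 0 ≤ f x) :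
    ‖deriv f 0‖ ^ 2 ≤ 12 * ε * ‖f 0‖ := by
  obtain ⟨q, htaylor, hq⟩ := exists_eq_add_deriv_mul_add_mul_sq hf hε
  have hre : ∀ x : ℝ, 0 ≤ (f x).re := fun x => (Complex.le_def.1 (hpos x)).1
  have him : ∀ x : ℝ, (f x).im = 0 := fun x => (Complex.le_def.1 (hpos x)).2.symm
  have hderiv : deriv f 0 = ((deriv f 0).re : ℂ) :=
    Complex.ext rfl (by simpa using im_deriv_eq_zero_of_forall_ofReal (x := 0) (hf _) him)
  have hvalue : f 0 = ((f 0).re : ℂ) := Complex.ext rfl (by simpa using him 0)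
  have hf0 : 0 ≤ (f 0).re := by simpa using hre 0
  have hbound : |(deriv f 0).re| ≤ ε :=
    (Complex.abs_re_le_norm _).trans (norm_deriv_zero_le_of_forall_norm_sub_le hf hε)
  have hquad : ∀ x : ℝ, |x| ≤ 1 →
      0 ≤ (f 0).re + (deriv f 0).re * x + 3 * ε * x ^ 2 := fun x hx => by
    have hrem : (q x * (x : ℂ) ^ 2).re ≤ 3 * ε * x ^ 2 := by
      refine (Complex.re_le_norm _).trans ?_
      rw [norm_mul, norm_pow, Complex.norm_real, Real.norm_eq_abs, sq_abs]
      gcongr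
      exact hq x (by simpa using hx)
    have hx0 := hre x
    rw [htaylor x, hderiv, Complex.add_re, Complex.add_re, ← Complex.ofReal_mul,
      Complex.ofReal_re] at hx0
    linarith
  rw [hderiv, hvalue, Complex.norm_real, Complex.norm_real, Real.norm_eq_abs, sq_abs,
    Real.norm_of_nonneg hf0]
  have := sq_le_of_forall_nonneg_quadratic (by linarith [abs_nonneg (deriv f 0).re]) hquad
  linarith

end Holomorphic

/-! ### Entries and the operator norm of matrices -/

section Entries

theorem hasDerivAt_matrix_iff {𝕜 m n E : Type*} [NontriviallyNormedField 𝕜] [Finite m] [Finite n]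
    [NormedAddCommGroup E] [NormedSpace 𝕜 E] {f : 𝕜 → Matrix m n E} {f' : Matrix m n E} {t : 𝕜} :
    HasDerivAt f f' t ↔ ∀ a b, HasDerivAt (fun s => f s a b) (f' a b) t := by
  cases nonempty_fintype m
  cases nonempty_fintype n
  exact hasDerivAt_pi.trans (forall_congr' fun _ => hasDerivAt_pi)

variable {𝕜 m n : Type*} [RCLike 𝕜] [Fintype n]

theorem norm_toLp_sq (v : n → 𝕜) : ((‖WithLp.toLp 2 v‖ ^ 2 : ℝ) : 𝕜) = star v ⬝ᵥ v := by
  rw [RCLike.ofReal_pow, ← inner_self_eq_norm_sq_to_K, EuclideanSpace.inner_eq_star_dotProduct,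
    dotProduct_comm]

variable [Fintype m] [DecidableEq n]

theorem norm_star_dotProduct_mulVec_le (A : Matrix m n 𝕜) (v : m → 𝕜) (w : n → 𝕜) :
    ‖star v ⬝ᵥ A *ᵥ w‖ ≤ ‖A‖ * ‖WithLp.toLp 2 v‖ * ‖WithLp.toLp 2 w‖ :=
  calc ‖star v ⬝ᵥ A *ᵥ w‖ = ‖inner 𝕜 (WithLp.toLp 2 v) (WithLp.toLp 2 (A *ᵥ w))‖ := by
        rw [EuclideanSpace.inner_eq_star_dotProduct, dotProduct_comm]
    _ ≤ ‖WithLp.toLp 2 v‖ * ‖WithLp.toLp 2 (A *ᵥ w)‖ := norm_inner_le_norm _ _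
    _ ≤ ‖WithLp.toLp 2 v‖ * (‖A‖ * ‖WithLp.toLp 2 w‖) := by
      gcongr
      exact Matrix.l2_opNorm_mulVec A (WithLp.toLp 2 w)
    _ = _ := by ring

theorem norm_entry_le_l2_opNorm (A : Matrix m n 𝕜) (a : m) (b : n) :
    ‖A a b‖ ≤ ‖A‖ := by
  classical
  have h := norm_star_dotProduct_mulVec_le A (Pi.single a 1) (Pi.single b 1)
  simpa [← Pi.single_star, EuclideanSpace.norm_eq, Pi.single_apply, apply_ite] using h

end Entries

/-! ### Exponentials of superoperators -/

section Superoperators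

theorem exp_apply_of_eigenvector {𝔸 E : Type*} [NormedRing 𝔸] [NormedAlgebra ℂ 𝔸]
    [CompleteSpace 𝔸] [NormedAddCommGroup E] [NormedSpace ℂ E] (f : 𝔸 →L[ℂ] E) {A : 𝔸} {μ : ℂ}
    (h : ∀ k : ℕ, f (A ^ k) = μ ^ k • f 1) :
    f (NormedSpace.exp A) = Complex.exp μ • f 1 := by
  have hleft := f.hasSum (NormedSpace.exp_series_hasSum_exp' (𝕂 := ℂ) A)
  have hright := (NormedSpace.exp_series_hasSum_exp' (𝕂 := ℂ) μ).smul_const (f 1)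
  rw [← Complex.exp_eq_exp_ℂ] at hright
  refine hleft.unique ?_
  convert hright using 2 with k
  rw [map_smul, h, smul_assoc]

variable {I : Type} [Fintype I] [DecidableEq I]

/-- The exponential of a superoperator, computed in the Banach algebra of continuous linear maps. -/
noncomputable def superExp (Φ : SuperOp I) : SuperOp I :=
  (NormedSpace.exp (Module.End.toContinuousLinearMap (Op I) Φ) : Op I →L[ℂ] Op I)

theorem toContinuousLinearMap_superExp (Φ : SuperOp I) :
    Module.End.toContinuousLinearMap (Op I) (superExp Φ) =
      NormedSpace.exp (Module.End.toContinuousLinearMap (Op I) Φ) :=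
  ContinuousLinearMap.coe_injective rfl

theorem evolution_eq_superExp (𝓛 : SuperOp I) (s : ℝ) :
    evolution 𝓛 s = superExp (s • 𝓛) := by
  set b := Matrix.stdBasis ℂ I I
  set e := (LinearMap.toMatrixAlgEquiv b).symm.trans (Module.End.toContinuousLinearMap (Op I))
  have he : Continuous e := e.toLinearMap.continuous_of_finiteDimensional
  have hgen : e ((s : ℂ) • LinearMap.toMatrixAlgEquiv b 𝓛) =
      Module.End.toContinuousLinearMap (Op I) (s • 𝓛) := by
    rw [map_smul, AlgEquiv.trans_apply, AlgEquiv.symm_apply_apply]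
    rfl
  apply (Module.End.toContinuousLinearMap (Op I)).injective
  rw [toContinuousLinearMap_superExp, ← hgen]
  exact NormedSpace.map_exp_of_mem_ball (𝕂 := ℂ) e he _
    (by simp [NormedSpace.expSeries_radius_eq_top])

theorem superExp_apply_of_eigenvector {Φ : SuperOp I} {ρ : Op I} {μ : ℂ} (h : Φ ρ = μ • ρ) :
    superExp Φ ρ = Complex.exp μ • ρ := by
  refine exp_apply_of_eigenvector (ContinuousLinearMap.apply ℂ (Op I) ρ) fun k => ?_
  induction k with
  | zero => simp
  | succ k ih =>
    have hΦ : Module.End.toContinuousLinearMap (Op I) Φ ρ = μ • ρ := h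
    simp only [ContinuousLinearMap.apply_apply, one_apply_eq_self] at ih ⊢
    rw [pow_succ, mul_apply_eq_comp, hΦ, map_smul, ih, smul_smul, pow_succ']

/-- Frequent application of `C` projects the free evolution onto the range of a projection `π`
on which `C` acts trivially. -/
theorem exists_norm_rounds_sub_superExp_le [Nonempty I] {C π : SuperOp I} (hπC : π * C = C)
    (hCπ : C * π = π) (l : ℝ) {ρ : Op I} (hρ : π ρ = ρ) :
    ∃ E : ℝ, ∀ K : ℕ, 1 ≤ K → ∀ 𝓛 : SuperOp I, ‖Module.End.toContinuousLinearMap (Op I) 𝓛‖ ≤ l →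
      ‖((C * superExp ((K : ℝ)⁻¹ • 𝓛)) ^ K) ρ - superExp (C * 𝓛 * π) ρ‖ ≤ E / K := by
  set e := Module.End.toContinuousLinearMap (𝕜 := ℂ) (Op I)
  obtain ⟨E, hE⟩ := exists_norm_zeno_pow_sub_exp_le (C := e C) (π := e π)
    (by rw [← map_mul, hπC]) (by rw [← map_mul, hCπ]) l
  refine ⟨E * ‖ρ‖, fun K hK 𝓛 h𝓛 => ?_⟩
  have happly : ((C * superExp ((K : ℝ)⁻¹ • 𝓛)) ^ K) ρ - superExp (C * 𝓛 * π) ρ =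
      ((e C * NormedSpace.exp ((K : ℝ)⁻¹ • e 𝓛)) ^ K * e π -
        NormedSpace.exp (e C * e 𝓛 * e π) * e π) ρ := by
    have hsmul : (K : ℝ)⁻¹ • e 𝓛 = e ((K : ℝ)⁻¹ • 𝓛) := rfl
    have heρ : e π ρ = ρ := hρ
    rw [hsmul, ← map_mul, ← map_mul, ← toContinuousLinearMap_superExp,
      ← toContinuousLinearMap_superExp, ← map_mul, ← map_pow, sub_apply,
      mul_apply_eq_comp, mul_apply_eq_comp, heρ]
    rfl
  rw [happly, mul_div_right_comm]
  exact ContinuousLinearMap.le_of_opNorm_le _ (hE K hK _ h𝓛) ρ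

theorem eq_evolution_of_hasDerivAt (𝓛 : SuperOp I) {y : ℝ → Op I}
    (hy : ∀ s a b, HasDerivAt (fun u => y u a b) (𝓛 (y s) a b) s) (s : ℝ) :
    y s = evolution 𝓛 s (y 0) := by
  set f : Op I →L[ℝ] Op I := (Module.End.toContinuousLinearMap (Op I) 𝓛).restrictScalars ℝ
  refine congrFun (ODE_solution_unique_univ (v := fun _ => f) (s := fun _ => Set.univ)
    (K := ‖f‖₊) (t₀ := 0) (f := y) (g := fun u => evolution 𝓛 u (y 0))
    (fun _ => f.lipschitz.lipschitzOnWith) (fun u => ⟨?_, trivial⟩) (fun u => ⟨?_, trivial⟩) ?_) s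
  · exact hasDerivAt_matrix_iff.2 fun a b => hy u a b
  · exact hasDerivAt_matrix_iff.2 fun a b => evolution_hasDerivAt 𝓛 (y 0) u a b
  · simp [evolution_zero]

end Superoperators

/-! ### Positivity of Lindblad evolutions -/

section Positivity

variable {I κ : Type} [Fintype I] [Fintype κ] {H : Op I} (J : κ → Op I) (ω : ℝ)

/-- The non-Hermitian generator `G` for which a Lindbladian reads `X ↦ G X + X G† + ∑ᵢ Jᵢ X Jᵢ†`. -/
noncomputable def noJumpGenerator (H : Op I) : Op I :=
  (-Complex.I * ω) • H - (1 / 2 : ℂ) • ∑ i, (J i)ᴴ * J i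

variable {J ω}

theorem lindbladian_apply_eq_noJumpGenerator (hH : H.IsHermitian) (X : Op I) :
    lindbladian H J ω X = noJumpGenerator J ω H * X + X * (noJumpGenerator J ω H)ᴴ +
      ∑ i, J i * X * (J i)ᴴ := by
  have hGH : (noJumpGenerator J ω H)ᴴ =
      (Complex.I * ω) • H - (1 / 2 : ℂ) • ∑ i, (J i)ᴴ * J i := by
    rw [noJumpGenerator, Matrix.conjTranspose_sub, Matrix.conjTranspose_smul,
      Matrix.conjTranspose_smul, hH.eq, Matrix.conjTranspose_sum]
    simp
  rw [hGH]
  simp only [noJumpGenerator, lindbladian, LinearMap.coe_mk, AddHom.coe_mk,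
    Finset.sum_sub_distrib, ← Finset.smul_sum, Finset.sum_add_distrib, sub_mul, mul_sub,
    Matrix.smul_mul, Matrix.mul_smul, Finset.sum_mul, Finset.mul_sum, smul_sub, smul_add, neg_mul,
    neg_smul]
  abel

theorem posSemidef_euler_step (hH : H.IsHermitian) {h : ℝ} (hh : 0 ≤ h) {X : Op I}
    (hX : X.PosSemidef) :
    (X + h • lindbladian H J ω X +
      h ^ 2 • (noJumpGenerator J ω H * X * (noJumpGenerator J ω H)ᴴ)).PosSemidef := by
  classical
  set G := noJumpGenerator J ω H with hG
  have hfactor : X + h • lindbladian H J ω X + h ^ 2 • (G * X * Gᴴ) =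
      (1 + h • G) * X * (1 + h • G)ᴴ + h • ∑ i, J i * X * (J i)ᴴ := by
    rw [lindbladian_apply_eq_noJumpGenerator hH, ← hG]
    simp only [Matrix.conjTranspose_add, Matrix.conjTranspose_smul, Matrix.conjTranspose_one,
      star_trivial, add_mul, mul_add, one_mul, mul_one, Matrix.smul_mul, Matrix.mul_smul, smul_add,
      smul_smul, pow_two]
    abel
  rw [hfactor]
  refine (hX.mul_mul_conjTranspose_same _).add (Matrix.PosSemidef.smul ?_ hh)
  exact Matrix.posSemidef_sum _ fun i _ => hX.mul_mul_conjTranspose_same _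

theorem posSemidef_evolution [DecidableEq I] [Nonempty I] (hH : H.IsHermitian) {s : ℝ} (hs : 0 ≤ s)
    {ρ : Op I} (hρ : ρ.PosSemidef) : (evolution (lindbladian H J ω) s ρ).PosSemidef := by
  set e := Module.End.toContinuousLinearMap (𝕜 := ℂ) (Op I)
  set G := noJumpGenerator J ω H
  set 𝓛 := e (lindbladian H J ω)
  set Q := e (LinearMap.mulLeft ℂ G ∘ₗ LinearMap.mulRight ℂ Gᴴ)
  set step : ℕ → Op I →L[ℂ] Op I := fun K =>
    1 + (K : ℝ)⁻¹ • (s • 𝓛) + ((K : ℝ)⁻¹ ^ 2) • (s ^ 2 • Q)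
  have hlim : Tendsto (fun K => (step K ^ K) ρ) atTop
      (𝓝 (evolution (lindbladian H J ω) s ρ)) := by
    rw [evolution_eq_superExp]
    exact ((ContinuousLinearMap.apply ℂ (Op I) ρ).continuous.tendsto _).comp
      (tendsto_one_add_smul_add_smul_pow (s • 𝓛) (s ^ 2 • Q))
  have hpos : ∀ K k : ℕ, ((step K ^ k) ρ).PosSemidef := fun K k => by
    induction k with
    | zero => simpa using hρ
    | succ k ih =>
      have hnext := posSemidef_euler_step (J := J) (ω := ω) hH
        (by positivity : 0 ≤ (K : ℝ)⁻¹ * s) ih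
      rw [mul_pow, ← smul_smul, ← smul_smul, mul_assoc] at hnext
      rwa [pow_succ']
  open scoped MatrixOrder in
  exact Matrix.nonneg_iff_posSemidef.1
    (isClosed_Ici.mem_of_tendsto hlim (.of_forall fun K => (hpos K K).nonneg))

end Positivity

/-! ### Independent blocks -/

section Blocks

variable {I κ : Type} {n : ℕ}

/-- The product operator `x₁ ⊗ ⋯ ⊗ xₙ` on `n` blocks, as a multilinear function of its factors. -/
def tprod : MultilinearMap ℂ (fun _ : Fin n => Op I) (Op (Fin n → I)) :=
  MultilinearMap.pi fun w => MultilinearMap.pi fun w' =>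
    (MultilinearMap.mkPiAlgebra ℂ (Fin n) ℂ).compLinearMap fun j =>
      Matrix.entryLinearMap ℂ ℂ (w j) (w' j)

theorem tprod_apply (x : Fin n → Op I) (w w' : Fin n → I) :
    tprod x w w' = ∏ j, x j (w j) (w' j) :=
  rfl

theorem tprod_ketbra (ψ φ : I → ℂ) :
    tprod (fun _ : Fin n => ketbra ψ φ) =
      ketbra (fun w => ∏ j, ψ (w j)) (fun w => ∏ j, φ (w j)) := by
  ext w w'
  simp [tprod_apply, ketbra, Matrix.vecMulVec_apply, Finset.prod_mul_distrib]

theorem conjTranspose_tprod (x : Fin n → Op I) : (tprod x)ᴴ = tprod fun j => (x j)ᴴ := by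
  ext w w'
  simp [tprod_apply]

theorem tprod_mul [Fintype I] (x y : Fin n → Op I) : tprod x * tprod y = tprod (x * y) := by
  classical
  ext w w'
  simp [tprod_apply, Matrix.mul_apply, Finset.prod_univ_sum, Finset.prod_mul_distrib]

variable [DecidableEq I]

theorem onBlock_eq_tprod (j : Fin n) (B : Op I) :
    onBlock j B = tprod (Function.update 1 j B) := by
  ext w w'
  rw [tprod_apply, ← Finset.mul_prod_erase _ _ (Finset.mem_univ j), Function.update_self,
    Finset.prod_congr rfl fun k hk => by
      rw [Function.update_of_ne (Finset.ne_of_mem_erase hk), Pi.one_apply, Matrix.one_apply]]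
  simp [onBlock, Finset.prod_ite_zero]

theorem conjTranspose_onBlock (j : Fin n) (B : Op I) : (onBlock j B)ᴴ = onBlock j Bᴴ := by
  rw [onBlock_eq_tprod, onBlock_eq_tprod, conjTranspose_tprod]
  congr 1
  funext k
  rcases eq_or_ne k j with rfl | hk
  · simp
  · simp [Function.update_of_ne hk]

variable [Fintype κ]

theorem onBlock_sum (j : Fin n) (B : κ → Op I) :
    onBlock j (∑ i, B i) = ∑ i, onBlock j (B i) := by
  simp only [onBlock_eq_tprod, MultilinearMap.map_update_sum]

variable [Fintype I]

theorem onBlock_mul_tprod (j : Fin n) (B : Op I) (x : Fin n → Op I) :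
    onBlock j B * tprod x = tprod (Function.update x j (B * x j)) := by
  rw [onBlock_eq_tprod, tprod_mul]
  congr 1
  funext k
  rcases eq_or_ne k j with rfl | hk
  · simp
  · simp [Function.update_of_ne hk]

theorem tprod_mul_onBlock (j : Fin n) (B : Op I) (x : Fin n → Op I) :
    tprod x * onBlock j B = tprod (Function.update x j (x j * B)) := by
  rw [onBlock_eq_tprod, tprod_mul]
  congr 1
  funext k
  rcases eq_or_ne k j with rfl | hk
  · simp
  · simp [Function.update_of_ne hk]

theorem superOp_apply_eq_sum (Φ : SuperOp I) (X : Op I) (a b : I) :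
    Φ X a b = ∑ p, ∑ q, Φ (Matrix.single p q 1) a b * X p q := by
  conv_lhs => rw [Matrix.matrix_eq_sum_single X]
  simp only [map_sum, Matrix.sum_apply]
  refine Finset.sum_congr rfl fun p _ => Finset.sum_congr rfl fun q _ => ?_
  rw [← mul_one (X p q), ← smul_eq_mul, ← Matrix.smul_single, map_smul, Matrix.smul_apply,
    smul_eq_mul, smul_eq_mul, mul_one, mul_comm]

theorem tensorPower_tprod (Φ : SuperOp I) (x : Fin n → Op I) :
    tensorPower n Φ (tprod x) = tprod fun j => Φ (x j) := by
  ext w w'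
  simp only [tensorPower, LinearMap.coe_mk, AddHom.coe_mk, Matrix.of_apply, tprod_apply,
    ← Finset.prod_mul_distrib, superOp_apply_eq_sum Φ (x _), Finset.prod_univ_sum,
    Fintype.piFinset_univ]

theorem lindbladian_tprod (H : Op I) (J : κ → Op I) (ω : ℝ) (x : Fin n → Op I) :
    lindbladian (∑ j : Fin n, onBlock j H) (fun p : Fin n × κ => onBlock p.1 (J p.2)) ω (tprod x) =
      ∑ j, tprod (Function.update x j (lindbladian H J ω (x j))) := by
  have hjump : ∀ (j : Fin n) (i : κ), onBlock j (J i) * tprod x * (onBlock j (J i))ᴴ =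
      tprod (Function.update x j (J i * x j * (J i)ᴴ)) := fun j i => by
    simp [conjTranspose_onBlock, onBlock_mul_tprod, tprod_mul_onBlock]
  have hleft : ∀ (j : Fin n) (i : κ), (onBlock j (J i))ᴴ * onBlock j (J i) * tprod x =
      tprod (Function.update x j ((J i)ᴴ * J i * x j)) := fun j i => by
    simp [conjTranspose_onBlock, onBlock_mul_tprod, mul_assoc]
  have hright : ∀ (j : Fin n) (i : κ), tprod x * ((onBlock j (J i))ᴴ * onBlock j (J i)) =
      tprod (Function.update x j (x j * ((J i)ᴴ * J i))) := fun j i => by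
    simp [conjTranspose_onBlock, tprod_mul_onBlock, ← mul_assoc]
  simp only [lindbladian, LinearMap.coe_mk, AddHom.coe_mk, Fintype.sum_prod_type, hjump, hleft,
    hright]
  simp only [Finset.sum_mul, Finset.mul_sum, onBlock_mul_tprod, tprod_mul_onBlock,
    ← Finset.sum_sub_distrib, Finset.smul_sum, ← Finset.sum_add_distrib,
    MultilinearMap.map_update_add, MultilinearMap.map_update_sub, MultilinearMap.map_update_sum,
    MultilinearMap.map_update_smul]

theorem evolution_tprod (H : Op I) (J : κ → Op I) (ω s : ℝ) (x : Fin n → Op I) :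
    evolution (lindbladian (∑ j : Fin n, onBlock j H)
        (fun p : Fin n × κ => onBlock p.1 (J p.2)) ω) s (tprod x) =
      tprod fun j => evolution (lindbladian H J ω) s (x j) := by
  have hunique := eq_evolution_of_hasDerivAt (lindbladian (∑ j : Fin n, onBlock j H)
    (fun p : Fin n × κ => onBlock p.1 (J p.2)) ω)
    (y := fun u => tprod fun j => evolution (lindbladian H J ω) u (x j)) (fun u a b => ?_) s
  · rw [hunique]; simp [evolution_zero]
  · have hleibniz := HasDerivAt.fun_finsetProd (u := Finset.univ) fun j (_ : j ∈ Finset.univ) =>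
      evolution_hasDerivAt (lindbladian H J ω) (x j) u (a j) (b j)
    simp only [tprod_apply]
    refine hleibniz.congr_deriv ?_
    rw [lindbladian_tprod, Matrix.sum_apply]
    refine Finset.sum_congr rfl fun j _ => ?_
    rw [tprod_apply, ← Finset.mul_prod_erase _ _ (Finset.mem_univ j), Function.update_self,
      smul_eq_mul, mul_comm]
    congr 1
    exact Finset.prod_congr rfl fun k hk => by
      rw [Function.update_of_ne (Finset.ne_of_mem_erase hk)]

theorem rounds_tprod {m d : ℕ} {α : Type} [Fintype α] [DecidableEq α] (H L : Op (Fin d))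
    (C : SuperOp ((Fin m → Fin d) × α)) (ω t : ℝ) (K : ℕ)
    (x : Fin n → Op ((Fin m → Fin d) × α)) :
    rounds (tensorPower n C) (arrayGenerator n m α H L ω) t K (tprod x) =
      tprod fun j => rounds C (blockGenerator m α H L ω) t K (x j) := by
  have hgen : arrayGenerator n m α H L ω = lindbladian
      (∑ j : Fin n, onBlock j (∑ ℓ : Fin m, onProbe ℓ H))
      (fun p : Fin n × Fin m => onBlock p.1 (onProbe p.2 L)) ω := by
    simp only [arrayGenerator, onBlock_sum]
  have hpow : ∀ k : ℕ, ((tensorPower n C ∘ₗ evolution (arrayGenerator n m α H L ω) (t / K)) ^ k)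
      (tprod x) = tprod fun j =>
        ((C ∘ₗ evolution (blockGenerator m α H L ω) (t / K)) ^ k) (x j) := fun k => by
    induction k with
    | zero => simp
    | succ k ih =>
      rw [pow_succ', Module.End.mul_apply, ih, LinearMap.comp_apply, hgen,
        evolution_tprod _ (fun ℓ => onProbe ℓ L), tensorPower_tprod]
      simp only [pow_succ', Module.End.mul_apply, LinearMap.comp_apply, blockGenerator]
  exact hpow K

theorem tensorPower_eq_sum_kraus {Φ : SuperOp I} {V : κ → Op I}
    (hV : ∀ X, Φ X = ∑ i, V i * X * (V i)ᴴ) (X : Op (Fin n → I)) :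
    tensorPower n Φ X = ∑ i : Fin n → κ,
      tprod (fun j => V (i j)) * X * (tprod fun j => V (i j))ᴴ := by
  classical
  have hentry : ∀ a b p q, Φ (Matrix.single a b 1) p q = ∑ i, V i p a * star (V i q b) :=
    fun a b p q => by
      rw [hV, Matrix.sum_apply]
      refine Finset.sum_congr rfl fun i _ => ?_
      simp [Matrix.mul_apply, Matrix.single_apply, ite_and]
  ext w w'
  simp only [tensorPower, LinearMap.coe_mk, AddHom.coe_mk, Matrix.of_apply, hentry,
    Matrix.sum_apply, Finset.prod_univ_sum, Fintype.piFinset_univ, Matrix.mul_apply,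
    Matrix.conjTranspose_apply, tprod_apply, Finset.sum_mul, star_prod, Finset.prod_mul_distrib]
  refine Finset.sum_comm.trans
    ((Finset.sum_congr rfl fun y _ => Finset.sum_comm).trans (Finset.sum_comm.trans ?_))
  exact Finset.sum_congr rfl fun i _ => Finset.sum_congr rfl fun b _ =>
    Finset.sum_congr rfl fun a _ => mul_right_comm _ _ _

theorem posSemidef_tensorPower {Φ : SuperOp I} {V : κ → Op I}
    (hV : ∀ X, Φ X = ∑ i, V i * X * (V i)ᴴ) {X : Op (Fin n → I)} (hX : X.PosSemidef) :
    (tensorPower n Φ X).PosSemidef := by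
  rw [tensorPower_eq_sum_kraus hV]
  exact Matrix.posSemidef_sum _ fun i _ => hX.mul_mul_conjTranspose_same _

end Blocks

/-! ### Second moments and symmetric logarithmic derivatives -/

section SecondMoment

variable {I : Type} [Fintype I]

/-- The second moment `Tr(ρ X† X)` of the operator `X` in the state `ρ`, which is `Tr(ρ X²)` for
Hermitian `X`. The quantum Fisher information is the second moment of a symmetric logarithmic
derivative. -/
noncomputable def secondMoment (ρ X : Op I) : ℝ := (ρ * (Xᴴ * X)).trace.re

theorem secondMoment_eq_re_trace_conj (ρ X : Op I) :
    secondMoment ρ X = (X * ρ * Xᴴ).trace.re := by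
  rw [secondMoment, ← mul_assoc, Matrix.trace_mul_cycle]

theorem secondMoment_nonneg {ρ : Op I} (hρ : ρ.PosSemidef) (X : Op I) : 0 ≤ secondMoment ρ X := by
  rw [secondMoment_eq_re_trace_conj]
  exact (Complex.le_def.1 (hρ.mul_mul_conjTranspose_same X).trace_nonneg).1

theorem secondMoment_eq_re_trace_sq [DecidableEq I] (ρ : Op I) {X : Op I} (hX : X.IsHermitian) :
    secondMoment ρ X = (ρ * X ^ 2).trace.re := by
  rw [secondMoment, hX.eq, pow_two]

theorem ofReal_secondMoment [DecidableEq I] {ρ X : Op I} (hρ : ρ.PosSemidef)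
    (hX : X.IsHermitian) : (secondMoment ρ X : ℂ) = (ρ * X ^ 2).trace := by
  have hnonneg := (hρ.mul_mul_conjTranspose_same X).trace_nonneg
  rw [← Matrix.trace_mul_cycle, mul_assoc, hX.eq, ← pow_two] at hnonneg
  rw [secondMoment_eq_re_trace_sq ρ hX]
  exact (Complex.eq_re_of_ofReal_le (r := 0) (by simpa using hnonneg)).symm

theorem secondMoment_smul (ρ X : Op I) (c : ℂ) :
    secondMoment ρ (c • X) = ‖c‖ ^ 2 * secondMoment ρ X := by
  have hc : star c * c = ((‖c‖ ^ 2 : ℝ) : ℂ) := by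
    rw [RCLike.star_def, Complex.conj_mul', Complex.ofReal_pow]
  rw [secondMoment, Matrix.conjTranspose_smul, Matrix.smul_mul, Matrix.mul_smul Xᴴ, smul_smul,
    Matrix.mul_smul, Matrix.trace_smul, hc, smul_eq_mul, Complex.re_ofReal_mul, secondMoment]

theorem sqrt_secondMoment_sub_le {ρ : Op I} (hρ : ρ.PosSemidef) (X Y : Op I) :
    √(secondMoment ρ (X - Y)) ≤ √(secondMoment ρ X) + √(secondMoment ρ Y) := by
  classical
  simp only [secondMoment_eq_re_trace_conj]
  exact @norm_sub_le _ (ρ.toMatrixSeminormedAddCommGroup hρ).toSeminormedAddGroup X Y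

theorem secondMoment_sub (ρ : Op I) {Λ : Op I} (hΛ : Λ.IsHermitian) (B : Op I) :
    secondMoment ρ (Λ - B) =
      secondMoment ρ Λ + secondMoment ρ B - ((B * ρ + ρ * Bᴴ) * Λ).trace.re := by
  have hcross : (ρ * (Λ * B)).trace = (B * ρ * Λ).trace := by
    rw [← mul_assoc, Matrix.trace_mul_comm, mul_assoc]
  simp only [secondMoment, Matrix.conjTranspose_sub, hΛ.eq, mul_sub, sub_mul, add_mul,
    Matrix.trace_sub, Matrix.trace_add, hcross, mul_assoc ρ, Complex.sub_re, Complex.add_re]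
  ring

/-- The Fisher information of a derivative `½(Λρ + ρΛ)` is the least second moment of the operators
`B` with `Bρ + ρB†` equal to twice that derivative. -/
theorem secondMoment_le_of_mul_add_mul_eq {ρ Λ B : Op I} (hρ : ρ.PosSemidef)
    (hΛ : Λ.IsHermitian) (hB : Λ * ρ + ρ * Λ = B * ρ + ρ * Bᴴ) :
    secondMoment ρ Λ ≤ secondMoment ρ B := by
  have hnonneg := secondMoment_nonneg hρ (Λ - B)
  have hΛΛ : (Λ * ρ * Λ).trace = (ρ * (Λ * Λ)).trace := by
    rw [mul_assoc, Matrix.trace_mul_comm, mul_assoc]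
  rw [secondMoment_sub ρ hΛ, ← hB, add_mul, Matrix.trace_add, hΛΛ, mul_assoc ρ,
    Complex.add_re] at hnonneg
  have hdef : secondMoment ρ Λ = (ρ * (Λ * Λ)).trace.re := by rw [secondMoment, hΛ.eq]
  linarith

theorem trace_mul_sub_secondMoment_le {ρ Λ X : Op I} (hρ : ρ.PosSemidef) (hΛ : Λ.IsHermitian)
    (hX : X.IsHermitian) :
    ((Λ * ρ + ρ * Λ) * X).trace.re - secondMoment ρ X ≤ secondMoment ρ Λ := by
  have hnonneg := secondMoment_nonneg hρ (X - Λ)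
  rw [secondMoment_sub ρ hX, hΛ.eq] at hnonneg
  linarith

variable [DecidableEq I]

theorem secondMoment_unitary_conj {U : Op I} (hU : Uᴴ * U = 1) (ρ X : Op I) :
    secondMoment (U * ρ * Uᴴ) (U * X * Uᴴ) = secondMoment ρ X := by
  have hcancel : ∀ Y : Op I, Uᴴ * (U * Y) = Y := fun Y => by rw [← mul_assoc, hU, one_mul]
  simp only [secondMoment, Matrix.conjTranspose_mul, Matrix.conjTranspose_conjTranspose, mul_assoc,
    hcancel]
  rw [Matrix.trace_mul_comm]
  simp only [mul_assoc, hU, mul_one]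

theorem secondMoment_diagonal (l : I → ℝ) (X : Op I) :
    secondMoment (Matrix.diagonal fun i => (l i : ℂ)) X = ∑ i, ∑ j, l i * ‖X j i‖ ^ 2 := by
  have htrace : (Matrix.diagonal (fun i => (l i : ℂ)) * (Xᴴ * X)).trace =
      ((∑ i, ∑ j, l i * ‖X j i‖ ^ 2 : ℝ) : ℂ) := by
    simp only [Matrix.trace, Matrix.diag_apply, Matrix.diagonal_mul, Matrix.mul_apply (M := Xᴴ),
      Matrix.conjTranspose_apply, Finset.mul_sum, RCLike.star_def, Complex.conj_mul']
    push_cast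
    rfl
  rw [secondMoment, htrace, Complex.ofReal_re]

end SecondMoment

section SLD

variable {I : Type} [Fintype I]

theorem star_add_smul_dotProduct_mulVec (A : Op I) (u w : I → ℂ) (c : ℂ) :
    star (u + c • w) ⬝ᵥ A *ᵥ (u + c • w) = star u ⬝ᵥ A *ᵥ u + star c * c * (star w ⬝ᵥ A *ᵥ w) +
      c * (star u ⬝ᵥ A *ᵥ w) + star c * (star w ⬝ᵥ A *ᵥ u) := by
  simp only [star_add, star_smul, Matrix.mulVec_add, Matrix.mulVec_smul, add_dotProduct,
    dotProduct_add, smul_dotProduct, dotProduct_smul, smul_eq_mul]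
  ring

theorem sum_star_add_I_pow_smul_dotProduct_mulVec (A : Op I) (u w : I → ℂ) :
    ∑ k : Fin 4, star (u + Complex.I ^ (k : ℕ) • w) ⬝ᵥ A *ᵥ (u + Complex.I ^ (k : ℕ) • w) =
      4 * (star u ⬝ᵥ A *ᵥ u + star w ⬝ᵥ A *ᵥ w) := by
  simp only [star_add_smul_dotProduct_mulVec, Fin.sum_univ_four, RCLike.star_def, map_pow,
    Complex.conj_I, Fin.coe_ofNat_eq_mod, Nat.reduceMod, pow_zero, pow_one]
  linear_combination ((1 + Complex.I) * (star u ⬝ᵥ A *ᵥ w) + (1 - Complex.I) * (star w ⬝ᵥ A *ᵥ u) -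
    (Complex.I ^ 4 - 2 * Complex.I ^ 2 + 3) * (star w ⬝ᵥ A *ᵥ w)) * Complex.I_sq

theorem four_mul_star_dotProduct_mulVec (A : Op I) (u w : I → ℂ) :
    4 * (star u ⬝ᵥ A *ᵥ w) = ∑ k : Fin 4, star (Complex.I ^ (k : ℕ)) *
      (star (u + Complex.I ^ (k : ℕ) • w) ⬝ᵥ A *ᵥ (u + Complex.I ^ (k : ℕ) • w)) := by
  simp only [star_add_smul_dotProduct_mulVec, Fin.sum_univ_four, RCLike.star_def, map_pow,
    Complex.conj_I, Fin.coe_ofNat_eq_mod, Nat.reduceMod, pow_zero, pow_one]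
  linear_combination ((Complex.I ^ 4 - 2 * Complex.I ^ 2 + 3) * (star u ⬝ᵥ A *ᵥ w) -
    (1 + Complex.I ^ 4) * (star w ⬝ᵥ A *ᵥ u) - (1 - Complex.I) * (star u ⬝ᵥ A *ᵥ u) -
    (1 + Complex.I ^ 3) * (Complex.I ^ 4 - Complex.I ^ 2 + 1) * (star w ⬝ᵥ A *ᵥ w)) * Complex.I_sq

variable {ρ D : Op I} {M : ℝ}

theorem norm_star_dotProduct_mulVec_sq_le_of_form_le (hρ : ρ.PosSemidef) (hM : 0 ≤ M)
    (hform : ∀ v : I → ℂ,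
      ‖star v ⬝ᵥ D *ᵥ v‖ ^ 2 ≤ M * ‖star v ⬝ᵥ v‖ * ‖star v ⬝ᵥ ρ *ᵥ v‖) (u w : I → ℂ) :
    ‖star u ⬝ᵥ D *ᵥ w‖ ^ 2 ≤ M * ‖star u ⬝ᵥ u + star w ⬝ᵥ w‖ *
      ‖star u ⬝ᵥ ρ *ᵥ u + star w ⬝ᵥ ρ *ᵥ w‖ := by
  set v : Fin 4 → I → ℂ := fun k => u + Complex.I ^ (k : ℕ) • w
  have hsum : ∀ A : Op I, A.PosSemidef → ∑ k, ‖star (v k) ⬝ᵥ A *ᵥ v k‖ =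
      4 * ‖star u ⬝ᵥ A *ᵥ u + star w ⬝ᵥ A *ᵥ w‖ := fun A hA => by
    have hnonneg : ∀ x, 0 ≤ star x ⬝ᵥ A *ᵥ x := (Matrix.posSemidef_iff_dotProduct_mulVec.1 hA).2
    apply Complex.ofReal_injective
    push_cast
    rw [Complex.norm_of_nonneg' (add_nonneg (hnonneg u) (hnonneg w)),
      ← sum_star_add_I_pow_smul_dotProduct_mulVec]
    exact Finset.sum_congr rfl fun k _ => Complex.norm_of_nonneg' (hnonneg _)
  have hpolar : 4 * ‖star u ⬝ᵥ D *ᵥ w‖ ≤ ∑ k, ‖star (v k) ⬝ᵥ D *ᵥ v k‖ := by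
    calc 4 * ‖star u ⬝ᵥ D *ᵥ w‖ = ‖4 * (star u ⬝ᵥ D *ᵥ w)‖ := by simp
      _ ≤ ∑ k : Fin 4, ‖star (Complex.I ^ (k : ℕ)) * (star (v k) ⬝ᵥ D *ᵥ v k)‖ := by
        rw [four_mul_star_dotProduct_mulVec]
        exact norm_sum_le _ _
      _ = _ := by simp
  have hcauchy := Finset.sum_sq_le_sum_mul_sum_of_sq_le_mul Finset.univ
    (r := fun k => ‖star (v k) ⬝ᵥ D *ᵥ v k‖) (f := fun k => M * ‖star (v k) ⬝ᵥ v k‖)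
    (g := fun k => ‖star (v k) ⬝ᵥ ρ *ᵥ v k‖) (fun k _ => by positivity)
    (fun k _ => norm_nonneg _) (fun k _ => hform (v k))
  classical
  have hone := hsum 1 Matrix.PosSemidef.one
  simp only [Matrix.one_mulVec] at hone
  rw [← Finset.mul_sum, hone, hsum ρ hρ] at hcauchy
  have hsq := pow_le_pow_left₀ (by positivity) hpolar 2
  linarith

theorem exists_sld_of_diagonal [DecidableEq I] {l : I → ℝ} (hl : ∀ i, 0 ≤ l i) (hD : D.IsHermitian)
    (hM : 0 ≤ M) (hentry : ∀ i j, ‖D i j‖ ^ 2 ≤ M * (l i + l j)) :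
    ∃ Λ : Op I, Λ.IsHermitian ∧
      D = (1 / 2 : ℂ) • (Λ * Matrix.diagonal (fun i => (l i : ℂ)) +
        Matrix.diagonal (fun i => (l i : ℂ)) * Λ) ∧
      secondMoment (Matrix.diagonal fun i => (l i : ℂ)) Λ ≤ 4 * (Fintype.card I : ℝ) ^ 2 * M := by
  set Λ : Op I := Matrix.of fun i j => 2 * D i j / ((l i + l j : ℝ) : ℂ) with hΛ
  refine ⟨Λ, ?_, ?_, ?_⟩
  · ext i j
    simp only [hΛ, Matrix.conjTranspose_apply, Matrix.of_apply, star_div₀, star_mul', hD.apply,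
      add_comm (l j), star_ofNat, RCLike.star_def, Complex.conj_ofReal]
  · ext i j
    simp only [Matrix.smul_apply, Matrix.add_apply, Matrix.mul_diagonal, Matrix.diagonal_mul,
      hΛ, Matrix.of_apply, smul_eq_mul]
    by_cases hsum : l i + l j = 0
    · have hzero : D i j = 0 := by simpa [hsum] using hentry i j
      simp [hzero]
    · have hsum' : (l i : ℂ) + l j ≠ 0 := by exact_mod_cast hsum
      push_cast
      field_simp
      ring
  · have hterm : ∀ i j, l i * ‖Λ j i‖ ^ 2 ≤ 4 * M := fun i j => by
      rcases (add_nonneg (hl j) (hl i)).eq_or_lt with hsum | hsum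
      · rw [hΛ, Matrix.of_apply, ← hsum]
        simpa using hM
      · rw [hΛ, Matrix.of_apply, norm_div, norm_mul, Complex.norm_real, Complex.norm_ofNat,
          Real.norm_of_nonneg hsum.le, div_pow, mul_pow, ← mul_div_assoc,
          div_le_iff₀ (by positivity)]
        calc l i * (2 ^ 2 * ‖D j i‖ ^ 2) ≤ (l j + l i) * (2 ^ 2 * (M * (l j + l i))) := by
              gcongr
              · exact le_add_of_nonneg_left (hl j)
              · exact hentry j i
          _ = _ := by ring
    calc secondMoment _ Λ ≤ ∑ _i : I, ∑ _j : I, 4 * M := by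
          rw [secondMoment_diagonal]
          exact Finset.sum_le_sum fun i _ => Finset.sum_le_sum fun j _ => hterm i j
      _ = _ := by
          simp only [Finset.sum_const, Finset.card_univ, nsmul_eq_mul]
          ring

theorem exists_sld_of_form_le (hρ : ρ.PosSemidef) (hD : D.IsHermitian) (hM : 0 ≤ M)
    (hform : ∀ v : I → ℂ,
      ‖star v ⬝ᵥ D *ᵥ v‖ ^ 2 ≤ M * ‖star v ⬝ᵥ v‖ * ‖star v ⬝ᵥ ρ *ᵥ v‖) :
    ∃ Λ : Op I, Λ.IsHermitian ∧ D = (1 / 2 : ℂ) • (Λ * ρ + ρ * Λ) ∧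
      secondMoment ρ Λ ≤ 8 * (Fintype.card I : ℝ) ^ 2 * M := by
  classical
  obtain ⟨U, l, hl, hUU, hUU', hdiag⟩ : ∃ (U : Op I) (l : I → ℝ), (∀ i, 0 ≤ l i) ∧
      Uᴴ * U = 1 ∧ U * Uᴴ = 1 ∧ ρ = U * Matrix.diagonal (fun i => (l i : ℂ)) * Uᴴ :=
    ⟨hρ.isHermitian.eigenvectorUnitary.1, hρ.isHermitian.eigenvalues, hρ.eigenvalues_nonneg,
      Unitary.coe_star_mul_self _, Unitary.coe_mul_star_self _, hρ.isHermitian.spectral_theorem⟩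
  have hcancel : ∀ Y : Op I, Uᴴ * (U * Y) = Y := fun Y => by rw [← mul_assoc, hUU, one_mul]
  have hcancel' : ∀ Y : Op I, U * (Uᴴ * Y) = Y := fun Y => by rw [← mul_assoc, hUU', one_mul]
  set d : Op I := Matrix.diagonal fun i => (l i : ℂ) with hd
  have hcol : ∀ (X : Op I) i j, star (U.col i) ⬝ᵥ X *ᵥ U.col j = (Uᴴ * X * U) i j :=
    fun X i j => by rw [mul_assoc]; rfl
  have hentry : ∀ i j, ‖(Uᴴ * D * U) i j‖ ^ 2 ≤ 2 * M * (l i + l j) := fun i j => by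
    have hone : ∀ i, star (U.col i) ⬝ᵥ U.col i = 1 := fun i => by
      simpa [hUU] using hcol 1 i i
    have heig : ∀ i, star (U.col i) ⬝ᵥ ρ *ᵥ U.col i = l i := fun i => by
      rw [hcol, hdiag]
      simp [mul_assoc, hcancel, hUU, hd]
    have h := norm_star_dotProduct_mulVec_sq_le_of_form_le hρ hM hform (U.col i) (U.col j)
    rw [hone, hone, heig, heig, hcol, one_add_one_eq_two, Complex.norm_ofNat, ← Complex.ofReal_add,
      Complex.norm_of_nonneg (add_nonneg (hl i) (hl j))] at h
    linarith
  obtain ⟨Λ, hΛ, hsld, hbound⟩ := exists_sld_of_diagonal hl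
    (Matrix.isHermitian_conjTranspose_mul_mul U hD) (by positivity) hentry
  refine ⟨U * Λ * Uᴴ, Matrix.isHermitian_mul_mul_conjTranspose U hΛ, ?_, ?_⟩
  · calc D = U * (Uᴴ * D * U) * Uᴴ := by simp only [mul_assoc, hcancel', hUU', mul_one]
      _ = _ := by
        rw [hsld, ← hd, hdiag]
        simp only [Matrix.mul_smul, Matrix.smul_mul, mul_add, add_mul, mul_assoc, hcancel]
  · rw [hdiag, secondMoment_unitary_conj hUU]
    linarith

end SLD

/-! ### Convergence of the quantum Fisher information -/

section HolomorphicStates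

theorem isHermitian_deriv {I : Type} [Finite I] {A : ℂ → Op I} {ω : ℝ} {A' : Op I}
    (hA : HasDerivAt A A' (ω : ℂ)) (hherm : ∀ x : ℝ, (A x).IsHermitian) : A'.IsHermitian := by
  ext a b
  have hab := (hasDerivAt_matrix_iff.1 hA a b).comp_ofReal
  have hba := (hasDerivAt_matrix_iff.1 hA b a).comp_ofReal.star
  simp only [(hherm _).apply] at hba
  exact hba.unique hab

variable {I : Type} [Fintype I] {A : ℂ → Op I} (hA : Differentiable ℂ A)
  (hpos : ∀ x : ℝ, (A x).PosSemidef)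

include hA hpos

/-- Positivity bounds the derivative of each expectation `⟨v, A v⟩` by the geometric mean of its
value and of its oscillation, so the Fisher information is controlled by the oscillation of the
family over a complex disc. -/
theorem exists_sld_of_norm_sub_le [DecidableEq I] {c : Op I} {ε : ℝ}
    (hε : ∀ z : ℂ, ‖z‖ ≤ 1 → ‖A z - c‖ ≤ ε) :
    ∃ Λ : Op I, Λ.IsHermitian ∧ deriv A 0 = (1 / 2 : ℂ) • (Λ * A 0 + A 0 * Λ) ∧
      secondMoment (A 0) Λ ≤ 96 * (Fintype.card I : ℝ) ^ 2 * ε := by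
  have hε0 : 0 ≤ ε := (norm_nonneg _).trans (hε 0 (by simp))
  have hderiv : HasDerivAt A (deriv A 0) ((0 : ℝ) : ℂ) := by simpa using (hA 0).hasDerivAt
  suffices hform : ∀ v : I → ℂ, ‖star v ⬝ᵥ deriv A 0 *ᵥ v‖ ^ 2 ≤
      12 * ε * ‖star v ⬝ᵥ v‖ * ‖star v ⬝ᵥ A 0 *ᵥ v‖ by
    obtain ⟨Λ, hΛ, hsld, hbound⟩ := exists_sld_of_form_le (by simpa using hpos 0)
      (isHermitian_deriv hderiv fun x => (hpos x).isHermitian) (by positivity) hform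
    exact ⟨Λ, hΛ, hsld, hbound.trans_eq (by ring)⟩
  intro v
  set φ : Op I →L[ℂ] ℂ := LinearMap.toContinuousLinearMap
    { toFun := fun X => star v ⬝ᵥ X *ᵥ v
      map_add' := fun X Y => by rw [Matrix.add_mulVec, dotProduct_add]
      map_smul' := fun r X => by rw [Matrix.smul_mulVec, dotProduct_smul, RingHom.id_apply] }
  have hφ : ∀ X, φ X = star v ⬝ᵥ X *ᵥ v := fun X => rfl
  have hφA : ∀ z, HasDerivAt (fun z => φ (A z)) (φ (deriv A z)) z := fun z =>
    φ.hasFDerivAt.comp_hasDerivAt z (hA z).hasDerivAt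
  have hvv : ‖star v ⬝ᵥ v‖ = ‖WithLp.toLp 2 v‖ ^ 2 := by
    rw [← norm_toLp_sq, RCLike.norm_of_nonneg (by positivity)]
  have hosc : ∀ z : ℂ, ‖z‖ ≤ 1 → ‖φ (A z) - φ c‖ ≤ ε * ‖star v ⬝ᵥ v‖ := fun z hz => by
    rw [← map_sub, hφ, hvv, pow_two, ← mul_assoc]
    refine (norm_star_dotProduct_mulVec_le _ _ _).trans ?_
    gcongr
    exact hε z hz
  have hsq := norm_deriv_sq_le_of_nonneg (fun z => (hφA z).differentiableAt) hosc
    fun x => (Matrix.posSemidef_iff_dotProduct_mulVec.1 (hpos x)).2 v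
  rw [(hφA 0).deriv] at hsq
  simpa only [hφ, mul_assoc] using hsq

theorem exists_sld_deriv (ω : ℝ) :
    ∃ Λ : Op I, Λ.IsHermitian ∧ deriv A ω = (1 / 2 : ℂ) • (Λ * A ω + A ω * Λ) := by
  classical
  have hshift : Differentiable ℂ fun z => A (ω + z) := hA.comp (differentiable_id.const_add _)
  obtain ⟨ε, hε⟩ := (isCompact_closedBall (0 : ℂ) 1).exists_bound_of_continuousOn
    hshift.continuous.continuousOn
  obtain ⟨Λ, hΛ, hsld, -⟩ := exists_sld_of_norm_sub_le hshift
    (fun x => by simpa using hpos (ω + x)) (c := 0)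
    fun z hz => by simpa using hε z (by simpa using hz)
  rw [deriv_comp_const_add] at hsld
  exact ⟨Λ, hΛ, by simpa using hsld⟩

theorem isQFI_secondMoment [DecidableEq I] {ω : ℝ} {Λ : Op I} (hΛ : Λ.IsHermitian)
    (hsld : deriv A ω = (1 / 2 : ℂ) • (Λ * A ω + A ω * Λ)) :
    IsQFI (fun x : ℝ => A x) ω (secondMoment (A ω) Λ) := by
  refine ⟨Λ, hΛ, fun a b => ?_, (ofReal_secondMoment (hpos ω) hΛ).symm⟩
  rw [← hsld]
  exact (hasDerivAt_matrix_iff.1 (hA ω).hasDerivAt a b).comp_ofReal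

end HolomorphicStates

section RotatingFrame

variable {I : Type} [Fintype I] [DecidableEq I]

/-- The family `A` seen in the frame rotating with the Hamiltonian `G`: the family generated by `G`
from `ρ` is constant, equal to `ρ`, in this frame. -/
noncomputable def rotatingFrame (G : Op I) (A : ℂ → Op I) (z : ℂ) : Op I :=
  NormedSpace.exp (z • (Complex.I • G)) * A z * NormedSpace.exp ((-z) • (Complex.I • G))

variable {G : Op I} {A B : ℂ → Op I}

theorem rotatingFrame_zero : rotatingFrame G A 0 = A 0 := by simp [rotatingFrame]

theorem hasDerivAt_rotatingFrame {A' : Op I} {z : ℂ} (hA : HasDerivAt A A' z) :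
    HasDerivAt (rotatingFrame G A) (NormedSpace.exp (z • (Complex.I • G)) *
      (A' + Complex.I • (G * A z - A z * G)) * NormedSpace.exp ((-z) • (Complex.I • G))) z := by
  have hleft := hasDerivAt_exp_smul_const (𝕂 := ℂ) (Complex.I • G) z
  have hright := (hasDerivAt_exp_smul_const' (𝕂 := ℂ) (Complex.I • G) (-z)).scomp z
    (hasDerivAt_neg z)
  refine ((hleft.mul hA).mul hright).congr_deriv ?_
  simp only [Function.comp_apply, Pi.mul_apply, neg_smul, one_smul, Matrix.mul_smul,
    Matrix.smul_mul, smul_sub, mul_add, add_mul, mul_sub, sub_mul, mul_neg, mul_assoc]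
  abel

theorem posSemidef_rotatingFrame (hG : G.IsHermitian) {x : ℝ} (hA : (A x).PosSemidef) :
    (rotatingFrame G A x).PosSemidef := by
  have hexp : (NormedSpace.exp ((x : ℂ) • (Complex.I • G)))ᴴ =
      NormedSpace.exp ((-(x : ℂ)) • (Complex.I • G)) := by
    rw [← Matrix.exp_conjTranspose]
    simp [Matrix.conjTranspose_smul, hG.eq]
  rw [rotatingFrame, ← hexp]
  exact hA.mul_mul_conjTranspose_same _

theorem norm_rotatingFrame_sub_le [Nonempty I] {z : ℂ} (hz : ‖z‖ ≤ 1) :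
    ‖rotatingFrame G A z - rotatingFrame G B z‖ ≤ Real.exp ‖G‖ ^ 2 * ‖A z - B z‖ := by
  have hexp : ∀ w : ℂ, ‖w‖ ≤ 1 → ‖NormedSpace.exp (w • (Complex.I • G))‖ ≤ Real.exp ‖G‖ :=
    fun w hw => by
      refine (norm_exp_le _).trans (Real.exp_le_exp.2 ?_)
      rw [norm_smul, norm_smul, Complex.norm_I, one_mul]
      exact mul_le_of_le_one_left (norm_nonneg _) hw
  rw [rotatingFrame, rotatingFrame, ← sub_mul, ← mul_sub]
  calc _ ≤ ‖NormedSpace.exp (z • (Complex.I • G))‖ * ‖A z - B z‖ *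
        ‖NormedSpace.exp ((-z) • (Complex.I • G))‖ := norm_mul₃_le
    _ ≤ Real.exp ‖G‖ * ‖A z - B z‖ * Real.exp ‖G‖ := by
      gcongr
      · exact hexp z hz
      · exact hexp (-z) (by rwa [norm_neg])
    _ = _ := by ring

end RotatingFrame

section Convergence

variable {I : Type} [Fintype I] [DecidableEq I] [Nonempty I]

theorem sqrt_secondMoment_sld_le {A B : ℂ → Op I} {G Λ : Op I} (hA : Differentiable ℂ A)
    (hpos : ∀ x : ℝ, (A x).PosSemidef) (hG : G.IsHermitian)
    (hframe : ∀ z, rotatingFrame G B z = B 0) {ε : ℝ}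
    (hε : ∀ z : ℂ, ‖z‖ ≤ 1 → ‖A z - B z‖ ≤ ε) (hΛ : Λ.IsHermitian)
    (hsld : deriv A 0 = (1 / 2 : ℂ) • (Λ * A 0 + A 0 * Λ)) :
    √(secondMoment (A 0) Λ) ≤
      √(96 * (Fintype.card I : ℝ) ^ 2 * (Real.exp ‖G‖ ^ 2 * ε)) + 2 * √(secondMoment (A 0) G) := by
  have hA0 : (A 0).PosSemidef := by simpa using hpos 0
  have hderiv : deriv (rotatingFrame G A) 0 = deriv A 0 + Complex.I • (G * A 0 - A 0 * G) := by
    simpa using (hasDerivAt_rotatingFrame (G := G) (hA 0).hasDerivAt).deriv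
  obtain ⟨X, hX, hXsld, hXbound⟩ := exists_sld_of_norm_sub_le (A := rotatingFrame G A)
    (fun z => (hasDerivAt_rotatingFrame (hA z).hasDerivAt).differentiableAt)
    (fun x => posSemidef_rotatingFrame hG (hpos x)) (c := B 0) (ε := Real.exp ‖G‖ ^ 2 * ε)
    fun z hz => by
      rw [← hframe z]
      exact (norm_rotatingFrame_sub_le hz).trans (by gcongr; exact hε z hz)
  rw [rotatingFrame_zero] at hXbound
  rw [rotatingFrame_zero, hderiv, hsld] at hXsld
  have hrep : Λ * A 0 + A 0 * Λ = (X - (2 * Complex.I) • G) * A 0 +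
      A 0 * (X - (2 * Complex.I) • G)ᴴ := by
    have hconj : (X - (2 * Complex.I) • G)ᴴ = X + (2 * Complex.I) • G := by
      simp [Matrix.conjTranspose_sub, Matrix.conjTranspose_smul, hX.eq, hG.eq]
    rw [hconj, sub_mul, mul_add, Matrix.smul_mul, Matrix.mul_smul]
    linear_combination (norm := module) (2 : ℂ) • hXsld
  calc √(secondMoment (A 0) Λ) ≤ √(secondMoment (A 0) (X - (2 * Complex.I) • G)) :=
        Real.sqrt_le_sqrt (secondMoment_le_of_mul_add_mul_eq hA0 hΛ hrep)
    _ ≤ √(secondMoment (A 0) X) + √(secondMoment (A 0) ((2 * Complex.I) • G)) :=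
        sqrt_secondMoment_sub_le hA0 _ _
    _ ≤ _ := by
        rw [secondMoment_smul, norm_mul, Complex.norm_I, Complex.norm_ofNat, mul_one,
          Real.sqrt_mul (by positivity), Real.sqrt_sq zero_le_two]
        gcongr

end Convergence

section Convergence

theorem tendsto_of_norm_sub_le_div {V : Type*} [SeminormedAddCommGroup V] {u : ℕ → V} {a : V}
    {E : ℝ} (h : ∀ K : ℕ, 1 ≤ K → ‖u K - a‖ ≤ E / K) : Tendsto u atTop (𝓝 a) := by
  rw [tendsto_iff_norm_sub_tendsto_zero]
  exact squeeze_zero' (Eventually.of_forall fun _ => norm_nonneg _)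
    ((eventually_ge_atTop 1).mono h) (tendsto_const_div_atTop_nhds_zero_nat E)

theorem continuous_secondMoment_left {I : Type} [Fintype I] (X : Op I) :
    Continuous fun ρ : Op I => secondMoment ρ X :=
  Complex.continuous_re.comp (Continuous.matrix_trace (by fun_prop))

variable {I : Type} [Fintype I] [DecidableEq I]
  {E : ℝ} {ρK : ℕ → ℂ → Op I} {ρl : ℂ → Op I} {ω : ℝ}
  (hdiff : ∀ K, Differentiable ℂ (ρK K)) (hdl : Differentiable ℂ ρl)
  (hconv : ∀ K : ℕ, 1 ≤ K → ∀ z : ℂ, ‖z - ω‖ ≤ 1 → ‖ρK K z - ρl z‖ ≤ E / K)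

include hconv

theorem tendsto_apply_of_norm_sub_le_div : Tendsto (fun K => ρK K ω) atTop (𝓝 (ρl ω)) :=
  tendsto_of_norm_sub_le_div fun K hK => hconv K hK ω (by simp)

include hdiff hdl

theorem tendsto_deriv_of_norm_sub_le_div :
    Tendsto (fun K => deriv (ρK K) ω) atTop (𝓝 (deriv ρl ω)) := by
  refine tendsto_of_norm_sub_le_div (E := E) fun K hK => ?_
  have hcauchy := Complex.norm_deriv_le_of_forall_mem_sphere_norm_le
    (f := fun z => ρK K z - ρl z) (c := ω) (C := E / K) one_pos
    ((hdiff K).sub hdl).diffContOnCl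
    fun z hz => hconv K hK z (mem_sphere_iff_norm.1 hz).le
  rwa [div_one, deriv_fun_sub (hdiff K _) (hdl _)] at hcauchy

theorem tendsto_two_mul_trace_deriv_mul_sub_secondMoment {Λ : Op I} (hΛ : Λ.IsHermitian)
    (hsld : deriv ρl ω = (1 / 2 : ℂ) • (Λ * ρl ω + ρl ω * Λ)) :
    Tendsto (fun K => 2 * (deriv (ρK K) ω * Λ).trace.re - secondMoment (ρK K ω) Λ) atTop
      (𝓝 (secondMoment (ρl ω) Λ)) := by
  have htrace : Continuous fun Y : Op I => (Y * Λ).trace.re :=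
    Complex.continuous_re.comp (Continuous.matrix_trace (by fun_prop))
  have hvalue : (deriv ρl ω * Λ).trace.re = secondMoment (ρl ω) Λ := by
    have hcycle : (Λ * ρl ω * Λ).trace = (ρl ω * (Λ * Λ)).trace := by
      rw [mul_assoc, Matrix.trace_mul_comm, mul_assoc]
    rw [hsld, secondMoment, hΛ.eq, Matrix.smul_mul, Matrix.trace_smul, add_mul, Matrix.trace_add,
      hcycle, mul_assoc, ← two_mul, smul_eq_mul, ← mul_assoc, one_div_mul_cancel two_ne_zero,
      one_mul]
  have hlim := (((htrace.tendsto _).comp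
    (tendsto_deriv_of_norm_sub_le_div hdiff hdl hconv)).const_mul 2).sub
    (((continuous_secondMoment_left Λ).tendsto _).comp (tendsto_apply_of_norm_sub_le_div hconv))
  rwa [hvalue, two_mul, add_sub_cancel_right] at hlim

/-- The limit bounds the Fisher informations from below by their variational formula, and from
above by the representation of the derivative obtained in the frame rotating with `G`. -/
theorem exists_isQFI_tendsto [Nonempty I] {G : Op I} (hpos : ∀ K (x : ℝ), (ρK K x).PosSemidef)
    (hG : G.IsHermitian) (hframe : ∀ z, rotatingFrame G (fun w => ρl (ω + w)) z = ρl ω)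
    (hlim : IsQFI (fun x : ℝ => ρl x) ω (4 * secondMoment (ρl ω) G)) :
    ∃ F : ℕ → ℝ, (∀ K, IsQFI (fun x : ℝ => ρK K x) ω (F K)) ∧
      Tendsto F atTop (𝓝 (4 * secondMoment (ρl ω) G)) := by
  choose Λ hΛ hsld using fun K => exists_sld_deriv (hdiff K) (hpos K) ω
  obtain ⟨Λl, hΛl, hderivl, hFl⟩ := hlim
  have hsldl : deriv ρl ω = (1 / 2 : ℂ) • (Λl * ρl ω + ρl ω * Λl) := by
    ext a b
    exact (hasDerivAt_matrix_iff.1 (hdl ω).hasDerivAt a b).comp_ofReal.unique (hderivl a b)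
  have hFl' : secondMoment (ρl ω) Λl = 4 * secondMoment (ρl ω) G := by
    rw [secondMoment_eq_re_trace_sq _ hΛl, hFl, Complex.ofReal_re]
  refine ⟨fun K => secondMoment (ρK K ω) (Λ K),
    fun K => isQFI_secondMoment (hdiff K) (hpos K) (hΛ K) (hsld K), ?_⟩
  have hlower := tendsto_two_mul_trace_deriv_mul_sub_secondMoment hdiff hdl hconv hΛl hsldl
  set c : ℝ := 96 * (Fintype.card I : ℝ) ^ 2 * (Real.exp ‖G‖ ^ 2 * E)
  have hupper : Tendsto (fun K : ℕ => (√(c / K) + 2 * √(secondMoment (ρK K ω) G)) ^ 2) atTop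
      (𝓝 (4 * secondMoment (ρl ω) G)) := by
    have hsqrt := (Real.continuous_sqrt.tendsto 0).comp (tendsto_const_div_atTop_nhds_zero_nat c)
    have hmoment := ((continuous_secondMoment_left G).tendsto _).comp
      (tendsto_apply_of_norm_sub_le_div hconv)
    have hnonneg : 0 ≤ secondMoment (ρl ω) G :=
      ge_of_tendsto' hmoment fun K => secondMoment_nonneg (hpos K ω) G
    have hpow := (hsqrt.add (hmoment.sqrt.const_mul 2)).pow 2
    rwa [Real.sqrt_zero, zero_add, mul_pow, Real.sq_sqrt hnonneg, show (2 : ℝ) ^ 2 = 4 by norm_num]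
      at hpow
  rw [hFl'] at hlower
  refine tendsto_of_tendsto_of_tendsto_of_le_of_le' hlower hupper
    (Eventually.of_forall fun K => ?_) ((eventually_ge_atTop 1).mono fun K hK => ?_)
  · have h := trace_mul_sub_secondMoment_le (hpos K ω) (hΛ K) hΛl
    rwa [show Λ K * ρK K ω + ρK K ω * Λ K = (2 : ℂ) • deriv (ρK K) ω by
      rw [hsld, smul_smul]; norm_num, Matrix.smul_mul, Matrix.trace_smul, smul_eq_mul,
      ← Complex.ofReal_ofNat, Complex.re_ofReal_mul] at h
  · have hshift := sqrt_secondMoment_sld_le (A := fun z => ρK K (ω + z))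
      (B := fun z => ρl (ω + z)) ((hdiff K).comp (differentiable_id.const_add _))
      (fun x => by simpa using hpos K (ω + x)) hG (by simpa using hframe)
      (fun z hz => hconv K hK _ (by simpa using hz)) (hΛ K)
      (by rw [deriv_comp_const_add]; simpa using hsld K)
    rw [add_zero, mul_div_assoc' _ E, mul_div_assoc' _ _ (K : ℝ)] at hshift
    exact (Real.sqrt_le_iff.1 hshift).2

end Convergence

/-! ### Kets and bras -/

section Ketbra

variable {I : Type}

theorem conjTranspose_ketbra (ψ φ : I → ℂ) : (ketbra ψ φ)ᴴ = ketbra φ ψ := by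
  simp [ketbra, Matrix.conjTranspose_vecMulVec]

theorem sum_ketbra_single [Fintype I] [DecidableEq I] :
    ∑ b : I, ketbra (Pi.single b 1) (Pi.single b (1 : ℂ)) = (1 : Op I) := by
  ext a c
  simp [Matrix.sum_apply, ketbra, Matrix.vecMulVec_apply, Matrix.one_apply, Pi.single_apply,
    apply_ite]

variable [Fintype I]

theorem mul_ketbra (A : Op I) (ψ φ : I → ℂ) : A * ketbra ψ φ = ketbra (A *ᵥ ψ) φ := by
  rw [ketbra, Matrix.mul_vecMulVec, ketbra]

theorem ketbra_mul_ketbra (ψ φ ψ' φ' : I → ℂ) :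
    ketbra ψ φ * ketbra ψ' φ' = (star φ ⬝ᵥ ψ') • ketbra ψ φ' := by
  simp only [ketbra, Matrix.vecMulVec_mul_vecMulVec, Matrix.vecMulVec_smul]

theorem ketbra_mul_mul_ketbra (A : Op I) (ψ φ ψ' φ' : I → ℂ) :
    ketbra ψ φ * A * ketbra ψ' φ' = (star φ ⬝ᵥ A *ᵥ ψ') • ketbra ψ φ' := by
  rw [mul_assoc, mul_ketbra, ketbra_mul_ketbra]

theorem trace_ketbra (ψ φ : I → ℂ) : (ketbra ψ φ).trace = star φ ⬝ᵥ ψ := by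
  rw [ketbra, Matrix.trace_vecMulVec, dotProduct_comm]

end Ketbra

/-! ### Operators encoded into a code space -/

/-- The eigenvalues `±1` of the Pauli-Z operator. -/
def zsign : Fin 2 → ℝ := ![1, -1]

/-- The Pauli-Z operator of a qubit. -/
noncomputable def pauliZ : Op (Fin 2) := Matrix.diagonal fun a => (zsign a : ℂ)

theorem pauliZ_mul_self : pauliZ * pauliZ = 1 := by
  rw [pauliZ, Matrix.diagonal_mul_diagonal, ← Matrix.diagonal_one]
  congr 1
  ext a
  fin_cases a <;> simp [zsign]

section Encode

variable {I : Type}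

/-- The qubit operator `m` encoded into the code space with code words `ψ`. -/
noncomputable def encode (ψ : Fin 2 → I → ℂ) : Op (Fin 2) →ₗ[ℂ] Op I where
  toFun m := ∑ a, ∑ b, m a b • ketbra (ψ a) (ψ b)
  map_add' m m' := by
    simp only [Matrix.add_apply, add_smul, Finset.sum_add_distrib]
  map_smul' c m := by
    simp only [Matrix.smul_apply, smul_assoc, Finset.smul_sum, RingHom.id_apply]

theorem encode_apply (ψ : Fin 2 → I → ℂ) (m : Op (Fin 2)) :
    encode ψ m = ∑ a, ∑ b, m a b • ketbra (ψ a) (ψ b) :=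
  rfl

theorem encode_single (ψ : Fin 2 → I → ℂ) (a b : Fin 2) :
    encode ψ (Matrix.single a b 1) = ketbra (ψ a) (ψ b) := by
  simp [encode_apply, Matrix.single_apply, ite_and, ite_smul]

theorem encode_one (ψ : Fin 2 → I → ℂ) : encode ψ 1 = codeProj ψ := by
  simp [encode_apply, codeProj, Fin.sum_univ_two]

theorem encode_pauliZ (ψ : Fin 2 → I → ℂ) : encode ψ pauliZ = logicalZ ψ := by
  simp [encode_apply, logicalZ, pauliZ, zsign, Fin.sum_univ_two, sub_eq_add_neg]

theorem conjTranspose_encode (ψ : Fin 2 → I → ℂ) (m : Op (Fin 2)) :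
    (encode ψ m)ᴴ = encode ψ mᴴ := by
  simp only [encode_apply, Matrix.conjTranspose_sum, Matrix.conjTranspose_smul,
    conjTranspose_ketbra, Matrix.conjTranspose_apply]
  exact Finset.sum_comm

theorem conjTranspose_codeProj (ψ : Fin 2 → I → ℂ) : (codeProj ψ)ᴴ = codeProj ψ := by
  rw [← encode_one, conjTranspose_encode, Matrix.conjTranspose_one]

theorem isHermitian_logicalZ (ψ : Fin 2 → I → ℂ) : (logicalZ ψ).IsHermitian := by
  rw [Matrix.IsHermitian, ← encode_pauliZ, conjTranspose_encode, pauliZ,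
    Matrix.diagonal_conjTranspose]
  congr 2
  exact funext fun a => Complex.conj_ofReal _

variable [Fintype I]

theorem codeProj_mul_mul_codeProj (ψ : Fin 2 → I → ℂ) (A : Op I) :
    codeProj ψ * A * codeProj ψ = encode ψ (Matrix.of fun a b => star (ψ a) ⬝ᵥ A *ᵥ ψ b) := by
  simp only [codeProj, encode_apply, Fin.sum_univ_two, add_mul, mul_add, ketbra_mul_mul_ketbra,
    Matrix.of_apply]
  abel

variable {ψ : Fin 2 → I → ℂ} (hψ : ∀ k k', star (ψ k) ⬝ᵥ ψ k' = if k = k' then 1 else 0)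

include hψ

theorem trace_encode (m : Op (Fin 2)) : (encode ψ m).trace = m.trace := by
  simp only [encode_apply, Matrix.trace_sum, Matrix.trace_smul, trace_ketbra, hψ, smul_eq_mul]
  simp [Matrix.trace, Fin.sum_univ_two]

theorem encode_mul (m m' : Op (Fin 2)) : encode ψ (m * m') = encode ψ m * encode ψ m' := by
  simp only [encode_apply, Fin.sum_univ_two, Matrix.mul_apply, add_mul, mul_add, smul_mul_smul_comm,
    ketbra_mul_ketbra, hψ]
  simp only [if_true, zero_ne_one, one_ne_zero, if_false, one_smul, zero_smul, smul_zero, add_zero,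
    zero_add]
  module

theorem codeProj_mul_self : codeProj ψ * codeProj ψ = codeProj ψ := by
  rw [← encode_one, ← encode_mul hψ, one_mul]

theorem codeProj_mul_encode (m : Op (Fin 2)) : codeProj ψ * encode ψ m = encode ψ m := by
  rw [← encode_one, ← encode_mul hψ, one_mul]

theorem encode_mul_codeProj (m : Op (Fin 2)) : encode ψ m * codeProj ψ = encode ψ m := by
  rw [← encode_one, ← encode_mul hψ, mul_one]

theorem codeProj_mulVec (k : Fin 2) : codeProj ψ *ᵥ ψ k = ψ k := by
  simp only [codeProj, Matrix.add_mulVec, ketbra, Matrix.vecMulVec_mulVec, hψ]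
  fin_cases k <;> simp

end Encode

/-! ### The recovery channel -/

section Recovery

variable {I κ : Type} [Fintype I]

section Jumps

variable [DecidableEq κ] {P X : Op I} {J : κ → Op I}
  (hJJ : ∀ i j, P * (J i)ᴴ * J j * P = if i = j then P else 0)

include hJJ

theorem proj_mul_jumps_mul (hPX : P * X = X) (i j : κ) :
    P * (J i)ᴴ * (J j * X) = if i = j then X else 0 := by
  calc P * (J i)ᴴ * (J j * X) = P * (J i)ᴴ * (J j * (P * X)) := by rw [hPX]
    _ = P * (J i)ᴴ * J j * P * X := by noncomm_ring
    _ = if i = j then X else 0 := by rw [hJJ]; split_ifs <;> simp [hPX]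

theorem mul_jumps_mul_proj (hXP : X * P = X) (i j : κ) :
    X * (J i)ᴴ * (J j * P) = if i = j then X else 0 := by
  calc X * (J i)ᴴ * (J j * P) = X * P * (J i)ᴴ * (J j * P) := by rw [hXP]
    _ = X * (P * (J i)ᴴ * J j * P) := by noncomm_ring
    _ = if i = j then X else 0 := by rw [hJJ]; split_ifs <;> simp [hXP]

end Jumps

variable [Fintype κ]

/-- The completely positive map `X ↦ ∑ᵢ Vᵢ X Vᵢ†` with Kraus operators `V`. -/
noncomputable def krausMap (V : κ → Op I) : SuperOp I :=
  ∑ i, LinearMap.mulLeft ℂ (V i) ∘ₗ LinearMap.mulRight ℂ (V i)ᴴ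

theorem krausMap_apply (V : κ → Op I) (X : Op I) : krausMap V X = ∑ i, V i * X * (V i)ᴴ := by
  simp [krausMap, mul_assoc]

theorem sandwich_apply (A X : Op I) : sandwich A X = A * X * A := by
  simp [sandwich, mul_assoc]

theorem mul_lindbladian_mul (A B H : Op I) (J : κ → Op I) (ω : ℝ) (X : Op I) :
    A * lindbladian H J ω X * B = (-Complex.I * ω) • (A * (H * X - X * H) * B) +
      ∑ i, (A * (J i * X * (J i)ᴴ) * B -
        (1 / 2 : ℂ) • (A * ((J i)ᴴ * J i * X + X * ((J i)ᴴ * J i)) * B)) := by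
  simp only [lindbladian, LinearMap.coe_mk, AddHom.coe_mk]
  rw [mul_add, add_mul, Finset.mul_sum, Finset.sum_mul]
  simp only [mul_sub A (_ * _ * _), sub_mul (A * _) _ B, Matrix.mul_smul, Matrix.smul_mul]

section Projected

variable {P H X : Op I} {J : κ → Op I}
  (hJ : ∀ i, P * J i * P = 0) (hPX : P * X = X) (hXP : X * P = X)

include hJ hPX hXP

theorem proj_mul_lindbladian_mul_proj [DecidableEq κ]
    (hJJ : ∀ i j, P * (J i)ᴴ * J j * P = if i = j then P else 0) (ω : ℝ) :
    P * lindbladian H J ω X * P =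
      (-Complex.I * ω) • (P * H * P * X - X * (P * H * P)) - (Fintype.card κ : ℂ) • X := by
  have hcomm : P * (H * X - X * H) * P = P * H * P * X - X * (P * H * P) := by
    calc P * (H * X - X * H) * P = P * H * (X * P) - (P * X) * H * P := by noncomm_ring
      _ = P * H * (P * X) - (X * P) * H * P := by rw [hPX, hXP]
      _ = P * H * P * X - X * (P * H * P) := by noncomm_ring
  have hjump : ∀ i, P * (J i * X * (J i)ᴴ) * P = 0 := fun i => by
    calc P * (J i * X * (J i)ᴴ) * P = P * (J i * (P * X) * (J i)ᴴ) * P := by rw [hPX]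
      _ = P * J i * P * X * (J i)ᴴ * P := by noncomm_ring
      _ = 0 := by rw [hJ]; simp
  have hloss : ∀ i, P * ((J i)ᴴ * J i * X + X * ((J i)ᴴ * J i)) * P = X + X := fun i => by
    calc P * ((J i)ᴴ * J i * X + X * ((J i)ᴴ * J i)) * P
        = P * (J i)ᴴ * (J i * X) * P + P * X * (J i)ᴴ * (J i * P) := by noncomm_ring
      _ = X + X := by
        rw [hPX, proj_mul_jumps_mul hJJ hPX, mul_jumps_mul_proj hJJ hXP, if_pos rfl, hXP]
  have hhalf : (1 / 2 : ℂ) • (X + X) = X := by rw [← two_smul ℂ X, smul_smul]; norm_num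
  simp only [mul_lindbladian_mul, hcomm, hjump, hloss, hhalf, zero_sub, Finset.sum_neg_distrib,
    Finset.sum_const, Finset.card_univ, ← Nat.cast_smul_eq_nsmul ℂ, ← sub_eq_add_neg]

theorem compl_mul_lindbladian_mul_compl [DecidableEq I] (hP : Pᴴ = P) (ω : ℝ) :
    (1 - P) * lindbladian H J ω X * (1 - P) = ∑ i, J i * X * (J i)ᴴ := by
  have hQX : (1 - P) * X = 0 := by rw [sub_mul, one_mul, hPX, sub_self]
  have hXQ : X * (1 - P) = 0 := by rw [mul_sub, mul_one, hXP, sub_self]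
  have hvanish : ∀ A B : Op I, (1 - P) * (A * X + X * B) * (1 - P) = 0 := fun A B => by
    calc (1 - P) * (A * X + X * B) * (1 - P)
        = (1 - P) * A * (X * (1 - P)) + (1 - P) * X * B * (1 - P) := by
          rw [mul_add, add_mul, ← mul_assoc _ A, ← mul_assoc _ X, mul_assoc _ X]
      _ = 0 := by rw [hXQ, hQX]; simp
  have hQJX : ∀ i, (1 - P) * (J i * X) = J i * X := fun i => by
    calc (1 - P) * (J i * X) = J i * X - P * J i * (P * X) := by rw [hPX]; noncomm_ring
      _ = J i * X - P * J i * P * X := by noncomm_ring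
      _ = J i * X := by rw [hJ, zero_mul, sub_zero]
  have hPJP : ∀ i, P * (J i)ᴴ * P = 0 := fun i => by
    have h := congrArg Matrix.conjTranspose (hJ i)
    rwa [Matrix.conjTranspose_mul, Matrix.conjTranspose_mul, hP, ← mul_assoc,
      Matrix.conjTranspose_zero] at h
  have hXJQ : ∀ i, X * (J i)ᴴ * (1 - P) = X * (J i)ᴴ := fun i => by
    calc X * (J i)ᴴ * (1 - P) = X * (J i)ᴴ - X * P * (J i)ᴴ * P := by rw [hXP]; noncomm_ring
      _ = X * (J i)ᴴ - X * (P * (J i)ᴴ * P) := by noncomm_ring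
      _ = X * (J i)ᴴ := by rw [hPJP, mul_zero, sub_zero]
  have hjump : ∀ i, (1 - P) * (J i * X * (J i)ᴴ) * (1 - P) = J i * X * (J i)ᴴ := fun i => by
    rw [← mul_assoc, hQJX, mul_assoc, mul_assoc, ← mul_assoc X, hXJQ, ← mul_assoc]
  have hcomm : (1 - P) * (H * X - X * H) * (1 - P) = 0 := by
    rw [sub_eq_add_neg (H * X), ← mul_neg, hvanish]
  simp only [mul_lindbladian_mul, hcomm, hvanish, hjump, smul_zero, zero_add, sub_zero]

end Projected

variable [DecidableEq I]

theorem isChannel_krausMap {V : κ → Op I} (hV : ∑ i, (V i)ᴴ * V i = 1) :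
    IsChannel (krausMap V) := by
  refine ⟨Fintype.card κ, fun i => V ((Fintype.equivFin κ).symm i), fun X => ?_, ?_⟩
  · rw [krausMap_apply]
    exact ((Fintype.equivFin κ).symm.sum_comp fun i => V i * X * (V i)ᴴ).symm
  · rw [← hV]
    exact (Fintype.equivFin κ).symm.sum_comp fun i => (V i)ᴴ * V i

/-- `1 - ∑ᵢ Jᵢ P Jᵢ†`. When the errors `Jᵢ` map the range of the projection `P` isometrically onto
mutually orthogonal spaces, it is the projection onto the complement of these error spaces. -/
noncomputable def residual (P : Op I) (J : κ → Op I) : Op I := 1 - ∑ i, J i * P * (J i)ᴴ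

/-- The Kraus operators of the recovery for the code space with projection `P`: undo the error
`J i` on its error space, and reset to the code word `φ` on what remains. -/
noncomputable def recoveryKraus (P : Op I) (φ : I → ℂ) (J : κ → Op I) : κ ⊕ I → Op I
  | .inl i => P * (J i)ᴴ
  | .inr b => ketbra φ (Pi.single b 1) * residual P J

variable {P H X : Op I} {J : κ → Op I} {φ : I → ℂ}

theorem proj_mul_recoveryKraus (hPP : P * P = P) (hPφ : P *ᵥ φ = φ) (x : κ ⊕ I) :
    P * recoveryKraus P φ J x = recoveryKraus P φ J x := by
  rcases x with i | b
  · rw [recoveryKraus, ← mul_assoc, hPP]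
  · rw [recoveryKraus, ← mul_assoc, mul_ketbra, hPφ]

theorem sandwich_recovery (hP : Pᴴ = P) (hPP : P * P = P) (hPφ : P *ᵥ φ = φ) :
    sandwich P ∘ₗ krausMap (recoveryKraus P φ J) = krausMap (recoveryKraus P φ J) := by
  refine LinearMap.ext fun X => ?_
  rw [LinearMap.comp_apply, sandwich_apply, krausMap_apply, Finset.mul_sum, Finset.sum_mul]
  refine Finset.sum_congr rfl fun x _ => ?_
  calc P * (recoveryKraus P φ J x * X * (recoveryKraus P φ J x)ᴴ) * P
      = (P * recoveryKraus P φ J x) * X * (P * recoveryKraus P φ J x)ᴴ := by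
        rw [Matrix.conjTranspose_mul, hP]; noncomm_ring
    _ = recoveryKraus P φ J x * X * (recoveryKraus P φ J x)ᴴ := by
        rw [proj_mul_recoveryKraus hPP hPφ]

theorem conjTranspose_residual (hP : Pᴴ = P) : (residual P J)ᴴ = residual P J := by
  simp only [residual, Matrix.conjTranspose_sub, Matrix.conjTranspose_one,
    Matrix.conjTranspose_sum, Matrix.conjTranspose_mul, Matrix.conjTranspose_conjTranspose, hP,
    mul_assoc]

variable [DecidableEq κ]
  (hJJ : ∀ i j, P * (J i)ᴴ * J j * P = if i = j then P else 0)

include hJJ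

theorem residual_mul_jump (i : κ) : residual P J * (J i * P) = 0 := by
  have h : ∀ j, J j * P * (J j)ᴴ * (J i * P) = if j = i then J i * P else 0 := fun j => by
    calc J j * P * (J j)ᴴ * (J i * P) = J j * (P * (J j)ᴴ * J i * P) := by noncomm_ring
      _ = if j = i then J i * P else 0 := by rw [hJJ]; split_ifs with hji <;> simp [hji]
  simp only [residual, sub_mul, one_mul, Finset.sum_mul, h, Finset.sum_ite_eq', Finset.mem_univ,
    if_true, sub_self]

theorem residual_mul_self : residual P J * residual P J = residual P J := by
  conv_lhs => enter [2]; rw [residual]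
  simp only [mul_sub, mul_one, Finset.mul_sum, ← mul_assoc (residual P J) (J _ * P),
    residual_mul_jump hJJ, zero_mul, Finset.sum_const_zero, sub_zero]

theorem isChannel_recovery (hP : Pᴴ = P) (hPP : P * P = P) (hφ : star φ ⬝ᵥ φ = 1) :
    IsChannel (krausMap (recoveryKraus P φ J)) := by
  have hundo : ∀ i, (P * (J i)ᴴ)ᴴ * (P * (J i)ᴴ) = J i * P * (J i)ᴴ := fun i => by
    rw [Matrix.conjTranspose_mul, Matrix.conjTranspose_conjTranspose, hP, mul_assoc,
      ← mul_assoc P, hPP, mul_assoc]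
  have hreset : ∀ b, (ketbra φ (Pi.single b 1) * residual P J)ᴴ *
      (ketbra φ (Pi.single b 1) * residual P J) =
        residual P J * ketbra (Pi.single b 1) (Pi.single b 1) * residual P J := fun b => by
    rw [Matrix.conjTranspose_mul, conjTranspose_residual hP, conjTranspose_ketbra, mul_assoc,
      ← mul_assoc (ketbra _ _), ketbra_mul_ketbra, hφ, one_smul, mul_assoc]
  refine isChannel_krausMap ?_
  rw [Fintype.sum_sum_type]
  simp only [recoveryKraus, hundo, hreset]
  rw [← Finset.sum_mul, ← Finset.mul_sum, sum_ketbra_single, mul_one, residual_mul_self hJJ,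
    residual, add_sub_cancel]

variable (hPX : P * X = X) (hXP : X * P = X)

include hPX hXP

theorem krausMap_recoveryKraus_jump (hP : Pᴴ = P) (i : κ) :
    krausMap (recoveryKraus P φ J) (J i * X * (J i)ᴴ) = X := by
  have hundo : ∀ j, recoveryKraus P φ J (.inl j) * (J i * X * (J i)ᴴ) *
      (recoveryKraus P φ J (.inl j))ᴴ = if j = i then X else 0 := fun j => by
    rw [recoveryKraus, Matrix.conjTranspose_mul, Matrix.conjTranspose_conjTranspose, hP]
    calc P * (J j)ᴴ * (J i * X * (J i)ᴴ) * (J j * P)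
        = P * (J j)ᴴ * (J i * X) * (J i)ᴴ * (J j * P) := by noncomm_ring
      _ = if j = i then X else 0 := by
        rw [proj_mul_jumps_mul hJJ hPX]
        split_ifs with hji
        · rw [mul_jumps_mul_proj hJJ hXP, if_pos hji.symm]
        · simp
  have hreset : ∀ b, recoveryKraus P φ J (.inr b) * (J i * X * (J i)ᴴ) = 0 := fun b => by
    calc ketbra φ (Pi.single b 1) * residual P J * (J i * X * (J i)ᴴ)
        = ketbra φ (Pi.single b 1) * (residual P J * (J i * P)) * (X * (J i)ᴴ) := by
          conv_lhs => rw [← hPX]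
          noncomm_ring
      _ = 0 := by rw [residual_mul_jump hJJ]; simp
  simp only [krausMap_apply, Fintype.sum_sum_type, hundo, hreset, zero_mul, Finset.sum_const_zero,
    add_zero, Finset.sum_ite_eq', Finset.mem_univ, if_true]

theorem qecOp_lindbladian (hP : Pᴴ = P) (hJ : ∀ i, P * J i * P = 0) (ω : ℝ) :
    qecOp P (krausMap (recoveryKraus P φ J)) (lindbladian H J ω X) =
      (-Complex.I * ω) • (P * H * P * X - X * (P * H * P)) := by
  rw [qecOp, LinearMap.add_apply, LinearMap.comp_apply, sandwich_apply, sandwich_apply,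
    proj_mul_lindbladian_mul_proj hJ hPX hXP hJJ, compl_mul_lindbladian_mul_compl hJ hPX hXP hP,
    map_sum]
  simp only [krausMap_recoveryKraus_jump hJJ hPX hXP hP, Finset.sum_const, Finset.card_univ,
    ← Nat.cast_smul_eq_nsmul ℂ, sub_add_cancel]

end Recovery

/-! ### Rotations about the logical Z axis -/

/-- The factor which the matrix unit `|a⟩⟨b|` acquires under conjugation with `exp (-i s Z)`. -/
noncomputable def coherencePhase (s : ℂ) (a b : Fin 2) : ℂ :=
  Complex.exp (-Complex.I * s * (zsign a - zsign b))

theorem coherencePhase_zero (a b : Fin 2) : coherencePhase 0 a b = 1 := by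
  simp [coherencePhase]

theorem coherencePhase_self (s : ℂ) (a : Fin 2) : coherencePhase s a a = 1 := by
  simp [coherencePhase]

theorem coherencePhase_mul (s : ℂ) (a b c : Fin 2) :
    coherencePhase s a b * coherencePhase s b c = coherencePhase s a c := by
  rw [coherencePhase, coherencePhase, coherencePhase, ← Complex.exp_add]
  ring_nf

theorem star_coherencePhase (s : ℝ) (a b : Fin 2) :
    star (coherencePhase s a b) = coherencePhase s b a := by
  rw [coherencePhase, coherencePhase, RCLike.star_def, ← Complex.exp_conj]
  simp only [map_mul, map_neg, map_sub, Complex.conj_I, Complex.conj_ofReal]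
  ring_nf

theorem coherencePhase_natCast_mul (n : ℕ) (s : ℂ) (a b : Fin 2) :
    coherencePhase (n * s) a b = coherencePhase s a b ^ n := by
  rw [coherencePhase, coherencePhase, ← Complex.exp_nat_mul]
  ring_nf

theorem hasDerivAt_coherencePhase (s : ℂ) (a b : Fin 2) :
    HasDerivAt (fun s => coherencePhase s a b)
      (-Complex.I * (zsign a - zsign b) * coherencePhase s a b) s := by
  have h := (((hasDerivAt_id s).const_mul (-Complex.I)).mul_const ((zsign a - zsign b : ℂ))).cexp
  refine h.congr_deriv ?_
  simp only [coherencePhase, id]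
  ring

/-- The qubit operator `m` rotated about the Z axis, i.e. `exp (-i s Z) m exp (i s Z)`. -/
noncomputable def phaseRotation (s : ℂ) (m : Op (Fin 2)) : Op (Fin 2) :=
  Matrix.of fun a b => coherencePhase s a b * m a b

theorem phaseRotation_zero (m : Op (Fin 2)) : phaseRotation 0 m = m := by
  ext a b
  simp [phaseRotation, coherencePhase_zero]

theorem phaseRotation_zero_right (s : ℂ) : phaseRotation s 0 = 0 := by
  ext a b
  simp [phaseRotation]

theorem trace_phaseRotation (s : ℂ) (m : Op (Fin 2)) : (phaseRotation s m).trace = m.trace := by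
  simp [phaseRotation, Matrix.trace, coherencePhase_self]

theorem conjTranspose_phaseRotation (s : ℝ) (m : Op (Fin 2)) :
    (phaseRotation s m)ᴴ = phaseRotation s mᴴ := by
  ext a b
  simp only [phaseRotation, Matrix.conjTranspose_apply, Matrix.of_apply, star_mul',
    star_coherencePhase]

theorem phaseRotation_mul (s : ℂ) (m m' : Op (Fin 2)) :
    phaseRotation s (m * m') = phaseRotation s m * phaseRotation s m' := by
  ext a c
  simp only [phaseRotation, Matrix.of_apply, Matrix.mul_apply, Finset.mul_sum]
  refine Finset.sum_congr rfl fun b _ => ?_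
  rw [← coherencePhase_mul s a b c]
  ring

theorem pauliZ_mul_sub_mul_pauliZ_apply (m : Op (Fin 2)) (a b : Fin 2) :
    (pauliZ * m - m * pauliZ) a b = (zsign a - zsign b) * m a b := by
  rw [Matrix.sub_apply, pauliZ, Matrix.diagonal_mul, Matrix.mul_diagonal]
  ring

theorem hasDerivAt_phaseRotation (m : Op (Fin 2)) (s : ℂ) :
    HasDerivAt (fun s => phaseRotation s m)
      (-Complex.I • (pauliZ * phaseRotation s m - phaseRotation s m * pauliZ)) s := by
  refine hasDerivAt_matrix_iff.2 fun a b =>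
    ((hasDerivAt_coherencePhase s a b).mul_const (m a b)).congr_deriv ?_
  rw [Matrix.smul_apply, pauliZ_mul_sub_mul_pauliZ_apply, smul_eq_mul, phaseRotation,
    Matrix.of_apply]
  ring

section EncodedRotation

variable {I : Type} [Fintype I] {ψ : Fin 2 → I → ℂ}
  (hψ : ∀ k k', star (ψ k) ⬝ᵥ ψ k' = if k = k' then 1 else 0)

include hψ

theorem encode_pauliZ_mul_sub (m : Op (Fin 2)) :
    encode ψ (pauliZ * m - m * pauliZ) = logicalZ ψ * encode ψ m - encode ψ m * logicalZ ψ := by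
  rw [map_sub, encode_mul hψ, encode_mul hψ, encode_pauliZ]

theorem hasDerivAt_encode_phaseRotation (m : Op (Fin 2)) (s : ℂ) :
    HasDerivAt (fun s => encode ψ (phaseRotation s m))
      (-Complex.I • (logicalZ ψ * encode ψ (phaseRotation s m) -
        encode ψ (phaseRotation s m) * logicalZ ψ)) s := by
  classical
  have h := (LinearMap.toContinuousLinearMap (encode ψ)).hasFDerivAt.comp_hasDerivAt s
    (hasDerivAt_phaseRotation m s)
  rw [LinearMap.coe_toContinuousLinearMap', map_smul, encode_pauliZ_mul_sub hψ] at h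
  exact h

theorem superExp_encode [DecidableEq I] {Φ : SuperOp I} {s : ℂ}
    (hΦ : ∀ m, Φ (encode ψ m) =
      (-Complex.I * s) • (logicalZ ψ * encode ψ m - encode ψ m * logicalZ ψ))
    (m : Op (Fin 2)) : superExp Φ (encode ψ m) = encode ψ (phaseRotation s m) := by
  have hunit : ∀ a b : Fin 2, superExp Φ (ketbra (ψ a) (ψ b)) =
      coherencePhase s a b • ketbra (ψ a) (ψ b) := fun a b => by
    refine superExp_apply_of_eigenvector ?_
    have hcomm : pauliZ * Matrix.single a b 1 - Matrix.single a b 1 * pauliZ =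
        (zsign a - zsign b : ℂ) • Matrix.single a b 1 := by
      ext c d
      rw [pauliZ_mul_sub_mul_pauliZ_apply, Matrix.smul_apply, smul_eq_mul]
      by_cases h : a = c ∧ b = d
      · rw [h.1, h.2]
      · simp [Matrix.single_apply_of_ne _ _ _ _ _ h]
    rw [← encode_single, hΦ, ← encode_pauliZ_mul_sub hψ, hcomm, map_smul, smul_smul]
  simp only [encode_apply, map_sum, map_smul, hunit, phaseRotation, Matrix.of_apply, smul_smul,
    mul_comm]

end EncodedRotation

/-! ### The Fisher information of a rotating pure state -/

section PureState

variable {I : Type} [Fintype I] [DecidableEq I] {G : Op I}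

theorem rotatingFrame_eq_of_hasDerivAt {A : ℂ → Op I}
    (hA : ∀ z, HasDerivAt A (-Complex.I • (G * A z - A z * G)) z) (z : ℂ) :
    rotatingFrame G A z = A 0 := by
  have hderiv : ∀ z, HasDerivAt (rotatingFrame G A) 0 z := fun z => by
    refine (hasDerivAt_rotatingFrame (hA z)).congr_deriv ?_
    rw [neg_smul, neg_add_cancel, mul_zero, zero_mul]
  rw [← rotatingFrame_zero (G := G) (A := A)]
  exact is_const_of_deriv_eq_zero (fun z => (hderiv z).differentiableAt)
    (fun z => (hderiv z).deriv) z 0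

/-- On a pure state the commutator `-2i [G, ρ]` is a symmetric logarithmic derivative for the
rotation generated by `G`. -/
theorem isQFI_of_pure {ρ : ℝ → Op I} {ω : ℝ} (hG : G.IsHermitian) (hρ : (ρ ω).PosSemidef)
    (hpure : ρ ω * ρ ω = ρ ω) (hmean : ρ ω * G * ρ ω = 0)
    (hderiv : ∀ a b, HasDerivAt (fun x => ρ x a b) ((-Complex.I • (G * ρ ω - ρ ω * G)) a b) ω) :
    IsQFI ρ ω (4 * secondMoment (ρ ω) G) := by
  refine ⟨(-2 * Complex.I) • (G * ρ ω - ρ ω * G), ?_, fun a b => ?_, ?_⟩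
  · rw [Matrix.IsHermitian, Matrix.conjTranspose_smul, Matrix.conjTranspose_sub,
      Matrix.conjTranspose_mul, Matrix.conjTranspose_mul, hG.eq, hρ.isHermitian.eq, ← neg_sub,
      smul_neg, ← neg_smul]
    simp
  · have hleft : (G * ρ ω - ρ ω * G) * ρ ω = G * ρ ω := by
      rw [sub_mul, hmean, sub_zero, mul_assoc, hpure]
    have hright : ρ ω * (G * ρ ω - ρ ω * G) = -(ρ ω * G) := by
      rw [mul_sub, ← mul_assoc, hmean, ← mul_assoc, hpure, zero_sub]
    have hsld : (1 / 2 : ℂ) • ((-2 * Complex.I) • (G * ρ ω - ρ ω * G) * ρ ω +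
        ρ ω * ((-2 * Complex.I) • (G * ρ ω - ρ ω * G))) =
          -Complex.I • (G * ρ ω - ρ ω * G) := by
      rw [Matrix.smul_mul, Matrix.mul_smul, hleft, hright]
      module
    rw [hsld]
    exact hderiv a b
  · have hsq : ρ ω * (G * ρ ω - ρ ω * G) ^ 2 = -(ρ ω * G ^ 2 * ρ ω) := by
      calc ρ ω * (G * ρ ω - ρ ω * G) ^ 2
          = (ρ ω * G * ρ ω) * (G * ρ ω - ρ ω * G) - (ρ ω * ρ ω) * G ^ 2 * ρ ω
            + (ρ ω * ρ ω) * G * ρ ω * G := by noncomm_ring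
        _ = -(ρ ω * G ^ 2 * ρ ω) := by rw [hpure, hmean]; simp
    rw [smul_pow, Matrix.mul_smul, hsq, Matrix.trace_smul, Matrix.trace_neg, Matrix.trace_mul_cycle,
      hpure, Complex.ofReal_mul, ofReal_secondMoment hρ hG]
    simp only [mul_pow, Complex.I_sq, smul_eq_mul]
    norm_num

end PureState

/-! ### The Fisher information of a logical GHZ state -/

/-- The state `(|0⟩ + |1⟩) / √2` of a qubit, as a density operator. -/
noncomputable def plusState : Op (Fin 2) := Matrix.of fun _ _ => 1 / 2

theorem trace_plusState : plusState.trace = 1 := by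
  simp [plusState, Matrix.trace]

theorem conjTranspose_plusState : plusStateᴴ = plusState := by
  ext a b
  simp [plusState]

theorem plusState_mul_self : plusState * plusState = plusState := by
  ext a b
  simp [plusState, Matrix.mul_apply]

theorem plusState_mul_pauliZ_mul_plusState : plusState * pauliZ * plusState = 0 := by
  ext a b
  simp [plusState, pauliZ, zsign, Matrix.mul_apply, Fin.sum_univ_two]

theorem phaseRotation_pauliZ (s : ℂ) : phaseRotation s pauliZ = pauliZ := by
  ext a b
  by_cases h : a = b <;> simp [phaseRotation, pauliZ, h, coherencePhase_self]

/-- The encoded equatorial qubit state with Bloch angle `2 s`. -/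
noncomputable def phaseState {I : Type} (ψ : Fin 2 → I → ℂ) (s : ℂ) : Op I :=
  encode ψ (phaseRotation s plusState)

section PhaseState

variable {I : Type} [Fintype I] {ψ : Fin 2 → I → ℂ}
  (hψ : ∀ k k', star (ψ k) ⬝ᵥ ψ k' = if k = k' then 1 else 0)

include hψ

theorem phaseState_mul_self (s : ℂ) : phaseState ψ s * phaseState ψ s = phaseState ψ s := by
  rw [phaseState, ← encode_mul hψ, ← phaseRotation_mul, plusState_mul_self]

theorem phaseState_mul_logicalZ_mul_phaseState (s : ℂ) :
    phaseState ψ s * logicalZ ψ * phaseState ψ s = 0 := by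
  rw [phaseState, ← encode_pauliZ, ← phaseRotation_pauliZ s, ← encode_mul hψ,
    ← encode_mul hψ, ← phaseRotation_mul, ← phaseRotation_mul,
    plusState_mul_pauliZ_mul_plusState, phaseRotation_zero_right, map_zero]

theorem posSemidef_phaseState (s : ℝ) : (phaseState ψ s).PosSemidef := by
  have hstar : (phaseState ψ s)ᴴ = phaseState ψ s := by
    rw [phaseState, conjTranspose_encode, conjTranspose_phaseRotation, conjTranspose_plusState]
  rw [← phaseState_mul_self hψ]
  conv => enter [1, 1]; rw [← hstar]
  exact Matrix.posSemidef_conjTranspose_mul_self _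

theorem secondMoment_phaseState (s : ℂ) : secondMoment (phaseState ψ s) (logicalZ ψ) = 1 := by
  rw [secondMoment, (isHermitian_logicalZ ψ).eq, ← encode_pauliZ, ← encode_mul hψ,
    pauliZ_mul_self, phaseState, ← encode_mul hψ, mul_one, trace_encode hψ, trace_phaseRotation,
    trace_plusState, Complex.one_re]

theorem four_mul_secondMoment_phaseState (g : ℝ) (s : ℂ) :
    4 * secondMoment (phaseState ψ s) ((g : ℂ) • logicalZ ψ) = (2 * g) ^ 2 := by
  rw [secondMoment_smul, secondMoment_phaseState hψ, Complex.norm_real, Real.norm_eq_abs, sq_abs]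
  ring

theorem hasDerivAt_phaseState_mul (g z : ℂ) :
    HasDerivAt (fun z => phaseState ψ (g * z)) (-Complex.I • ((g • logicalZ ψ) *
      phaseState ψ (g * z) - phaseState ψ (g * z) * (g • logicalZ ψ))) z := by
  classical
  have h := (hasDerivAt_encode_phaseRotation hψ plusState (g * z)).scomp z
    ((hasDerivAt_id z).const_mul g)
  refine h.congr_deriv ?_
  rw [mul_one, Matrix.smul_mul, Matrix.mul_smul, ← smul_sub, smul_comm]
  rfl

variable [DecidableEq I]

theorem rotatingFrame_phaseState (g w z : ℂ) :
    rotatingFrame (g • logicalZ ψ) (fun z => phaseState ψ (g * (w + z))) z =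
      phaseState ψ (g * w) := by
  rw [rotatingFrame_eq_of_hasDerivAt fun z =>
    (hasDerivAt_phaseState_mul hψ g (w + z)).comp_const_add w z, add_zero]

theorem isQFI_phaseState (g ω : ℝ) :
    IsQFI (fun x : ℝ => phaseState ψ (g * x)) ω
      (4 * secondMoment (phaseState ψ (g * ω)) ((g : ℂ) • logicalZ ψ)) := by
  refine isQFI_of_pure ((isHermitian_logicalZ ψ).smul (Complex.conj_ofReal g)) ?_
    (phaseState_mul_self hψ _) ?_ fun a b =>
      (hasDerivAt_matrix_iff.1 (hasDerivAt_phaseState_mul hψ g ω) a b).comp_ofReal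
  · rw [← Complex.ofReal_mul]
    exact posSemidef_phaseState hψ _
  · rw [Matrix.mul_smul, Matrix.smul_mul, phaseState_mul_logicalZ_mul_phaseState hψ, smul_zero]

end PhaseState

/-! ### The limit of fast error correction on one block -/

section ComplexFrequency

variable {I κ : Type} [Fintype I] [Fintype κ]

/-- The generator `lindbladian H J`, which is affine in the frequency, at a complex frequency. -/
noncomputable def complexLindbladian (H : Op I) (J : κ → Op I) (z : ℂ) : SuperOp I :=
  lindbladian H J 0 + z • (lindbladian H J 1 - lindbladian H J 0)

theorem complexLindbladian_ofReal (H : Op I) (J : κ → Op I) (ω : ℝ) :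
    complexLindbladian H J ω = lindbladian H J ω := by
  refine LinearMap.ext fun X => ?_
  simp only [complexLindbladian, lindbladian, LinearMap.add_apply, LinearMap.smul_apply,
    LinearMap.sub_apply, LinearMap.coe_mk, AddHom.coe_mk, Complex.ofReal_one, Complex.ofReal_zero,
    mul_one, mul_zero, zero_smul, zero_add, add_sub_cancel_right, smul_smul]
  rw [add_comm, mul_comm]

variable [DecidableEq I]

/-- The rounds of evolution and error correction, continued to complex frequencies. -/
noncomputable def complexRounds (C : SuperOp I) (H : Op I) (J : κ → Op I) (t : ℝ) (K : ℕ) (z : ℂ) :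
    SuperOp I :=
  (C * superExp ((K : ℝ)⁻¹ • (t • complexLindbladian H J z))) ^ K

theorem complexRounds_ofReal (C : SuperOp I) (H : Op I) (J : κ → Op I) (t : ℝ) (K : ℕ) (ω : ℝ) :
    complexRounds C H J t K ω = rounds C (lindbladian H J ω) t K := by
  rw [complexRounds, complexLindbladian_ofReal, smul_smul, ← evolution_eq_superExp,
    ← div_eq_inv_mul]
  rfl

theorem differentiable_complexRounds (C : SuperOp I) (H : Op I) (J : κ → Op I) (t : ℝ)
    (K : ℕ) (X : Op I) : Differentiable ℂ fun z => complexRounds C H J t K z X := by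
  set e := Module.End.toContinuousLinearMap (𝕜 := ℂ) (Op I)
  have hgen : ∀ z, e ((K : ℝ)⁻¹ • (t • complexLindbladian H J z)) = ((K : ℝ)⁻¹ * t) •
      (e (lindbladian H J 0) + z • e (lindbladian H J 1 - lindbladian H J 0)) := fun z => by
    rw [smul_smul, ← map_smul, ← map_add]
    rfl
  have happly : ∀ z, complexRounds C H J t K z X = ((e C * NormedSpace.exp (((K : ℝ)⁻¹ * t) •
      (e (lindbladian H J 0) + z • e (lindbladian H J 1 - lindbladian H J 0)))) ^ K) X :=
    fun z => by
      rw [← hgen, ← toContinuousLinearMap_superExp, ← map_mul, ← map_pow]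
      rfl
  have haffine : Differentiable ℂ fun z : ℂ => ((K : ℝ)⁻¹ * t) •
      (e (lindbladian H J 0) + z • e (lindbladian H J 1 - lindbladian H J 0)) := by fun_prop
  have hexp : Differentiable ℂ (NormedSpace.exp : (Op I →L[ℂ] Op I) → Op I →L[ℂ] Op I) :=
    fun x => (NormedSpace.exp_analytic (𝕂 := ℂ) x).differentiableAt
  simp only [happly]
  exact (ContinuousLinearMap.apply ℂ (Op I) X).differentiable.comp
    (((hexp.comp haffine).const_mul _).pow K)

theorem exists_norm_complexLindbladian_le (H : Op I) (J : κ → Op I) (t R : ℝ) :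
    ∃ l, ∀ z : ℂ, ‖z‖ ≤ R →
      ‖Module.End.toContinuousLinearMap (Op I) (t • complexLindbladian H J z)‖ ≤ l := by
  set e := Module.End.toContinuousLinearMap (𝕜 := ℂ) (Op I)
  refine ⟨|t| * (‖e (lindbladian H J 0)‖ + R * ‖e (lindbladian H J 1 - lindbladian H J 0)‖),
    fun z hz => ?_⟩
  have hgen : e (t • complexLindbladian H J z) = t •
      (e (lindbladian H J 0) + z • e (lindbladian H J 1 - lindbladian H J 0)) := by
    rw [← map_smul, ← map_add]
    rfl
  rw [hgen, norm_smul, Real.norm_eq_abs]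
  gcongr
  refine (norm_add_le _ _).trans ?_
  rw [norm_smul]
  gcongr

end ComplexFrequency

section Block

theorem sandwich_codeProj_encode {I : Type} [Fintype I] {ψ : Fin 2 → I → ℂ}
    (hψ : ∀ k k', star (ψ k) ⬝ᵥ ψ k' = if k = k' then 1 else 0) (m : Op (Fin 2)) :
    sandwich (codeProj ψ) (encode ψ m) = encode ψ m := by
  rw [sandwich_apply, codeProj_mul_encode hψ, encode_mul_codeProj hψ]

variable {I κ : Type} [Fintype I] [Fintype κ] [DecidableEq I]
  {ψ : Fin 2 → I → ℂ} (hψ : ∀ k k', star (ψ k) ⬝ᵥ ψ k' = if k = k' then 1 else 0)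
  {H : Op I} {J : κ → Op I}

/-- The error-correcting operation of the code with code words `ψ` for the errors `J`. The recovery
resets to `ψ 1` where no error can have led. -/
noncomputable def codeQEC (ψ : Fin 2 → I → ℂ) (J : κ → Op I) : SuperOp I :=
  qecOp (codeProj ψ) (krausMap (recoveryKraus (codeProj ψ) (ψ 1) J))

theorem codeQEC_eq_krausMap (ψ : Fin 2 → I → ℂ) (J : κ → Op I) :
    codeQEC ψ J = krausMap fun i : Option (κ ⊕ I) => i.elim (codeProj ψ)
      fun x => recoveryKraus (codeProj ψ) (ψ 1) J x * (1 - codeProj ψ) := by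
  refine LinearMap.ext fun X => ?_
  rw [krausMap_apply, Fintype.sum_option, codeQEC, qecOp, LinearMap.add_apply,
    LinearMap.comp_apply, krausMap_apply]
  simp only [Option.elim_none, Option.elim_some, Matrix.conjTranspose_mul,
    Matrix.conjTranspose_sub, Matrix.conjTranspose_one, conjTranspose_codeProj, sandwich_apply,
    mul_assoc]

include hψ

theorem sandwich_mul_codeQEC : sandwich (codeProj ψ) * codeQEC ψ J = codeQEC ψ J := by
  have hidem : sandwich (codeProj ψ) * sandwich (codeProj ψ) = sandwich (codeProj ψ) := by
    refine LinearMap.ext fun X => ?_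
    simp only [Module.End.mul_apply, sandwich_apply]
    calc codeProj ψ * (codeProj ψ * X * codeProj ψ) * codeProj ψ
        = (codeProj ψ * codeProj ψ) * X * (codeProj ψ * codeProj ψ) := by noncomm_ring
      _ = codeProj ψ * X * codeProj ψ := by rw [codeProj_mul_self hψ]
  rw [codeQEC, qecOp, mul_add, hidem, ← Module.End.mul_eq_comp, ← mul_assoc,
    Module.End.mul_eq_comp _ (krausMap _), sandwich_recovery (conjTranspose_codeProj ψ)
      (codeProj_mul_self hψ) (codeProj_mulVec hψ 1)]

theorem codeQEC_encode (m : Op (Fin 2)) : codeQEC ψ J (encode ψ m) = encode ψ m := by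
  rw [codeQEC, qecOp, LinearMap.add_apply, LinearMap.comp_apply, sandwich_codeProj_encode hψ,
    sandwich_apply, sub_mul, codeProj_mul_encode hψ, one_mul, sub_self, zero_mul, map_zero,
    add_zero]

theorem codeQEC_mul_sandwich :
    codeQEC ψ J * sandwich (codeProj ψ) = sandwich (codeProj ψ) := by
  refine LinearMap.ext fun X => ?_
  rw [Module.End.mul_apply, sandwich_apply, codeProj_mul_mul_codeProj, codeQEC_encode hψ]

variable [DecidableEq κ] (hJ : ∀ i, codeProj ψ * J i * codeProj ψ = 0)
  (hJJ : ∀ i j, codeProj ψ * (J i)ᴴ * J j * codeProj ψ = if i = j then codeProj ψ else 0)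
  {q r : ℝ} (hH : codeProj ψ * H * codeProj ψ = (q : ℂ) • codeProj ψ + (r : ℂ) • logicalZ ψ)

include hJ hJJ hH

theorem codeQEC_lindbladian_encode (ω : ℝ) (m : Op (Fin 2)) :
    codeQEC ψ J (lindbladian H J ω (encode ψ m)) = (-Complex.I * (ω * r)) •
      (logicalZ ψ * encode ψ m - encode ψ m * logicalZ ψ) := by
  rw [codeQEC, qecOp_lindbladian hJJ (codeProj_mul_encode hψ m) (encode_mul_codeProj hψ m)
    (conjTranspose_codeProj ψ) hJ, hH]
  simp only [add_mul, mul_add, Matrix.smul_mul, Matrix.mul_smul, codeProj_mul_encode hψ,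
    encode_mul_codeProj hψ, add_sub_add_left_eq_sub, ← smul_sub, smul_smul, mul_assoc]

theorem projected_complexLindbladian_encode (t : ℝ) (z : ℂ) (m : Op (Fin 2)) :
    (codeQEC ψ J * (t • complexLindbladian H J z) * sandwich (codeProj ψ)) (encode ψ m) =
      (-Complex.I * (z * (t * r))) • (logicalZ ψ * encode ψ m - encode ψ m * logicalZ ψ) := by
  rw [Module.End.mul_apply, Module.End.mul_apply, sandwich_codeProj_encode hψ,
    LinearMap.smul_apply, LinearMap.map_smul_of_tower, complexLindbladian, LinearMap.add_apply,
    LinearMap.smul_apply, LinearMap.sub_apply, map_add, map_smul, map_sub,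
    codeQEC_lindbladian_encode hψ hJ hJJ hH, codeQEC_lindbladian_encode hψ hJ hJJ hH,
    ← Complex.coe_smul]
  push_cast
  module

theorem exists_norm_complexRounds_sub_le [Nonempty I] (t R : ℝ) (m : Op (Fin 2)) :
    ∃ E : ℝ, ∀ K : ℕ, 1 ≤ K → ∀ z : ℂ, ‖z‖ ≤ R →
      ‖complexRounds (codeQEC ψ J) H J t K z (encode ψ m) -
        encode ψ (phaseRotation (z * (t * r)) m)‖ ≤ E / K := by
  obtain ⟨l, hl⟩ := exists_norm_complexLindbladian_le H J t R
  obtain ⟨E, hE⟩ := exists_norm_rounds_sub_superExp_le (sandwich_mul_codeQEC (J := J) hψ)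
    (codeQEC_mul_sandwich hψ) l (sandwich_codeProj_encode hψ m)
  refine ⟨E, fun K hK z hz => ?_⟩
  rw [← superExp_encode hψ (projected_complexLindbladian_encode hψ hJ hJJ hH t z)]
  exact hE K hK _ (hl z hz)

theorem tendsto_rounds_encode [Nonempty I] (t ω : ℝ) (m : Op (Fin 2)) :
    Tendsto (fun K : ℕ => rounds (codeQEC ψ J) (lindbladian H J ω) t K (encode ψ m)) atTop
      (𝓝 (encode ψ (phaseRotation (ω * (t * r)) m))) := by
  obtain ⟨E, hE⟩ := exists_norm_complexRounds_sub_le hψ hJ hJJ hH t ‖(ω : ℂ)‖ m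
  refine tendsto_of_norm_sub_le_div (E := E) fun K hK => ?_
  rw [← complexRounds_ofReal]
  exact hE K hK ω le_rfl

theorem exists_logical_evolution [Nonempty I] (ω : ℝ) {ρ : Op I}
    (hρ : sandwich (codeProj ψ) ρ = ρ) :
    ∃ ρL : ℝ → Op I, ρL 0 = ρ ∧
      (∀ t a b, HasDerivAt (fun s => ρL s a b)
        (((-Complex.I * ((ω * r : ℝ) : ℂ)) •
          (logicalZ ψ * ρL t - ρL t * logicalZ ψ)) a b) t) ∧
      ∀ t : ℝ, 0 ≤ t → Tendsto (fun K : ℕ => rounds (codeQEC ψ J) (lindbladian H J ω) t K ρ)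
        atTop (𝓝 (ρL t)) := by
  obtain ⟨m, rfl⟩ : ∃ m, ρ = encode ψ m :=
    ⟨_, by rw [← codeProj_mul_mul_codeProj, ← sandwich_apply, hρ]⟩
  refine ⟨fun t => encode ψ (phaseRotation (ω * (t * r)) m), ?_, fun t a b => ?_,
    fun t _ => tendsto_rounds_encode hψ hJ hJJ hH t ω m⟩
  · simp only [Complex.ofReal_zero, zero_mul, mul_zero, phaseRotation_zero]
  · have hspeed : HasDerivAt (fun t : ℂ => ω * (t * r)) (ω * r : ℂ) t := by
      simpa using ((hasDerivAt_id (t : ℂ)).mul_const (r : ℂ)).const_mul (ω : ℂ)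
    have h := (hasDerivAt_encode_phaseRotation hψ m (ω * (t * r))).scomp (t : ℂ) hspeed
    refine (hasDerivAt_matrix_iff.1 h a b).comp_ofReal.congr_deriv ?_
    rw [smul_smul]
    push_cast
    ring_nf

end Block

/-! ### Arrays of blocks in a logical GHZ state -/

section ArrayCode

variable {I : Type} (ψ : Fin 2 → I → ℂ) (n : ℕ)

/-- The code words `|a_L⟩^{⊗ n}` of an array of `n` blocks. -/
noncomputable def arrayCode (a : Fin 2) : (Fin n → I) → ℂ :=
  fun w => ∏ j, ψ a (w j)

theorem ketbra_ghz :
    ketbra (ghz ψ n) (ghz ψ n) =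
      (1 / 2 : ℂ) • ∑ a, ∑ b, tprod fun _ : Fin n => ketbra (ψ a) (ψ b) := by
  have hsq : (1 / (Real.sqrt 2 : ℂ)) * (1 / (Real.sqrt 2 : ℂ)) = 1 / 2 := by
    rw [div_mul_div_comm, ← Complex.ofReal_mul, Real.mul_self_sqrt zero_le_two, one_mul]
    norm_num
  ext w w'
  simp only [tprod_ketbra]
  simp only [Fin.sum_univ_two, Matrix.smul_apply, Matrix.add_apply, ketbra,
    Matrix.vecMulVec_apply, ghz, Pi.star_apply, star_mul', star_add, smul_eq_mul, RCLike.star_def,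
    map_div₀, map_one, map_prod, Complex.conj_ofReal, ← hsq]
  ring

theorem encode_phaseRotation_single (s : ℂ) (a b : Fin 2) :
    encode ψ (phaseRotation s (Matrix.single a b 1)) =
      coherencePhase s a b • ketbra (ψ a) (ψ b) := by
  have hsingle : phaseRotation s (Matrix.single a b 1) =
      coherencePhase s a b • Matrix.single a b 1 := by
    ext i j
    simp only [phaseRotation, Matrix.of_apply, Matrix.smul_apply, Matrix.single_apply, smul_eq_mul]
    split_ifs with h
    · rw [h.1, h.2]
    · rw [mul_zero, mul_zero]
  rw [hsingle, map_smul, encode_single]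

theorem phaseState_arrayCode (s : ℂ) :
    phaseState (arrayCode ψ n) (n * s) = (1 / 2 : ℂ) • ∑ a, ∑ b, tprod fun _ : Fin n =>
      encode ψ (phaseRotation s (Matrix.single a b 1)) := by
  rw [phaseState, encode_apply, Finset.smul_sum]
  refine Finset.sum_congr rfl fun a _ => ?_
  rw [Finset.smul_sum]
  refine Finset.sum_congr rfl fun b _ => ?_
  have hpow : tprod (fun _ : Fin n => encode ψ (phaseRotation s (Matrix.single a b 1))) =
      coherencePhase s a b ^ n • ketbra (arrayCode ψ n a) (arrayCode ψ n b) := by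
    simp only [encode_phaseRotation_single]
    rw [MultilinearMap.map_smul_univ, tprod_ketbra, Finset.prod_const, Finset.card_fin]
    rfl
  rw [hpow, smul_smul, phaseRotation, plusState, Matrix.of_apply, Matrix.of_apply,
    coherencePhase_natCast_mul, mul_comm]

theorem arrayCode_orthonormal [Fintype I] {ψ : Fin 2 → I → ℂ} {n : ℕ}
    (hψ : ∀ k k', star (ψ k) ⬝ᵥ ψ k' = if k = k' then 1 else 0) (hn : 1 ≤ n) (k k' : Fin 2) :
    star (arrayCode ψ n k) ⬝ᵥ arrayCode ψ n k' = if k = k' then 1 else 0 := by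
  have hprod : star (arrayCode ψ n k) ⬝ᵥ arrayCode ψ n k' = ∏ _j : Fin n, star (ψ k) ⬝ᵥ ψ k' := by
    simp only [dotProduct, arrayCode, Finset.prod_univ_sum, Fintype.piFinset_univ, Pi.star_apply,
      star_prod, Finset.prod_mul_distrib]
  rw [hprod, hψ, Finset.prod_const, Finset.card_fin, ite_pow, one_pow,
    zero_pow (Nat.one_le_iff_ne_zero.1 hn)]

end ArrayCode

section TensorPowers

variable {I : Type} (n : ℕ)

theorem continuous_tprod : Continuous (tprod : (Fin n → Op I) → Op (Fin n → I)) := by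
  refine continuous_matrix fun w w' => ?_
  simp only [tprod_apply]
  exact continuous_finsetProd _ fun j _ => (continuous_apply j).matrix_elem _ _

theorem differentiable_tprod [Finite I] {f : ℂ → Op I} (hf : Differentiable ℂ f) :
    Differentiable ℂ fun z => tprod fun _ : Fin n => f z := by
  classical
  cases nonempty_fintype I
  let T : ContinuousMultilinearMap ℂ (fun _ : Fin n => Op I) (Op (Fin n → I)) :=
    ⟨tprod, continuous_tprod n⟩
  exact (T.contDiff (n := 1)).differentiable one_ne_zero |>.comp
    (differentiable_pi.2 fun _ => hf)

variable [Fintype I] [DecidableEq I]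

theorem exists_norm_tprod_sub_le (M : ℝ) :
    ∃ C : ℝ, 0 ≤ C ∧ ∀ A B : Op I, ‖A‖ ≤ M → ‖B‖ ≤ M →
      ‖tprod (fun _ : Fin n => A) - tprod fun _ : Fin n => B‖ ≤ C * ‖A - B‖ := by
  let T : ContinuousMultilinearMap ℂ (fun _ : Fin n => Op I) (Op (Fin n → I)) :=
    ⟨tprod, continuous_tprod n⟩
  refine ⟨‖T‖ * n * |M| ^ (n - 1), by positivity, fun A B hA hB => ?_⟩
  have hconst : ∀ {A : Op I} {R : ℝ}, 0 ≤ R → ‖A‖ ≤ R → ‖fun _ : Fin n => A‖ ≤ R :=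
    fun hR hA => (pi_norm_le_iff_of_nonneg hR).2 fun _ => hA
  refine (T.norm_image_sub_le (fun _ => A) fun _ => B).trans ?_
  rw [Fintype.card_fin]
  gcongr
  · exact max_le (hconst (abs_nonneg M) (hA.trans (le_abs_self M)))
      (hconst (abs_nonneg M) (hB.trans (le_abs_self M)))
  · exact hconst (norm_nonneg _) le_rfl

theorem exists_norm_tprod_sub_le_div {f : ℕ → ℂ → Op I} {g : ℂ → Op I} {S : Set ℂ} {E M : ℝ}
    (hfg : ∀ K : ℕ, 1 ≤ K → ∀ z ∈ S, ‖f K z - g z‖ ≤ E / K) (hg : ∀ z ∈ S, ‖g z‖ ≤ M) :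
    ∃ E' : ℝ, ∀ K : ℕ, 1 ≤ K → ∀ z ∈ S,
      ‖tprod (fun _ : Fin n => f K z) - tprod (fun _ : Fin n => g z)‖ ≤ E' / K := by
  obtain ⟨C, hC, htprod⟩ := exists_norm_tprod_sub_le (I := I) n (|E| + M)
  refine ⟨C * E, fun K hK z hz => ?_⟩
  have hdiff : ‖f K z - g z‖ ≤ |E| :=
    (hfg K hK z hz).trans <| (div_le_div_of_nonneg_right (le_abs_self E) K.cast_nonneg).trans
      (div_le_self (abs_nonneg E) (Nat.one_le_cast.2 hK))
  have hf : ‖f K z‖ ≤ |E| + M := by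
    calc ‖f K z‖ = ‖(f K z - g z) + g z‖ := by rw [sub_add_cancel]
      _ ≤ |E| + M := (norm_add_le _ _).trans (add_le_add hdiff (hg z hz))
  calc ‖tprod (fun _ : Fin n => f K z) - tprod (fun _ : Fin n => g z)‖
      ≤ C * ‖f K z - g z‖ :=
        htprod _ _ hf ((hg z hz).trans (le_add_of_nonneg_left (abs_nonneg E)))
    _ ≤ C * (E / K) := mul_le_mul_of_nonneg_left (hfg K hK z hz) hC
    _ = C * E / K := (mul_div_assoc _ _ _).symm

end TensorPowers

section Positivity

variable {m d : ℕ} {α : Type} [DecidableEq α]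

theorem conjTranspose_onProbe (ℓ : Fin m) (A : Op (Fin d)) :
    (onProbe (α := α) ℓ A)ᴴ = onProbe ℓ Aᴴ := by
  ext p q
  simp only [Matrix.conjTranspose_apply, onProbe, Matrix.of_apply, apply_ite star, star_zero]
  exact if_congr (and_congr (forall₂_congr fun _ _ => eq_comm) eq_comm) rfl rfl

variable [Fintype α] {H L : Op (Fin d)}

theorem posSemidef_rounds_codeQEC [Nonempty ((Fin m → Fin d) × α)] (hH : H.IsHermitian)
    (ψ : Fin 2 → (Fin m → Fin d) × α → ℂ) (J : Fin m → Op ((Fin m → Fin d) × α)) (n K : ℕ) (ω : ℝ)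
    {t : ℝ} (ht : 0 ≤ t) {X : Op (Fin n → (Fin m → Fin d) × α)} (hX : X.PosSemidef) :
    (rounds (tensorPower n (codeQEC ψ J)) (arrayGenerator n m α H L ω) t K X).PosSemidef := by
  have hHn : (∑ j : Fin n, ∑ ℓ : Fin m, onBlock j (onProbe (α := α) ℓ H)).IsHermitian := by
    rw [Matrix.IsHermitian]
    simp only [Matrix.conjTranspose_sum, conjTranspose_onBlock, conjTranspose_onProbe, hH.eq]
  have hs : (0 : ℝ) ≤ t / K := by positivity
  unfold rounds
  generalize t / (K : ℝ) = s at hs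
  induction K with
  | zero => exact hX
  | succ K ih =>
    rw [pow_succ', Module.End.mul_apply, LinearMap.comp_apply]
    exact posSemidef_tensorPower (fun Y => by rw [codeQEC_eq_krausMap, krausMap_apply])
      (posSemidef_evolution hHn hs ih)

end Positivity

section ArrayLimit

variable {m d : ℕ} {α : Type} [DecidableEq α] [Fintype α] {H L : Op (Fin d)}
  {ψ : Fin 2 → (Fin m → Fin d) × α → ℂ}

/-- The state of an array started in the logical GHZ state after `K` rounds of evolution and error
correction, continued to complex frequencies. -/
noncomputable def complexArrayState (H L : Op (Fin d)) (ψ : Fin 2 → (Fin m → Fin d) × α → ℂ)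
    (n : ℕ) (t : ℝ) (K : ℕ) (z : ℂ) : Op (Fin n → (Fin m → Fin d) × α) :=
  (1 / 2 : ℂ) • ∑ a, ∑ b, tprod fun _ : Fin n =>
    complexRounds (codeQEC ψ fun ℓ : Fin m => onProbe ℓ L) (∑ ℓ : Fin m, onProbe ℓ H)
      (fun ℓ : Fin m => onProbe ℓ L) t K z (ketbra (ψ a) (ψ b))

theorem complexArrayState_ofReal (n : ℕ) (t : ℝ) (K : ℕ) (ω : ℝ) :
    complexArrayState H L ψ n t K ω =
      rounds (tensorPower n (codeQEC ψ fun ℓ : Fin m => onProbe ℓ L))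
        (arrayGenerator n m α H L ω) t K (ketbra (ghz ψ n) (ghz ψ n)) := by
  simp only [complexArrayState, ketbra_ghz, map_smul, map_sum, rounds_tprod, complexRounds_ofReal]
  rfl

theorem differentiable_complexArrayState (n : ℕ) (t : ℝ) (K : ℕ) :
    Differentiable ℂ (complexArrayState H L ψ n t K) :=
  Differentiable.fun_const_smul (Differentiable.fun_sum fun _ _ => Differentiable.fun_sum fun _ _ =>
    differentiable_tprod n (differentiable_complexRounds _ _ _ _ _ _)) _

theorem posSemidef_complexArrayState [Nonempty ((Fin m → Fin d) × α)] (hH : H.IsHermitian)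
    (n : ℕ) {t : ℝ} (ht : 0 ≤ t) (K : ℕ) (ω : ℝ) :
    (complexArrayState H L ψ n t K ω).PosSemidef := by
  rw [complexArrayState_ofReal]
  exact posSemidef_rounds_codeQEC hH ψ _ n K ω ht (Matrix.posSemidef_vecMulVec_self_star _)

variable (hψ : ∀ k k', star (ψ k) ⬝ᵥ ψ k' = if k = k' then 1 else 0)
  (hJ : ∀ i : Fin m, codeProj ψ * onProbe i L * codeProj ψ = 0)
  (hJJ : ∀ i j : Fin m, codeProj ψ * (onProbe i L)ᴴ * onProbe j L * codeProj ψ =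
    if i = j then codeProj ψ else 0)
  {q r : ℝ} (hP : codeProj ψ * (∑ ℓ : Fin m, onProbe ℓ H) * codeProj ψ =
    (q : ℂ) • codeProj ψ + (r : ℂ) • logicalZ ψ)

include hψ hJ hJJ hP

theorem exists_norm_complexArrayState_sub_le [Nonempty ((Fin m → Fin d) × α)] (n : ℕ) (t ω : ℝ) :
    ∃ E : ℝ, ∀ K : ℕ, 1 ≤ K → ∀ z : ℂ, ‖z - ω‖ ≤ 1 →
      ‖complexArrayState H L ψ n t K z - phaseState (arrayCode ψ n) (n * (z * (t * r)))‖ ≤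
        E / K := by
  have hterm : ∀ a b, ∃ E : ℝ, ∀ K : ℕ, 1 ≤ K → ∀ z ∈ Metric.closedBall (ω : ℂ) 1,
      ‖(tprod fun _ : Fin n => complexRounds (codeQEC ψ fun ℓ : Fin m => onProbe ℓ L)
          (∑ ℓ : Fin m, onProbe ℓ H) (fun ℓ : Fin m => onProbe ℓ L) t K z (ketbra (ψ a) (ψ b))) -
        tprod fun _ : Fin n =>
          encode ψ (phaseRotation (z * (t * r)) (Matrix.single a b 1))‖ ≤ E / K := fun a b => by
    obtain ⟨E, hE⟩ := exists_norm_complexRounds_sub_le hψ hJ hJJ hP t (‖(ω : ℂ)‖ + 1)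
      (Matrix.single a b 1)
    have hcont : Continuous fun z : ℂ =>
        encode ψ (phaseRotation (z * (t * r)) (Matrix.single a b 1)) :=
      (continuous_iff_continuousAt.2 fun s =>
        (hasDerivAt_encode_phaseRotation hψ _ s).continuousAt).comp (continuous_mul_const _)
    obtain ⟨M, hM⟩ := (isCompact_closedBall (ω : ℂ) 1).exists_bound_of_continuousOn
      hcont.continuousOn
    refine exists_norm_tprod_sub_le_div (E := E) n (fun K hK z hz => ?_) hM
    rw [← encode_single]
    exact hE K hK z (norm_le_norm_add_const_of_dist_le hz)
  choose E hE using hterm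
  refine ⟨∑ a, ∑ b, E a b, fun K hK z hz => ?_⟩
  rw [phaseState_arrayCode, complexArrayState]
  simp only [← smul_sub, ← Finset.sum_sub_distrib]
  rw [norm_smul, Finset.sum_div]
  refine (mul_le_of_le_one_left (norm_nonneg _) (by norm_num)).trans
    (norm_sum_le_of_le _ fun a _ => ?_)
  rw [Finset.sum_div]
  exact norm_sum_le_of_le _ fun b _ => hE a b K hK z (mem_closedBall_iff_norm.2 hz)

theorem tendsto_array_rounds [Nonempty ((Fin m → Fin d) × α)] (n : ℕ) (t ω : ℝ) :
    Tendsto (fun K : ℕ => rounds (tensorPower n (codeQEC ψ fun ℓ : Fin m => onProbe ℓ L))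
      (arrayGenerator n m α H L ω) t K (ketbra (ghz ψ n) (ghz ψ n))) atTop
      (𝓝 (phaseState (arrayCode ψ n) (n * (ω * (t * r))))) := by
  obtain ⟨E, hE⟩ := exists_norm_complexArrayState_sub_le hψ hJ hJJ hP n t ω
  refine tendsto_of_norm_sub_le_div (E := E) fun K hK => ?_
  rw [← complexArrayState_ofReal]
  exact hE K hK ω (by rw [sub_self, norm_zero]; exact zero_le_one)

theorem array_fisherInformation [Nonempty ((Fin m → Fin d) × α)] (hH : H.IsHermitian) {n : ℕ}
    (hn : 1 ≤ n) {t : ℝ} (ht : 0 ≤ t) (ω : ℝ) :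
    IsQFI (fun x : ℝ => phaseState (arrayCode ψ n) (n * (x * (t * r)))) ω
      ((2 * (n * (t * r))) ^ 2) ∧
    ∃ F : ℕ → ℝ, (∀ K, IsQFI (fun x : ℝ =>
      rounds (tensorPower n (codeQEC ψ fun ℓ : Fin m => onProbe ℓ L))
        (arrayGenerator n m α H L x) t K (ketbra (ghz ψ n) (ghz ψ n))) ω (F K)) ∧
      Tendsto F atTop (𝓝 ((2 * (n * (t * r))) ^ 2)) := by
  have hΨ := arrayCode_orthonormal hψ hn
  obtain ⟨E, hE⟩ := exists_norm_complexArrayState_sub_le hψ hJ hJJ hP n t ω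
  set g : ℝ := n * (t * r) with hg
  have hphase : ∀ z : ℂ, (n * (z * (t * r)) : ℂ) = g * z := fun z => by
    rw [hg]
    push_cast
    ring
  have hG : ((g : ℂ) • logicalZ (arrayCode ψ n)).IsHermitian :=
    (isHermitian_logicalZ _).smul (Complex.conj_ofReal g)
  have hlim := isQFI_phaseState hΨ g ω
  simp only [hphase] at hE ⊢
  simp only [← complexArrayState_ofReal]
  rw [← four_mul_secondMoment_phaseState hΨ g (g * ω)]
  exact ⟨hlim, exists_isQFI_tendsto (differentiable_complexArrayState n t)
    (fun z => (hasDerivAt_phaseState_mul hΨ g z).differentiableAt) hE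
    (posSemidef_complexArrayState hH n ht) hG (rotatingFrame_phaseState hΨ g ω) hlim⟩

end ArrayLimit

/-! ### Two-probe marginals -/

section Marginals

theorem trace_twoProbeMarginal_mul {m d : ℕ} {α : Type} [Fintype α] (ℓ ℓ' : Fin m)
    (X : Op ((Fin m → Fin d) × α)) (M : Op (Fin d × Fin d)) :
    (twoProbeMarginal ℓ ℓ' X * M).trace = ∑ w, ∑ w', ∑ x,
      if ∀ k, k ≠ ℓ → k ≠ ℓ' → w k = w' k then
        X (w, x) (w', x) * M (w' ℓ, w' ℓ') (w ℓ, w ℓ') else 0 := by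
  have hfibre : (twoProbeMarginal ℓ ℓ' X * M).trace =
      ∑ pq : (Fin d × Fin d) × (Fin d × Fin d), ∑ s : (Fin m → Fin d) × (Fin m → Fin d) × α,
        (if pq = ((s.1 ℓ, s.1 ℓ'), (s.2.1 ℓ, s.2.1 ℓ')) then
          if ∀ k, k ≠ ℓ → k ≠ ℓ' → s.1 k = s.2.1 k then
            X (s.1, s.2.2) (s.2.1, s.2.2) * M (s.2.1 ℓ, s.2.1 ℓ') (s.1 ℓ, s.1 ℓ') else 0
          else 0) := by
    rw [Fintype.sum_prod_type]
    simp only [Matrix.trace, Matrix.diag_apply, Matrix.mul_apply]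
    refine Finset.sum_congr rfl fun p _ => Finset.sum_congr rfl fun q _ => ?_
    simp only [twoProbeMarginal, Matrix.of_apply, Fintype.sum_prod_type, Finset.sum_mul]
    refine Finset.sum_congr rfl fun w _ => Finset.sum_congr rfl fun w' _ =>
      Finset.sum_congr rfl fun x _ => ?_
    by_cases hpq : (p, q) = ((w ℓ, w ℓ'), (w' ℓ, w' ℓ'))
    · rw [if_pos hpq]
      obtain ⟨rfl, rfl⟩ := Prod.ext_iff.1 hpq
      simp
    · rw [if_neg hpq, if_neg, zero_mul]
      rintro ⟨hp₁, hp₂, hq₁, hq₂, -⟩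
      exact hpq (by rw [hp₁, hp₂, hq₁, hq₂])
  rw [hfibre, Finset.sum_comm]
  simp only [Finset.sum_ite_eq', Finset.mem_univ, if_true,
    Fintype.sum_prod_type (α₁ := Fin m → Fin d)]

variable {m d : ℕ} {α : Type} [DecidableEq α]

theorem onProbe_one (ℓ : Fin m) : onProbe (α := α) ℓ (1 : Op (Fin d)) = 1 := by
  ext p q
  simp only [onProbe, Matrix.of_apply, Matrix.one_apply, ← ite_and]
  refine if_congr ⟨fun h => Prod.ext (funext fun k => ?_) h.1.2, ?_⟩ rfl rfl
  · by_cases hk : k = ℓ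
    · rw [hk, h.2]
    · exact h.1.1 k hk
  · rintro rfl
    exact ⟨⟨fun _ _ => rfl, rfl⟩, rfl⟩

theorem sum_single_apply_mk {ι : Type} [DecidableEq ι] (c : ι → α) (A : Finset ι) (w : ι)
    (x : α) :
    (∑ v ∈ A, Pi.single (v, c v) 1 : ι × α → ℂ) (w, x) = if w ∈ A ∧ c w = x then 1 else 0 := by
  rw [Finset.sum_apply]
  simp only [Pi.single_apply, Prod.mk.injEq, ite_and]
  rw [Finset.sum_ite_eq]
  simp only [eq_comm]

variable [Fintype α]

theorem onProbe_mul_apply (ℓ : Fin m) (A : Op (Fin d)) (M : Op ((Fin m → Fin d) × α))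
    (p q : (Fin m → Fin d) × α) :
    (onProbe ℓ A * M : Op ((Fin m → Fin d) × α)) p q =
      ∑ i, A (p.1 ℓ) i * M (Function.update p.1 ℓ i, p.2) q := by
  rw [Matrix.mul_apply]
  refine (Finset.sum_of_injOn (fun i => (Function.update p.1 ℓ i, p.2))
    (fun i _ i' _ h => by simpa using congrFun (congrArg Prod.fst h) ℓ)
    (fun _ _ => Finset.mem_coe.2 (Finset.mem_univ _)) (fun r _ hr => ?_) fun i _ => ?_).symm
  · rw [onProbe, Matrix.of_apply, if_neg, zero_mul]
    refine fun h => hr ⟨r.1 ℓ, Finset.mem_coe.2 (Finset.mem_univ _), Prod.ext ?_ h.2⟩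
    exact Function.update_eq_iff.2 ⟨rfl, fun k hk => h.1 k hk⟩
  · rw [onProbe, Matrix.of_apply, if_pos ⟨fun k hk => (Function.update_of_ne hk ..).symm, rfl⟩]
    simp only [Function.update_self]

theorem onProbe_mul (ℓ : Fin m) (A B : Op (Fin d)) :
    onProbe (α := α) ℓ (A * B) = onProbe ℓ A * onProbe ℓ B := by
  ext p q
  have hrest : ∀ i, (∀ k, k ≠ ℓ → Function.update p.1 ℓ i k = q.1 k) ↔
      ∀ k, k ≠ ℓ → p.1 k = q.1 k := fun i =>
    forall₂_congr fun k hk => by rw [Function.update_of_ne hk]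
  rw [onProbe_mul_apply]
  simp only [onProbe, Matrix.of_apply, Matrix.mul_apply, Function.update_self, hrest, mul_ite,
    mul_zero]
  split_ifs
  · rfl
  · rw [Finset.sum_const_zero]

theorem onProbe_mul_onProbe_apply {ℓ ℓ' : Fin m} (hℓ : ℓ ≠ ℓ') (A B : Op (Fin d))
    (p q : (Fin m → Fin d) × α) :
    (onProbe ℓ A * onProbe ℓ' B : Op ((Fin m → Fin d) × α)) p q =
      if (∀ k, k ≠ ℓ → k ≠ ℓ' → p.1 k = q.1 k) ∧ p.2 = q.2 then
        A (p.1 ℓ) (q.1 ℓ) * B (p.1 ℓ') (q.1 ℓ') else 0 := by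
  rw [onProbe_mul_apply, Finset.sum_eq_single (q.1 ℓ)]
  · simp only [onProbe, Matrix.of_apply, mul_ite, mul_zero, Function.update_of_ne hℓ.symm]
    refine if_congr (and_congr_left fun _ => ⟨fun h k hk hk' => ?_, fun h k hk' => ?_⟩) rfl rfl
    · rw [← h k hk', Function.update_of_ne hk]
    · by_cases hk : k = ℓ
      · rw [hk, Function.update_self]
      · rw [Function.update_of_ne hk, h k hk hk']
  · intro i _ hi
    rw [onProbe, Matrix.of_apply, if_neg, mul_zero]
    exact fun h => hi (by simpa using h.1 ℓ hℓ)
  · exact fun h => absurd (Finset.mem_univ _) h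

theorem trace_twoProbeMarginal_mul_kronecker {ℓ ℓ' : Fin m} (hℓ : ℓ ≠ ℓ')
    (X : Op ((Fin m → Fin d) × α)) (A B : Op (Fin d)) :
    (twoProbeMarginal ℓ ℓ' X * (A ⊗ₖ B)).trace = (X * (onProbe ℓ A * onProbe ℓ' B)).trace := by
  rw [trace_twoProbeMarginal_mul]
  simp only [Matrix.trace, Matrix.diag_apply, Matrix.mul_apply (M := X),
    onProbe_mul_onProbe_apply hℓ, Fintype.sum_prod_type, Matrix.kroneckerMap_apply]
  refine Finset.sum_congr rfl fun w _ => ?_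
  rw [Finset.sum_comm]
  refine Finset.sum_congr rfl fun x _ => Finset.sum_congr rfl fun w' _ => ?_
  simp only [and_comm (b := _ = x), ite_and, mul_ite, mul_zero, Finset.sum_ite_eq',
    Finset.mem_univ, if_true, eq_comm (a := w' _)]

theorem trace_ketbra_mul {I : Type} [Fintype I] (φ ψ : I → ℂ) (M : Op I) :
    (ketbra φ ψ * M).trace = star ψ ⬝ᵥ M *ᵥ φ := by
  rw [ketbra, Matrix.vecMulVec_mul, Matrix.trace_vecMulVec, dotProduct_comm,
    Matrix.dotProduct_mulVec]

variable {L : Op (Fin d)} {ρ Q : Fin 2 → Op (Fin d)} {ψ : Fin 2 → (Fin m → Fin d) × α → ℂ}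

theorem MultiProbeCondition.dotProduct_onProbe_mul_onProbe (h : MultiProbeCondition L ρ Q ψ)
    {ℓ ℓ' : Fin m} (hℓ : ℓ ≠ ℓ') (A B : Op (Fin d)) (k k' : Fin 2) :
    star (ψ k) ⬝ᵥ (onProbe ℓ A * onProbe ℓ' B) *ᵥ ψ k' =
      if k = k' then (ρ k * A).trace * (ρ k * B).trace - (Q k * A).trace * (Q k * B).trace
      else 0 := by
  rw [← trace_ketbra_mul, ← trace_twoProbeMarginal_mul_kronecker hℓ, h.2 k' k ℓ ℓ' hℓ]
  by_cases hk : k = k'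
  · subst hk
    rw [if_pos rfl, if_pos rfl, sub_mul, ← Matrix.mul_kronecker_mul, ← Matrix.mul_kronecker_mul,
      Matrix.trace_sub, Matrix.trace_kronecker, Matrix.trace_kronecker]
  · rw [if_neg hk, if_neg (Ne.symm hk), zero_mul, Matrix.trace_zero]

theorem MultiProbeCondition.dotProduct_onProbe [Nontrivial (Fin m)]
    (h : MultiProbeCondition L ρ Q ψ) (hρ : ∀ k, (ρ k).trace = 1) (ℓ : Fin m) (A : Op (Fin d))
    (k k' : Fin 2) :
    star (ψ k) ⬝ᵥ onProbe ℓ A *ᵥ ψ k' = if k = k' then (ρ k * A).trace else 0 := by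
  obtain ⟨ℓ', hℓ⟩ := exists_ne ℓ
  have htwo := h.dotProduct_onProbe_mul_onProbe hℓ.symm A 1 k k'
  rwa [onProbe_one, mul_one, mul_one, mul_one, hρ, (h.1 k).2.1, mul_zero, sub_zero, mul_one]
    at htwo

omit [DecidableEq α] in
theorem MultiProbeCondition.dotProduct_eq [Nontrivial (Fin m)]
    (h : MultiProbeCondition L ρ Q ψ) (hρ : ∀ k, (ρ k).trace = 1) (k k' : Fin 2) :
    star (ψ k) ⬝ᵥ ψ k' = if k = k' then 1 else 0 := by
  classical
  have honsite := h.dotProduct_onProbe hρ (Classical.arbitrary _) 1 k k'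
  rwa [onProbe_one, Matrix.one_mulVec, mul_one, hρ] at honsite

theorem MultiProbeCondition.codeProj_mul_onProbe_mul_codeProj [Nontrivial (Fin m)]
    (h : MultiProbeCondition L ρ Q ψ) (hρ : ∀ k, (ρ k).trace = 1) (ℓ : Fin m) (A : Op (Fin d)) :
    codeProj ψ * onProbe ℓ A * codeProj ψ =
      encode ψ (Matrix.diagonal fun k => (ρ k * A).trace) := by
  rw [codeProj_mul_mul_codeProj]
  congr 1
  ext k k'
  simp only [Matrix.of_apply, h.dotProduct_onProbe hρ, Matrix.diagonal_apply]

theorem MultiProbeCondition.codeProj_mul_jump_mul_codeProj [Nontrivial (Fin m)]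
    (h : MultiProbeCondition L ρ Q ψ) (hρ : ∀ k, (ρ k).trace = 1)
    (hL : ∀ k, (ρ k * L).trace = 0) (ℓ : Fin m) :
    codeProj ψ * onProbe ℓ L * codeProj ψ = 0 := by
  simp only [h.codeProj_mul_onProbe_mul_codeProj hρ, hL, Matrix.diagonal_zero, map_zero]

/-- The Knill–Laflamme condition for the single-probe jumps. Between different probes it holds
because `ρ k` and `Q k` are both orthogonal to `L`. -/
theorem MultiProbeCondition.codeProj_mul_jumps_mul_codeProj [Nontrivial (Fin m)]
    (h : MultiProbeCondition L ρ Q ψ) (hρ : ∀ k, (ρ k).trace = 1)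
    (hL : ∀ k, (ρ k * L).trace = 0) (hLL : ∀ k, (ρ k * (Lᴴ * L)).trace = 1) (i j : Fin m) :
    codeProj ψ * (onProbe i L)ᴴ * onProbe j L * codeProj ψ = if i = j then codeProj ψ else 0 := by
  rw [mul_assoc (codeProj ψ), conjTranspose_onProbe]
  split_ifs with hij
  · rw [hij, ← onProbe_mul, h.codeProj_mul_onProbe_mul_codeProj hρ]
    simp only [hLL, Matrix.diagonal_one, encode_one]
  · rw [codeProj_mul_mul_codeProj]
    simp only [h.dotProduct_onProbe_mul_onProbe hij, hL, (h.1 _).2.2, mul_zero, sub_self,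
      ite_self]
    exact map_zero _

theorem MultiProbeCondition.codeProj_mul_sum_onProbe_mul_codeProj [Nontrivial (Fin m)]
    (h : MultiProbeCondition L ρ Q ψ) (hρ : ∀ k, (ρ k).trace = 1) {A : Op (Fin d)} {a b : ℝ}
    (ha : (ρ 0 * A).trace = a) (hb : (ρ 1 * A).trace = b) :
    codeProj ψ * (∑ ℓ, onProbe ℓ A) * codeProj ψ =
      ((m * (a + b) / 2 : ℝ) : ℂ) • codeProj ψ + ((m * (a - b) / 2 : ℝ) : ℂ) • logicalZ ψ := by
  have hdiag : (Matrix.diagonal fun k => (ρ k * A).trace) =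
      ((a + b) / 2 : ℂ) • 1 + ((a - b) / 2 : ℂ) • pauliZ := by
    ext k k'
    fin_cases k <;> fin_cases k' <;> simp [pauliZ, zsign, ha, hb] <;> ring
  simp only [Finset.mul_sum, Finset.sum_mul, h.codeProj_mul_onProbe_mul_codeProj hρ, hdiag,
    map_add, map_smul, encode_one, encode_pauliZ, Finset.sum_const, Finset.card_univ,
    Fintype.card_fin]
  push_cast
  module

/-- The number of pairs of strings contributing to the entry `(p, q)` of the two-probe marginal of
`|φ⟩⟨ψ|`, for equal superpositions `φ`, `ψ` of the strings in `A`, `B` tagged by `c`. -/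
def pairCount (c : (Fin m → Fin d) → α) (A B : Finset (Fin m → Fin d)) (ℓ ℓ' : Fin m)
    (p q : Fin d × Fin d) : ℕ :=
  ∑ w ∈ A, ∑ w' ∈ B, if c w = c w' ∧ w ℓ = p.1 ∧ w ℓ' = p.2 ∧ w' ℓ = q.1 ∧ w' ℓ' = q.2 ∧
    (∀ k, k ≠ ℓ → k ≠ ℓ' → w k = w' k) then 1 else 0

theorem twoProbeMarginal_ketbra_sum_single (ℓ ℓ' : Fin m) (c : (Fin m → Fin d) → α)
    (A B : Finset (Fin m → Fin d)) (a b : ℂ) (p q : Fin d × Fin d) :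
    twoProbeMarginal ℓ ℓ' (ketbra (a • ∑ w ∈ A, Pi.single (w, c w) 1 :
      (Fin m → Fin d) × α → ℂ) (b • ∑ w ∈ B, Pi.single (w, c w) 1)) p q =
      a * star b * (pairCount c A B ℓ ℓ' p q : ℂ) := by
  simp only [twoProbeMarginal, Matrix.of_apply, ketbra, Matrix.vecMulVec_apply, Pi.smul_apply,
    Pi.star_apply, smul_eq_mul, sum_single_apply_mk, pairCount]
  push_cast
  rw [Finset.mul_sum, ← Finset.sum_subset (Finset.subset_univ A)]
  · refine Finset.sum_congr rfl fun w hw => ?_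
    rw [Finset.mul_sum, ← Finset.sum_subset (Finset.subset_univ B)]
    · refine Finset.sum_congr rfl fun w' hw' => ?_
      rw [Finset.sum_eq_single (c w)]
      · simp only [hw, hw', true_and, if_true, eq_comm (a := c w')]
        by_cases hc : c w = c w' <;> simp [hc]
      · intro x _ hx
        simp [Ne.symm hx]
      · simp
    · intro w' _ hw'
      simp [hw']
  · intro w _ hw
    simp [hw]

end Marginals

/-! ### Distance of the Hamiltonian to the Lindblad span -/

theorem half_one_mem_lindbladSpan {I : Type} [Fintype I] [DecidableEq I] (L : Op I) :
    (1 / 2 : ℂ) • (1 : Op I) ∈ lindbladSpan L := by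
  have hreal : (1 / 2 : ℂ) • (1 : Op I) = (1 / 2 : ℝ) • 1 := by
    ext i j
    simp [Complex.real_smul]
  rw [hreal]
  exact Submodule.smul_mem _ _ (Submodule.subset_span (Set.mem_insert _ _))

theorem qutritS_mem_lindbladSpan : qutritS ∈ lindbladSpan qutritL :=
  Submodule.sub_mem _ (half_one_mem_lindbladSpan _) (Submodule.subset_span (by simp))

theorem qutritH_sub_qutritS :
    qutritH - qutritS = Matrix.diagonal ![1 / 2, -1 / 2, 1 / 2] := by
  ext i j
  fin_cases i <;> fin_cases j <;>
    simp [qutritH, qutritS, qutritL, Matrix.mul_apply, Fin.sum_univ_three] <;> norm_num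

theorem norm_qutritH_sub_qutritS : ‖qutritH - qutritS‖ = 1 / 2 := by
  rw [qutritH_sub_qutritS, Matrix.l2_opNorm_diagonal]
  refine le_antisymm ((pi_norm_le_iff_of_nonneg (by norm_num)).2 fun i => ?_) ?_
  · fin_cases i <;> simp
  · simpa using norm_le_pi_norm (![1 / 2, -1 / 2, 1 / 2] : Fin 3 → ℂ) 0

theorem trace_qutritRho_zero_mul (A : Op (Fin 3)) :
    (qutritRho 0 * A).trace = 1 / 2 * A 0 0 + 1 / 2 * A 2 2 := by
  simp [qutritRho, Matrix.trace, Fin.sum_univ_three]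

theorem trace_qutritRho_one_mul (A : Op (Fin 3)) : (qutritRho 1 * A).trace = A 1 1 := by
  simp [qutritRho, Matrix.trace, Fin.sum_univ_three]

theorem trace_qutritRho_sub_mul_eq_zero {X : Op (Fin 3)} (hX : X ∈ lindbladSpan qutritL) :
    ((qutritRho 0 - qutritRho 1) * X).trace = 0 := by
  induction hX using Submodule.span_induction with
  | mem X hX =>
    rw [sub_mul, Matrix.trace_sub, trace_qutritRho_zero_mul, trace_qutritRho_one_mul]
    rcases hX with rfl | rfl | rfl | rfl <;>
      simp [qutritL, Matrix.mul_apply, Fin.sum_univ_three] <;> norm_num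
  | zero => simp
  | add X Y _ _ hX hY => rw [mul_add, Matrix.trace_add, hX, hY, add_zero]
  | smul c X _ hX => rw [Matrix.mul_smul, Matrix.trace_smul, hX, smul_zero]

theorem trace_qutritRho_sub_mul_qutritH :
    ((qutritRho 0 - qutritRho 1) * qutritH).trace = 1 := by
  rw [sub_mul, Matrix.trace_sub, trace_qutritRho_zero_mul, trace_qutritRho_one_mul]
  simp only [qutritH, Matrix.of_apply, Matrix.cons_val]
  norm_num

theorem norm_trace_qutritRho_sub_mul_le (A : Op (Fin 3)) :
    ‖((qutritRho 0 - qutritRho 1) * A).trace‖ ≤ 2 * ‖A‖ := by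
  rw [sub_mul, Matrix.trace_sub, trace_qutritRho_zero_mul, trace_qutritRho_one_mul]
  have hentries : ‖1 / 2 * A 0 0 + 1 / 2 * A 2 2 - A 1 1‖ ≤
      1 / 2 * ‖A 0 0‖ + 1 / 2 * ‖A 2 2‖ + ‖A 1 1‖ := by
    refine (norm_sub_le _ _).trans (add_le_add ((norm_add_le _ _).trans ?_) le_rfl)
    simp
  linarith [norm_entry_le_l2_opNorm A 0 0, norm_entry_le_l2_opNorm A 1 1,
    norm_entry_le_l2_opNorm A 2 2]

theorem half_le_norm_qutritH_sub {X : Op (Fin 3)} (hX : X ∈ lindbladSpan qutritL) :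
    1 / 2 ≤ ‖qutritH - X‖ := by
  have htrace : ((qutritRho 0 - qutritRho 1) * (qutritH - X)).trace = 1 := by
    rw [mul_sub, Matrix.trace_sub, trace_qutritRho_sub_mul_eq_zero hX,
      trace_qutritRho_sub_mul_qutritH, sub_zero]
  have hbound := norm_trace_qutritRho_sub_mul_le (qutritH - X)
  rw [htrace, norm_one] at hbound
  linarith

theorem qutritH_notMem_lindbladSpan : qutritH ∉ lindbladSpan qutritL := fun hmem => by
  have hle := half_le_norm_qutritH_sub hmem
  rw [sub_self, norm_zero] at hle
  norm_num at hle

theorem isLeast_norm_qutritH_sub : IsLeast ((fun X : Op (Fin 3) => ‖qutritH - X‖) ''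
    (lindbladSpan qutritL : Set (Op (Fin 3)))) ‖qutritH - qutritS‖ := by
  refine ⟨⟨_, qutritS_mem_lindbladSpan, rfl⟩, ?_⟩
  rintro _ ⟨X, hX, rfl⟩
  exact norm_qutritH_sub_qutritS.trans_le (half_le_norm_qutritH_sub hX)

theorem lindbladDist_qutrit : lindbladDist qutritH qutritL = ‖qutritH - qutritS‖ :=
  isLeast_norm_qutritH_sub.csInf_eq

/-! ### The optimal pair of density operators -/

theorem isDensity_qutritRho (k : Fin 2) : IsDensity (qutritRho k) := by
  fin_cases k
  · refine ⟨Matrix.PosSemidef.diagonal fun i => ?_, ?_⟩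
    · fin_cases i <;> simp
    · simp only [qutritRho, Fin.zero_eta, Matrix.cons_val, Matrix.trace_diagonal,
        Fin.sum_univ_three]
      norm_num
  · refine ⟨Matrix.PosSemidef.diagonal fun i => ?_, ?_⟩
    · fin_cases i <;> simp
    · simp [qutritRho, Matrix.trace, Fin.sum_univ_three]

theorem apply_eq_zero_of_diag_eq_zero {I : Type} [Finite I] {A : Op I} (hA : A.PosSemidef)
    {j : I} (hj : A j j = 0) (i : I) : A i j = 0 ∧ A j i = 0 := by
  classical
  cases nonempty_fintype I
  have hker : A *ᵥ Pi.single j 1 = 0 := (hA.dotProduct_mulVec_zero_iff _).1 (by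
    rw [Matrix.mulVec_single_one, Pi.star_single, star_one, single_dotProduct, one_mul]
    exact hj)
  have hcol : A i j = 0 := by
    rw [Matrix.mulVec_single_one] at hker
    exact congrFun hker i
  exact ⟨hcol, by rw [← hA.isHermitian.apply, hcol, star_zero]⟩

/-- The value `1` is the maximum of the trace, attained only when `σ 0` and `σ 1` are supported on
the two eigenspaces of the diagonal matrix. -/
theorem populations_eq_zero_of_trace_eq_one {σ : Fin 2 → Op (Fin 3)}
    (hσ : ∀ k, IsDensity (σ k))
    (htrace : ((σ 0 - σ 1) * Matrix.diagonal ![1 / 2, -1 / 2, 1 / 2]).trace = 1) :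
    σ 0 1 1 = 0 ∧ σ 1 0 0 = 0 ∧ σ 1 2 2 = 0 := by
  have htrace₀ : σ 0 0 0 + σ 0 1 1 + σ 0 2 2 = 1 := by
    simpa [Matrix.trace, Fin.sum_univ_three] using (hσ 0).2
  have htrace₁ : σ 1 0 0 + σ 1 1 1 + σ 1 2 2 = 1 := by
    simpa [Matrix.trace, Fin.sum_univ_three] using (hσ 1).2
  have hsum : σ 0 1 1 + σ 1 0 0 + σ 1 2 2 = 0 := by
    simp only [Matrix.trace, Matrix.diag_apply, Matrix.mul_diagonal, Fin.sum_univ_three,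
      Matrix.sub_apply, Matrix.cons_val] at htrace
    linear_combination htrace₀ / 2 + htrace₁ / 2 - htrace
  have hnonneg : ∀ k i, 0 ≤ σ k i i := fun k i => (hσ k).1.diag_nonneg
  obtain ⟨hsum', h22⟩ :=
    (add_eq_zero_iff_of_nonneg (add_nonneg (hnonneg 0 1) (hnonneg 1 0)) (hnonneg 1 2)).1 hsum
  obtain ⟨h11, h00⟩ := (add_eq_zero_iff_of_nonneg (hnonneg 0 1) (hnonneg 1 0)).1 hsum'
  exact ⟨h11, h00, h22⟩

theorem eq_qutritRho_one {ρ : Op (Fin 3)} (hρ : IsDensity ρ) (h₀ : ρ 0 0 = 0) (h₂ : ρ 2 2 = 0) :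
    ρ = qutritRho 1 := by
  have hrow₀ := apply_eq_zero_of_diag_eq_zero hρ.1 h₀
  have hrow₂ := apply_eq_zero_of_diag_eq_zero hρ.1 h₂
  have h₁ : ρ 1 1 = 1 := by
    simpa [Matrix.trace, Fin.sum_univ_three, h₀, h₂] using hρ.2
  ext i j
  fin_cases i <;> fin_cases j <;> simp [qutritRho, h₀, h₁, h₂, hrow₀, hrow₂]

theorem eq_qutritRho_zero {ρ : Op (Fin 3)} (hρ : IsDensity ρ) (h₁ : ρ 1 1 = 0)
    (hX : ∀ X ∈ lindbladSpan qutritL, ((ρ - qutritRho 1) * X).trace = 0) : ρ = qutritRho 0 := by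
  have hrow₁ := apply_eq_zero_of_diag_eq_zero hρ.1 h₁
  have hgen : ∀ X ∈ lindbladSpan qutritL, (ρ * X).trace = X 1 1 := fun X hXmem => by
    rw [← trace_qutritRho_one_mul X, ← sub_eq_zero, ← Matrix.trace_sub, ← sub_mul, hX X hXmem]
  have hre : ρ 0 2 + ρ 2 0 = 0 := by
    simpa [qutritL, Matrix.trace, Matrix.mul_apply, Fin.sum_univ_three, hrow₁, h₁] using
      hgen (qutritL + qutritLᴴ) (Submodule.subset_span (by simp))
  have him : -(Complex.I * ρ 0 2) + Complex.I * ρ 2 0 = 0 := by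
    simpa [qutritL, Matrix.trace, Matrix.mul_apply, Fin.sum_univ_three, hrow₁, h₁] using
      hgen (Complex.I • (qutritL - qutritLᴴ)) (Submodule.subset_span (by simp))
  have h₂ : ρ 2 2 * (1 + 1) = 1 := by
    simpa [qutritL, Matrix.trace, Matrix.mul_apply, Fin.sum_univ_three, hrow₁, h₁] using
      hgen (qutritLᴴ * qutritL) (Submodule.subset_span (by simp))
  have htrace : ρ 0 0 + ρ 2 2 = 1 := by
    simpa [Matrix.trace, Fin.sum_univ_three, h₁] using hρ.2
  have h₂' : ρ 2 2 = 1 / 2 := by linear_combination h₂ / 2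
  have h₀ : ρ 0 0 = 1 / 2 := by linear_combination htrace - h₂'
  have h₀₂ : ρ 0 2 = 0 := by
    linear_combination hre / 2 + Complex.I / 2 * him + (ρ 0 2 - ρ 2 0) / 2 * Complex.I_mul_I
  have h₂₀ : ρ 2 0 = 0 := by linear_combination hre - h₀₂
  ext i j
  fin_cases i <;> fin_cases j <;> simp [qutritRho, h₀, h₁, h₂', hrow₁, h₀₂, h₂₀]

theorem eq_qutritRho {σ : Fin 2 → Op (Fin 3)} (hσ : ∀ k, IsDensity (σ k))
    (hH : ((σ 0 - σ 1) * qutritH).trace = 1)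
    (hX : ∀ X ∈ lindbladSpan qutritL, ((σ 0 - σ 1) * X).trace = 0) : σ = qutritRho := by
  have htrace : ((σ 0 - σ 1) * Matrix.diagonal ![1 / 2, -1 / 2, 1 / 2]).trace = 1 := by
    rw [← qutritH_sub_qutritS, mul_sub, Matrix.trace_sub, hH, hX _ qutritS_mem_lindbladSpan,
      sub_zero]
  obtain ⟨h₁₁, h₀₀, h₂₂⟩ := populations_eq_zero_of_trace_eq_one hσ htrace
  have hσ₁ := eq_qutritRho_one (hσ 1) h₀₀ h₂₂
  have hσ₀ := eq_qutritRho_zero (hσ 0) h₁₁ (hσ₁ ▸ hX)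
  funext k
  fin_cases k
  exacts [hσ₀, hσ₁]

theorem trace_qutritRho_zero_mul_qutritRho_one : (qutritRho 0 * qutritRho 1).trace = 0 := by
  simp [qutritRho, Fin.sum_univ_three]

theorem optimal_pair_iff (σ : Fin 2 → Op (Fin 3)) :
    ((∀ k, IsDensity (σ k)) ∧
      ((σ 0 - σ 1) * qutritH).trace = ((2 * lindbladDist qutritH qutritL : ℝ) : ℂ) ∧
      ∀ X ∈ lindbladSpan qutritL, ((σ 0 - σ 1) * X).trace = 0) ↔ σ = qutritRho := by
  have hdist : ((2 * lindbladDist qutritH qutritL : ℝ) : ℂ) = 1 := by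
    rw [lindbladDist_qutrit, norm_qutritH_sub_qutritS]
    norm_num
  rw [hdist]
  constructor
  · rintro ⟨hσ, hH, hX⟩
    exact eq_qutritRho hσ hH hX
  · rintro rfl
    exact ⟨isDensity_qutritRho, trace_qutritRho_sub_mul_qutritH,
      fun X => trace_qutritRho_sub_mul_eq_zero⟩

/-! ### The code words -/

theorem W₀_eq : W₀ = {![0, 0, 2, 2], ![2, 2, 0, 0], ![0, 2, 0, 2], ![2, 0, 2, 0], ![0, 2, 2, 0],
    ![2, 0, 0, 2]} := by
  decide +kernel

/-- The ancilla state attached to a string by the code words `code41`. -/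
def tag (w : Fin 4 → Fin 3) : Fin 3 :=
  if w 0 = w 1 then 0 else if w 0 = w 2 then 1 else 2

theorem code41_eq_taggedCode : code41 = taggedCode tag := by
  have htag : tag ![0, 0, 2, 2] = 0 ∧ tag ![2, 2, 0, 0] = 0 ∧ tag ![0, 2, 0, 2] = 1 ∧
      tag ![2, 0, 2, 0] = 1 ∧ tag ![0, 2, 2, 0] = 2 ∧ tag ![2, 0, 0, 2] = 2 ∧
      tag ![1, 1, 1, 1] = 0 := by decide
  rw [taggedCode, W₀_eq, Finset.sum_insert (by decide), Finset.sum_insert (by decide),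
    Finset.sum_insert (by decide), Finset.sum_insert (by decide), Finset.sum_insert (by decide),
    Finset.sum_singleton, code41]
  simp only [htag, ket, add_assoc]

/-- The strings in the superposition of each code word. -/
def words : Fin 2 → Finset (Fin 4 → Fin 3) := ![W₀, {![1, 1, 1, 1]}]

/-- The amplitude of each string in a code word. -/
noncomputable def amplitude : Fin 2 → ℂ := ![1 / (Real.sqrt 6 : ℂ), 1]

theorem taggedCode_apply {D : ℕ} (c : (Fin 4 → Fin 3) → Fin D) (k : Fin 2) :
    taggedCode c k = amplitude k • ∑ w ∈ words k, Pi.single (w, c w) 1 := by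
  fin_cases k
  · rfl
  · simp [taggedCode, amplitude, words]

theorem twoProbeMarginal_taggedCode {D : ℕ} (c : (Fin 4 → Fin 3) → Fin D) (k k' : Fin 2)
    (ℓ ℓ' : Fin 4) (p q : Fin 3 × Fin 3) :
    twoProbeMarginal ℓ ℓ' (ketbra (taggedCode c k) (taggedCode c k')) p q =
      amplitude k * star (amplitude k') * (pairCount c (words k) (words k') ℓ ℓ' p q : ℂ) := by
  rw [taggedCode_apply, taggedCode_apply, twoProbeMarginal_ketbra_sum_single]

theorem amplitude_zero_mul_star : amplitude 0 * star (amplitude 0) = 1 / 6 := by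
  have hsq : ((Real.sqrt 6 : ℝ) : ℂ) * (Real.sqrt 6 : ℝ) = 6 := by
    exact_mod_cast Real.mul_self_sqrt (by norm_num : (0 : ℝ) ≤ 6)
  simp only [amplitude, Matrix.cons_val_zero, RCLike.star_def, map_div₀, map_one,
    Complex.conj_ofReal]
  rw [div_mul_div_comm, hsq, one_mul]

/-! ### The multi-probe condition -/

section Marginals

variable {ℓ ℓ' : Fin 4} (hℓ : ℓ ≠ ℓ')

include hℓ

theorem pairCount_tag_words_zero (p q : Fin 3 × Fin 3) :
    pairCount tag (words 0) (words 0) ℓ ℓ' p q = if p = q then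
      if p.1 = 1 ∨ p.2 = 1 then 0 else if p.1 = p.2 then 1 else 2 else 0 := by
  rw [words, W₀_eq]
  revert ℓ ℓ' p q
  decide +kernel

theorem pairCount_tag_words_one (p q : Fin 3 × Fin 3) :
    pairCount tag (words 1) (words 1) ℓ ℓ' p q = if p = q ∧ p = (1, 1) then 1 else 0 := by
  revert ℓ ℓ' p q
  decide +kernel

theorem pairCount_tag_words_of_ne {k k' : Fin 2} (hk : k ≠ k') (p q : Fin 3 × Fin 3) :
    pairCount tag (words k) (words k') ℓ ℓ' p q = 0 := by
  rw [words, W₀_eq]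
  revert k k' ℓ ℓ' p q
  decide +kernel

theorem twoProbeMarginal_code41_zero :
    twoProbeMarginal ℓ ℓ' (ketbra (code41 0) (code41 0)) =
      qutritRho 0 ⊗ₖ qutritRho 0 - qutritQ 0 ⊗ₖ qutritQ 0 := by
  have hsq : (1 / (Real.sqrt 12 : ℂ)) * (1 / (Real.sqrt 12 : ℂ)) = 1 / 12 := by
    rw [div_mul_div_comm, one_mul, ← Complex.ofReal_mul, Real.mul_self_sqrt (by norm_num)]
    norm_num
  ext p q
  rw [code41_eq_taggedCode, twoProbeMarginal_taggedCode, amplitude_zero_mul_star,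
    pairCount_tag_words_zero hℓ]
  simp only [qutritRho, qutritQ, Matrix.cons_val_zero, Matrix.smul_kronecker,
    Matrix.kronecker_smul, smul_smul, hsq, Matrix.diagonal_kronecker_diagonal, Matrix.sub_apply,
    Matrix.smul_apply, Matrix.diagonal_apply]
  by_cases hpq : p = q
  · simp only [if_pos hpq]
    obtain ⟨i, j⟩ := p
    fin_cases i <;> fin_cases j <;> norm_num
  · simp [hpq]

theorem twoProbeMarginal_code41_one :
    twoProbeMarginal ℓ ℓ' (ketbra (code41 1) (code41 1)) =
      qutritRho 1 ⊗ₖ qutritRho 1 - qutritQ 1 ⊗ₖ qutritQ 1 := by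
  ext p q
  rw [code41_eq_taggedCode, twoProbeMarginal_taggedCode, pairCount_tag_words_one hℓ]
  simp only [amplitude, qutritRho, qutritQ, Matrix.cons_val_one, Matrix.cons_val_fin_one,
    Matrix.diagonal_kronecker_diagonal, Matrix.zero_kronecker, sub_zero, Matrix.diagonal_apply,
    star_one, one_mul]
  by_cases hpq : p = q
  · simp only [hpq, true_and, if_true]
    obtain ⟨i, j⟩ := q
    fin_cases i <;> fin_cases j <;> simp
  · simp [hpq]

theorem twoProbeMarginal_code41_of_ne {k k' : Fin 2} (hk : k ≠ k') :
    twoProbeMarginal ℓ ℓ' (ketbra (code41 k) (code41 k')) = 0 := by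
  ext p q
  rw [code41_eq_taggedCode, twoProbeMarginal_taggedCode, pairCount_tag_words_of_ne hℓ hk,
    Nat.cast_zero, mul_zero, Matrix.zero_apply]

end Marginals

theorem qutritQ_admissible (k : Fin 2) : (qutritQ k).IsHermitian ∧ (qutritQ k).trace = 0 ∧
    (qutritQ k * qutritL).trace = 0 := by
  fin_cases k
  · refine ⟨?_, ?_, ?_⟩
    · ext i j
      fin_cases i <;> fin_cases j <;> simp [qutritQ]
    · simp [qutritQ, Matrix.trace, Fin.sum_univ_three]
    · simp [qutritQ, qutritL, Matrix.trace, Matrix.mul_apply, Fin.sum_univ_three, Matrix.diagonal]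
  · simp [qutritQ]

theorem multiProbeCondition_code41 :
    MultiProbeCondition qutritL qutritRho qutritQ code41 := by
  refine ⟨qutritQ_admissible, fun k k' ℓ ℓ' hℓ => ?_⟩
  split_ifs with hk
  · subst hk
    fin_cases k
    exacts [twoProbeMarginal_code41_zero hℓ, twoProbeMarginal_code41_one hℓ]
  · exact twoProbeMarginal_code41_of_ne hℓ hk

theorem trace_qutritRho (k : Fin 2) : (qutritRho k).trace = 1 := (isDensity_qutritRho k).2

theorem trace_qutritRho_mul_qutritL (k : Fin 2) : (qutritRho k * qutritL).trace = 0 := by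
  fin_cases k
  · simp [trace_qutritRho_zero_mul, qutritL]
  · simp [trace_qutritRho_one_mul, qutritL]

theorem trace_qutritRho_mul_qutritL_sq (k : Fin 2) :
    (qutritRho k * (qutritLᴴ * qutritL)).trace = 1 := by
  fin_cases k
  · simp [trace_qutritRho_zero_mul, qutritL, Matrix.mul_apply, Fin.sum_univ_three]
    norm_num
  · simp [trace_qutritRho_one_mul, qutritL, Matrix.mul_apply, Fin.sum_univ_three]

theorem orthonormal_code41 (k k' : Fin 2) :
    star (code41 k) ⬝ᵥ code41 k' = if k = k' then 1 else 0 :=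
  multiProbeCondition_code41.dotProduct_eq trace_qutritRho k k'

theorem codeProj_code41_mul_jump_mul (ℓ : Fin 4) :
    codeProj code41 * onProbe ℓ qutritL * codeProj code41 = 0 :=
  multiProbeCondition_code41.codeProj_mul_jump_mul_codeProj trace_qutritRho
    trace_qutritRho_mul_qutritL ℓ

theorem codeProj_code41_mul_jumps_mul (i j : Fin 4) :
    codeProj code41 * (onProbe i qutritL)ᴴ * onProbe j qutritL * codeProj code41 =
      if i = j then codeProj code41 else 0 :=
  multiProbeCondition_code41.codeProj_mul_jumps_mul_codeProj trace_qutritRho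
    trace_qutritRho_mul_qutritL trace_qutritRho_mul_qutritL_sq i j

theorem codeProj_code41_mul_hamiltonian_mul :
    codeProj code41 * (∑ ℓ, onProbe ℓ qutritH) * codeProj code41 =
      ((-2 : ℝ) : ℂ) • codeProj code41 + ((2 : ℝ) : ℂ) • logicalZ code41 := by
  have hzero : (qutritRho 0 * qutritH).trace = ((0 : ℝ) : ℂ) := by
    simp [trace_qutritRho_zero_mul, qutritH]
  have hone : (qutritRho 1 * qutritH).trace = ((-1 : ℝ) : ℂ) := by
    simp [trace_qutritRho_one_mul, qutritH]
  rw [multiProbeCondition_code41.codeProj_mul_sum_onProbe_mul_codeProj trace_qutritRho hzero hone]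
  norm_num

theorem isHermitian_qutritH : qutritH.IsHermitian := by
  ext i j
  fin_cases i <;> fin_cases j <;> simp [qutritH]

/-! ### The conflict graph -/

theorem comp_swap_of_agree_off : ∀ w ∈ insert ![1, 1, 1, 1] W₀, ∀ w' ∈ insert ![1, 1, 1, 1] W₀,
    ∀ ℓ ℓ' : Fin 4, w ≠ w' → (∀ k, k ≠ ℓ → k ≠ ℓ' → w k = w' k) →
      w ℓ ≠ w ℓ' ∧ w' = w ∘ Equiv.swap ℓ ℓ' := by
  rw [W₀_eq]
  decide +kernel

theorem mem_W₀_of_apply_ne : ∀ w ∈ insert ![1, 1, 1, 1] W₀, ∀ ℓ ℓ' : Fin 4, w ℓ ≠ w ℓ' →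
    w ∈ W₀ ∧ (w ℓ = 0 ∧ w ℓ' = 2 ∨ w ℓ = 2 ∧ w ℓ' = 0) := by
  rw [W₀_eq]
  decide +kernel

theorem CodeString.mem_insert (w : CodeString) : w.1 ∈ insert ![1, 1, 1, 1] W₀ :=
  Finset.mem_insert.2 w.2.symm

theorem onTwoProbes_apply_ne_zero {m d : ℕ} {ℓ ℓ' : Fin m} {B : Op (Fin d × Fin d)}
    {w w' : Fin m → Fin d} (h : onTwoProbes ℓ ℓ' B w w' ≠ 0) :
    ∀ k, k ≠ ℓ → k ≠ ℓ' → w k = w' k := by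
  by_contra hne
  exact h (by rw [onTwoProbes, Matrix.of_apply, if_neg hne])

theorem onTwoProbes_apply_comp_swap {m d : ℕ} (ℓ ℓ' : Fin m) (B : Op (Fin d × Fin d))
    (w : Fin m → Fin d) :
    onTwoProbes ℓ ℓ' B w (w ∘ Equiv.swap ℓ ℓ') = B (w ℓ, w ℓ') (w ℓ', w ℓ) := by
  rw [onTwoProbes, Matrix.of_apply, if_pos]
  · simp only [Function.comp_apply, Equiv.swap_apply_left, Equiv.swap_apply_right]
  · intro k hleft hright
    rw [Function.comp_apply, Equiv.swap_apply_of_ne_of_ne hleft hright]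

/-- `⟨20| L† ⊗ L |02⟩ = |⟨0| L |2⟩|²` is nonzero. -/
theorem exists_onTwoProbes_apply_comp_swap_ne_zero {w : Fin 4 → Fin 3} {ℓ ℓ' : Fin 4}
    (h₂ : w ℓ = 2) (h₀ : w ℓ' = 0) :
    ∃ B ∈ twoProbeSpan qutritL, ∃ i j : Fin 4,
      i ≠ j ∧ onTwoProbes i j B w (w ∘ Equiv.swap ℓ ℓ') ≠ 0 := by
  refine ⟨qutritLᴴ ⊗ₖ qutritL, Submodule.subset_span (Or.inr rfl), ℓ, ℓ', ?_, ?_⟩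
  · rintro rfl
    exact absurd (h₂.symm.trans h₀) (by decide)
  · rw [onTwoProbes_apply_comp_swap, h₂, h₀]
    simp [qutritL]

theorem conflictGraph_adj_iff (w w' : CodeString) : conflictGraph.Adj w w' ↔
    ∃ ℓ ℓ' : Fin 4, w.1 ℓ ≠ w.1 ℓ' ∧ w'.1 = w.1 ∘ Equiv.swap ℓ ℓ' := by
  rw [conflictGraph, SimpleGraph.fromRel_adj]
  constructor
  · rintro ⟨hne, hconflict⟩
    obtain ⟨ℓ, ℓ', hagree⟩ : ∃ ℓ ℓ', ∀ k, k ≠ ℓ → k ≠ ℓ' → w.1 k = w'.1 k := by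
      rcases hconflict with ⟨B, -, ℓ, ℓ', -, hB⟩ | ⟨B, -, ℓ, ℓ', -, hB⟩
      · exact ⟨ℓ, ℓ', onTwoProbes_apply_ne_zero hB⟩
      · exact ⟨ℓ, ℓ', fun k hk hk' => (onTwoProbes_apply_ne_zero hB k hk hk').symm⟩
    exact ⟨ℓ, ℓ', comp_swap_of_agree_off _ w.mem_insert _ w'.mem_insert ℓ ℓ'
      (Subtype.coe_injective.ne hne) hagree⟩
  · rintro ⟨ℓ, ℓ', hℓ, hswap⟩
    refine ⟨?_, Or.inl ?_⟩
    · rintro rfl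
      exact hℓ (by simpa using congrFun hswap ℓ)
    · rcases (mem_W₀_of_apply_ne _ w.mem_insert ℓ ℓ' hℓ).2 with ⟨h₀, h₂⟩ | ⟨h₂, h₀⟩
      · rw [hswap, Equiv.swap_comm]
        exact exists_onTwoProbes_apply_comp_swap_ne_zero h₂ h₀
      · rw [hswap]
        exact exists_onTwoProbes_apply_comp_swap_ne_zero h₂ h₀

theorem tag_ne_tag_comp_swap : ∀ w ∈ W₀, ∀ ℓ ℓ' : Fin 4, w ℓ ≠ w ℓ' →
    tag w ≠ tag (w ∘ Equiv.swap ℓ ℓ') := by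
  rw [W₀_eq]
  decide +kernel

theorem colorable_conflictGraph : conflictGraph.Colorable 3 := by
  refine ⟨SimpleGraph.Coloring.mk (fun w => tag w.1) fun {w w'} hadj => ?_⟩
  obtain ⟨ℓ, ℓ', hℓ, hswap⟩ := (conflictGraph_adj_iff w w').1 hadj
  rw [hswap]
  exact tag_ne_tag_comp_swap _ (mem_W₀_of_apply_ne _ w.mem_insert ℓ ℓ' hℓ).1 ℓ ℓ' hℓ

/-- Three strings in `W₀` that pairwise arise from each other by a swap of two entries. -/
def triangle : Fin 3 → Fin 4 → Fin 3 := ![![0, 0, 2, 2], ![0, 2, 0, 2], ![0, 2, 2, 0]]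

theorem triangle_mem_W₀ (i : Fin 3) : triangle i ∈ W₀ := by
  revert i
  decide +kernel

theorem triangle_injective : Function.Injective triangle := by
  decide +kernel

theorem exists_triangle_eq_comp_swap : ∀ i j, i ≠ j → ∃ ℓ ℓ' : Fin 4,
    triangle i ℓ ≠ triangle i ℓ' ∧ triangle j = triangle i ∘ Equiv.swap ℓ ℓ' := by
  decide +kernel

theorem exists_isNClique_conflictGraph : ∃ s, conflictGraph.IsNClique 3 s := by
  let vertex : Fin 3 ↪ CodeString := ⟨fun i => ⟨triangle i, Or.inl (triangle_mem_W₀ i)⟩,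
    fun _ _ h => triangle_injective (congrArg Subtype.val h)⟩
  refine ⟨Finset.univ.map vertex, ?_, by simp⟩
  rw [Finset.coe_map, Finset.coe_univ, Set.image_univ]
  rintro _ ⟨i, rfl⟩ _ ⟨j, rfl⟩ hij
  exact (conflictGraph_adj_iff _ _).2
    (exists_triangle_eq_comp_swap i j fun h => hij (congrArg vertex h))

theorem chromaticNumber_conflictGraph : conflictGraph.chromaticNumber = 3 := by
  obtain ⟨s, hs⟩ := exists_isNClique_conflictGraph
  refine le_antisymm colorable_conflictGraph.chromaticNumber_le ?_
  have hclique := hs.isClique.card_le_chromaticNumber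
  rw [hs.card_eq] at hclique
  exact_mod_cast hclique

/-! ### The ancilla dimension -/

theorem one_le_pairCount_comp_swap {D : ℕ} {c : (Fin 4 → Fin 3) → Fin D} {w : Fin 4 → Fin 3}
    {A : Finset (Fin 4 → Fin 3)} {ℓ ℓ' : Fin 4} (hw : w ∈ A) (hw' : w ∘ Equiv.swap ℓ ℓ' ∈ A)
    (hc : c w = c (w ∘ Equiv.swap ℓ ℓ')) :
    1 ≤ pairCount c A A ℓ ℓ' (w ℓ, w ℓ') (w ℓ', w ℓ) := by
  refine le_trans ?_ (Finset.single_le_sum (fun _ _ => Nat.zero_le _) hw)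
  refine le_trans ?_ (Finset.single_le_sum (fun _ _ => Nat.zero_le _) hw')
  rw [if_pos]
  refine ⟨hc, rfl, rfl, ?_, ?_, fun k hleft hright => ?_⟩
  · rw [Function.comp_apply, Equiv.swap_apply_left]
  · rw [Function.comp_apply, Equiv.swap_apply_right]
  · rw [Function.comp_apply, Equiv.swap_apply_of_ne_of_ne hleft hright]

/-- A coherence between `w` and its swap would be positive, while the multi-probe condition makes
it `-|⟨w ℓ| Q₀ |w ℓ'⟩|²`. -/
theorem MultiProbeCondition.apply_ne_apply_comp_swap {D : ℕ} {c : (Fin 4 → Fin 3) → Fin D}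
    {Q : Fin 2 → Op (Fin 3)} (h : MultiProbeCondition qutritL qutritRho Q (taggedCode c))
    {w : Fin 4 → Fin 3} (hw : w ∈ W₀) {ℓ ℓ' : Fin 4} (hℓ : w ℓ ≠ w ℓ')
    (hw' : w ∘ Equiv.swap ℓ ℓ' ∈ W₀) : c w ≠ c (w ∘ Equiv.swap ℓ ℓ') := by
  intro hc
  set count := pairCount c W₀ W₀ ℓ ℓ' (w ℓ, w ℓ') (w ℓ', w ℓ)
  have hcoherence : (1 / 6 : ℂ) * count = -(Complex.normSq (Q 0 (w ℓ) (w ℓ')) : ℂ) := by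
    have hmarginal := congrFun (congrFun (h.2 0 0 ℓ ℓ' (ne_of_apply_ne w hℓ)) (w ℓ, w ℓ'))
      (w ℓ', w ℓ)
    have hρ : qutritRho 0 (w ℓ) (w ℓ') = 0 := Matrix.diagonal_apply_ne _ hℓ
    rw [twoProbeMarginal_taggedCode, amplitude_zero_mul_star, if_pos rfl, Matrix.sub_apply,
      Matrix.kroneckerMap_apply, Matrix.kroneckerMap_apply, hρ, zero_mul, zero_sub,
      ← (h.1 0).1.apply (w ℓ') (w ℓ), RCLike.star_def, Complex.mul_conj] at hmarginal
    exact hmarginal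
  have hreal : (1 / 6 : ℝ) * count = -Complex.normSq (Q 0 (w ℓ) (w ℓ')) :=
    Complex.ofReal_injective (by push_cast; exact hcoherence)
  have hpos : (1 : ℝ) ≤ count := by
    exact_mod_cast one_le_pairCount_comp_swap hw hw' hc
  linarith [Complex.normSq_nonneg (Q 0 (w ℓ) (w ℓ'))]

theorem isLeast_ancilla_dimension :
    IsLeast {D : ℕ | ∃ (c : (Fin 4 → Fin 3) → Fin D) (Q : Fin 2 → Op (Fin 3)),
      MultiProbeCondition qutritL qutritRho Q (taggedCode c)} 3 := by
  refine ⟨⟨tag, qutritQ, code41_eq_taggedCode ▸ multiProbeCondition_code41⟩, ?_⟩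
  rintro D ⟨c, Q, hcond⟩
  have hinj : Function.Injective fun i => c (triangle i) := by
    intro i j hij
    by_contra hne
    obtain ⟨ℓ, ℓ', hℓ, hswap⟩ := exists_triangle_eq_comp_swap i j hne
    exact hcond.apply_ne_apply_comp_swap (triangle_mem_W₀ i) hℓ (hswap ▸ triangle_mem_W₀ j)
      (hswap ▸ hij)
  simpa using Fintype.card_le_of_injective _ hinj

/-! ### Quantum error correction with the code words -/

/-- The recovery channel of the four-probe code `code41`. -/
noncomputable def code41Recovery : SuperOp ((Fin 4 → Fin 3) × Fin 3) :=
  krausMap (recoveryKraus (codeProj code41) (code41 1) fun ℓ => onProbe ℓ qutritL)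

theorem isChannel_code41Recovery : IsChannel code41Recovery :=
  isChannel_recovery codeProj_code41_mul_jumps_mul (conjTranspose_codeProj code41)
    (codeProj_mul_self orthonormal_code41) (orthonormal_code41 1 1)

theorem sandwich_code41Recovery : sandwich (codeProj code41) ∘ₗ code41Recovery = code41Recovery :=
  sandwich_recovery (conjTranspose_codeProj code41) (codeProj_mul_self orthonormal_code41)
    (codeProj_mulVec orthonormal_code41 1)

theorem exists_logical_evolution_code41 (ω : ℝ) (ρ : Op ((Fin 4 → Fin 3) × Fin 3))
    (hρ : sandwich (codeProj code41) ρ = ρ) :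
    ∃ ρL : ℝ → Op ((Fin 4 → Fin 3) × Fin 3), ρL 0 = ρ ∧
      (∀ t a b, HasDerivAt (fun s => ρL s a b)
        (((-Complex.I * ((ω * 4 / 2 : ℝ) : ℂ)) •
          (logicalZ code41 * ρL t - ρL t * logicalZ code41)) a b) t) ∧
      ∀ t : ℝ, 0 ≤ t → Tendsto (fun K : ℕ => rounds (qecOp (codeProj code41) code41Recovery)
        (blockGenerator 4 (Fin 3) qutritH qutritL ω) t K ρ) atTop (𝓝 (ρL t)) := by
  rw [show ω * 4 / 2 = ω * 2 by ring]
  exact exists_logical_evolution orthonormal_code41 codeProj_code41_mul_jump_mul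
    codeProj_code41_mul_jumps_mul codeProj_code41_mul_hamiltonian_mul ω hρ

theorem tendsto_array_rounds_code41 (n : ℕ) (t ω : ℝ) :
    Tendsto (fun K : ℕ => rounds (tensorPower n (qecOp (codeProj code41) code41Recovery))
      (arrayGenerator n 4 (Fin 3) qutritH qutritL ω) t K (ketbra (ghz code41 n) (ghz code41 n)))
      atTop (𝓝 (phaseState (arrayCode code41 n) (n * (ω * (t * (2 : ℝ)))))) :=
  tendsto_array_rounds orthonormal_code41 codeProj_code41_mul_jump_mul
    codeProj_code41_mul_jumps_mul codeProj_code41_mul_hamiltonian_mul n t ω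

theorem array_fisherInformation_code41 {n : ℕ} (hn : 1 ≤ n) {t : ℝ} (ht : 0 ≤ t) (ω : ℝ) :
    IsQFI (fun x : ℝ => phaseState (arrayCode code41 n) (n * (x * (t * (2 : ℝ))))) ω
      (((4 * n : ℕ) : ℝ) ^ 2 * t ^ 2) ∧
    ∃ F : ℕ → ℝ, (∀ K, IsQFI (fun x : ℝ =>
      rounds (tensorPower n (qecOp (codeProj code41) code41Recovery))
        (arrayGenerator n 4 (Fin 3) qutritH qutritL x) t K
        (ketbra (ghz code41 n) (ghz code41 n))) ω (F K)) ∧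
      Tendsto F atTop (𝓝 (((4 * n : ℕ) : ℝ) ^ 2 * t ^ 2)) := by
  rw [show ((4 * n : ℕ) : ℝ) ^ 2 * t ^ 2 = (2 * (n * (t * 2))) ^ 2 by push_cast; ring]
  exact array_fisherInformation orthonormal_code41 codeProj_code41_mul_jump_mul
    codeProj_code41_mul_jumps_mul codeProj_code41_mul_hamiltonian_mul isHermitian_qutritH hn ht ω

end QutritSensing

theorem mainTheorem7 :
    -- the distance of the Hamiltonian to the Lindblad span
    (qutritH ∉ lindbladSpan qutritL ∧
      qutritS ∈ lindbladSpan qutritL ∧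
      qutritH - qutritS = Matrix.diagonal ![1 / 2, -1 / 2, 1 / 2] ∧
      IsLeast ((fun X : Op (Fin 3) => ‖qutritH - X‖) ''
        (lindbladSpan qutritL : Set (Op (Fin 3))))
        ‖qutritH - qutritS‖ ∧
      lindbladDist qutritH qutritL =
        ‖qutritH - qutritS‖ ∧
      ‖qutritH - qutritS‖ = 1 / 2) ∧
    -- `ρ_0`, `ρ_1` are the orthogonal density operators singled out by the two sensing conditions
    ((qutritRho 0 * qutritRho 1).trace = 0 ∧
      ∀ σ : Fin 2 → Op (Fin 3),
        (((∀ k, IsDensity (σ k)) ∧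
          ((σ 0 - σ 1) * qutritH).trace =
            ((2 * lindbladDist qutritH qutritL : ℝ) : ℂ) ∧
          ∀ X ∈ lindbladSpan qutritL, ((σ 0 - σ 1) * X).trace = 0) ↔
        σ = qutritRho)) ∧
    -- the code words are orthonormal and satisfy the multi-probe condition
    ((∀ k k' : Fin 2, star (code41 k) ⬝ᵥ code41 k' =
        if k = k' then 1 else 0) ∧
      MultiProbeCondition qutritL qutritRho qutritQ
        code41) ∧
    -- one recovery channel, independent of `ω`, `t` and the number of blocks
    (∃ R : SuperOp ((Fin 4 → Fin 3) × Fin 3),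
      IsChannel R ∧
      sandwich (codeProj code41) ∘ₗ R = R ∧
      -- in the limit of fast error correction the logical state obeys the noiseless equation
      (∀ (ω : ℝ) (ρ : Op ((Fin 4 → Fin 3) × Fin 3)),
        sandwich (codeProj code41) ρ = ρ →
        ∃ ρL : ℝ → Op ((Fin 4 → Fin 3) × Fin 3),
          ρL 0 = ρ ∧
          (∀ t a b, HasDerivAt (fun s => ρL s a b)
            (((-Complex.I * ((ω * 4 / 2 : ℝ) : ℂ)) •
              (logicalZ code41 * ρL t -
                ρL t * logicalZ code41)) a b) t) ∧
          ∀ t : ℝ, 0 ≤ t → Tendsto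
            (fun K : ℕ => rounds
              (qecOp (codeProj code41) R)
              (blockGenerator 4 (Fin 3) qutritH qutritL ω) t K ρ)
            atTop (𝓝 (ρL t))) ∧
      -- `N = 4 n` probes prepared in the logical GHZ state reach QFI `N² t²`
      (∀ n : ℕ, 1 ≤ n →
        ∃ (ρK : ℕ → ℝ → ℝ → Op (Fin n → (Fin 4 → Fin 3) × Fin 3))
          (ρlim : ℝ → ℝ → Op (Fin n → (Fin 4 → Fin 3) × Fin 3))
          (F : ℕ → ℝ → ℝ → ℝ),
          (∀ K t ω, ρK K t ω = rounds
            (tensorPower n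
              (qecOp (codeProj code41) R))
            (arrayGenerator n 4 (Fin 3) qutritH qutritL ω) t K
            (ketbra (ghz code41 n)
              (ghz code41 n))) ∧
          ∀ t : ℝ, 0 ≤ t → ∀ ω : ℝ,
            Tendsto (fun K => ρK K t ω) atTop (𝓝 (ρlim t ω)) ∧
            IsQFI (ρlim t) ω (((4 * n : ℕ) : ℝ) ^ 2 * t ^ 2) ∧
            (∀ K, IsQFI (ρK K t) ω (F K t ω)) ∧
            Tendsto (fun K => F K t ω) atTop (𝓝 (((4 * n : ℕ) : ℝ) ^ 2 * t ^ 2)))) ∧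
    -- ancilla dimension three is the minimum for the construction
    (IsLeast {D : ℕ | ∃ (c : (Fin 4 → Fin 3) → Fin D) (Q' : Fin 2 → Op (Fin 3)),
        MultiProbeCondition qutritL qutritRho Q'
          (taggedCode c)} 3 ∧
      (∀ w w' : CodeString, conflictGraph.Adj w w' ↔
        ∃ ℓ ℓ' : Fin 4, w.1 ℓ ≠ w.1 ℓ' ∧ w'.1 = w.1 ∘ Equiv.swap ℓ ℓ') ∧
      conflictGraph.chromaticNumber = 3) := by
  refine ⟨⟨qutritH_notMem_lindbladSpan, qutritS_mem_lindbladSpan, qutritH_sub_qutritS,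
      isLeast_norm_qutritH_sub, lindbladDist_qutrit, norm_qutritH_sub_qutritS⟩,
    ⟨trace_qutritRho_zero_mul_qutritRho_one, optimal_pair_iff⟩,
    ⟨orthonormal_code41, multiProbeCondition_code41⟩,
    ⟨code41Recovery, isChannel_code41Recovery, sandwich_code41Recovery,
      exists_logical_evolution_code41, fun n hn => ?_⟩,
    isLeast_ancilla_dimension, conflictGraph_adj_iff, chromaticNumber_conflictGraph⟩
  choose! F hF using fun t (ht : 0 ≤ t) ω => (array_fisherInformation_code41 hn ht ω).2
  exact ⟨_, fun t ω => phaseState (arrayCode code41 n) (n * (ω * (t * (2 : ℝ)))),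
    fun K t ω => F t ω K, fun K t ω => rfl, fun t ht ω => ⟨tendsto_array_rounds_code41 n t ω,
      (array_fisherInformation_code41 hn ht ω).1, hF t ht ω⟩⟩
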